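/- Let $k$ be a field, $n\ge 2$ an integer, and $q\in k$ a primitive $n$-th root of unity. Let $R=U_n(q)=k\langle G,X\mid G^n=1,\ X^n=0,\ GX=qXG\rangle$ be the Taft algebra (half quantum group), with $\Delta(G)=G\otimes G$, $\Delta(X)=X\otimes G+1\otimes X$, $\varepsilon(G)=1$, $\varepsilon(X)=0$, and let $$D(R)=k\langle a,b,c,d\mid a^n=0=d^n,\ b^n=1=c^n,\ ba=qab,\ dc=qcd,\ db=qbd,\ bc=cb,\ ca=qac,\ da-qad=1-bc\rangle$$ be its Drinfeld double, which contains $R$ through $G\mapsto b$, $X\mapsto a$. Let $R^+=\ker\varepsilon$ and let $Q=D(R)/R^+D(R)$, regarded as a right $R$-module; tensor products over $k$ of right $R$-modules carry the diagonal action $(v\otimes w)h=\sum vh_{(1)}\otimes wh_{(2)}$. Write $M\sim N$ (similar) if there are positive integers $r,s$ such that $M$ is isomorphic to a direct summand of $N^{r}$ and $N$ is isomorphic to a direct summand of $M^{s}$. The depth of a right $R$-module $V$ is the least integer $m\ge 0$ such that $p_m(V)\sim p_{m+1}(V)$, where $p_0(V)=k$ is the trivial module and $p_m(V)=V\oplus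 V^{\otimes 2}\oplus\cdots\oplus V^{\otimes m}$ for $m\ge 1$. A ring extension $B\subseteq A$ has right (respectively left) depth $2m$, for $m\ge 1$, if $A^{\otimes_B m}\sim A^{\otimes_B (m+1)}$ as $A$-$B$-bimodules (respectively as $B$-$A$-bimodules); $d_{ev}(B,A)$ denotes the least such even number. Then $Q\not\sim Q\otimes Q$ but $Q\otimes Q\sim Q\otimes Q\otimes Q$ as right $R$-modules. Hence the depth of $Q$ as a $U_n(q)$-module is $2$, and the minimum even depth is $d_{ev}(U_n(q),D(U_n(q)))=6$, both for right and for left depth. -/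

import Mathlib

open scoped TensorProduct
open MulOpposite (op)

universe u

namespace QuantumDepth

/-! ### Similarity of modules -/

section Similarity

variable (A : Type u) [Ring A]

/-- `M ∥ N`: the `A`-module `M` is isomorphic to a direct summand of `N`
(there is a split monomorphism `M → N`). -/
def IsSummand (M N : Type u) [AddCommGroup M] [Module A M] [AddCommGroup N] [Module A N] : Prop :=
  ∃ (f : M →ₗ[A] N) (g : N →ₗ[A] M), g ∘ₗ f = LinearMap.id

/-- `M ∼ N`: `M ∥ r · N` and `N ∥ s · M` for some positive integers `r`, `s`, where
`r · N = N ⊕ ⋯ ⊕ N` (`r` times). -/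
def IsSimilar (M N : Type u) [AddCommGroup M] [Module A M] [AddCommGroup N] [Module A N] : Prop :=
  (∃ r : ℕ, 0 < r ∧ IsSummand A M (Fin r → N)) ∧ (∃ s : ℕ, 0 < s ∧ IsSummand A N (Fin s → M))

end Similarity

/-! ### Right modules over a bialgebra, tensor products, depth -/

/-- A right module over the `k`-algebra `H`; its `k`-structure is the one induced from `H`. -/
structure RightMod (k H : Type u) [Field k] [Ring H] [Algebra k H] where
  carrier : Type u
  [addCommGroup : AddCommGroup carrier]
  [baseModule : Module k carrier]
  [rightModule : Module Hᵐᵒᵖ carrier]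
  [tower : IsScalarTower k Hᵐᵒᵖ carrier]

attribute [instance] RightMod.addCommGroup RightMod.baseModule RightMod.rightModule RightMod.tower

namespace RightMod

variable {k H : Type u} [Field k] [Ring H]

section Algebra

variable [Algebra k H]

/-- Similarity of right `H`-modules. -/
def Similar (V W : RightMod k H) : Prop := IsSimilar Hᵐᵒᵖ V.carrier W.carrier

/-- Restriction of a right `H`-module along an algebra map `i : R → H`: `v · r = v · i r`. -/
noncomputable def restrict {R : Type u} [Ring R] [Algebra k R] (i : R →ₐ[k] H)
    (V : RightMod k H) : RightMod k R :=
  letI : Module Rᵐᵒᵖ V.carrier := Module.compHom V.carrier (AlgHom.op i).toRingHom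
  haveI : IsScalarTower k Rᵐᵒᵖ V.carrier := ⟨fun c r v => by
    change AlgHom.op i (c • r) • v = c • (AlgHom.op i r • v)
    rw [map_smul, smul_assoc]⟩
  { carrier := V.carrier }

end Algebra

variable [Bialgebra k H]

/-- The trivial right module `k`: `c · h = ε(h) c`. -/
noncomputable def trivial (k H : Type u) [Field k] [Ring H] [Bialgebra k H] : RightMod k H :=
  letI act : Hᵐᵒᵖ →ₐ[k] k :=
    (AlgEquiv.toOpposite k k).symm.toAlgHom.comp (AlgHom.op (Bialgebra.counitAlgHom k H))
  letI : Module Hᵐᵒᵖ k := Module.compHom k act.toRingHom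
  haveI : IsScalarTower k Hᵐᵒᵖ k := ⟨fun c r v => by
    change act (c • r) * v = c * (act r * v)
    rw [map_smul, smul_eq_mul, mul_assoc]⟩
  { carrier := k }

/-- The diagonal right action of `H` on `V ⊗ W`, `(v ⊗ w) · h = ∑ v · h₁ ⊗ w · h₂`, as an
algebra map. -/
noncomputable def tensorAct (V W : RightMod k H) :
    Hᵐᵒᵖ →ₐ[k] Module.End k (V.carrier ⊗[k] W.carrier) :=
  (Module.endTensorEndAlgHom (R := k) (S := k) (A := k)).comp <|
    (Algebra.TensorProduct.map (Algebra.lsmul k k V.carrier) (Algebra.lsmul k k W.carrier)).comp <|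
      (Algebra.TensorProduct.opAlgEquiv k k H H).symm.toAlgHom.comp
        (AlgHom.op (Bialgebra.comulAlgHom k H))

/-- The vector space `V ⊗ W`, as a type of its own, so that the diagonal action is the only
action of `H` on it. -/
def TensorCarrier (V W : RightMod k H) : Type u := V.carrier ⊗[k] W.carrier

noncomputable instance (V W : RightMod k H) : AddCommGroup (TensorCarrier V W) :=
  inferInstanceAs (AddCommGroup (V.carrier ⊗[k] W.carrier))

noncomputable instance (V W : RightMod k H) : Module k (TensorCarrier V W) :=
  inferInstanceAs (Module k (V.carrier ⊗[k] W.carrier))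

noncomputable instance (V W : RightMod k H) : Module Hᵐᵒᵖ (TensorCarrier V W) :=
  letI : Module (Module.End k (V.carrier ⊗[k] W.carrier)) (TensorCarrier V W) :=
    inferInstanceAs (Module (Module.End k (V.carrier ⊗[k] W.carrier)) (V.carrier ⊗[k] W.carrier))
  Module.compHom (TensorCarrier V W) (tensorAct V W).toRingHom

instance (V W : RightMod k H) : IsScalarTower k Hᵐᵒᵖ (TensorCarrier V W) :=
  ⟨fun c r v => by
    change tensorAct V W (c • r) v = c • (tensorAct V W r v)
    rw [map_smul]
    rfl⟩

/-- The tensor product `V ⊗ W` of right `H`-modules, with the diagonal action. -/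
noncomputable def tensor (V W : RightMod k H) : RightMod k H where
  carrier := TensorCarrier V W

/-- Tensor powers: `V^{⊗0} = k` and `V^{⊗(m+1)} = V^{⊗m} ⊗ V`. -/
noncomputable def tensorPow (V : RightMod k H) : ℕ → RightMod k H
  | 0 => trivial k H
  | m + 1 => (tensorPow V m).tensor V

/-- `p₀(V) = k` and `p_m(V) = V ⊕ V^{⊗2} ⊕ ⋯ ⊕ V^{⊗m}` for `m ≥ 1`. -/
noncomputable def powerSum (V : RightMod k H) : ℕ → RightMod k H
  | 0 => trivial k H
  | m + 1 => { carrier := ∀ i : Fin (m + 1), (V.tensorPow (i + 1)).carrier }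

/-- `V` has depth `d`: `d` is the least natural number with `p_d(V) ∼ p_{d+1}(V)`. -/
def HasDepth (V : RightMod k H) (d : ℕ) : Prop :=
  IsLeast {m : ℕ | (V.powerSum m).Similar (V.powerSum (m + 1))} d

end RightMod

/-! ### The quotient module of `R ⊆ H` -/

section Quotient

variable {k R H : Type u} [Field k] [Ring R] [Bialgebra k R] [Ring H] [Algebra k H]

/-- The right ideal `R⁺H` of `H`, where `R⁺ = ker ε`. -/
def augmentationIdeal (i : R →ₐ[k] H) : Submodule Hᵐᵒᵖ H :=
  Submodule.span Hᵐᵒᵖ (i '' {r : R | Coalgebra.counit (R := k) r = 0})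

/-- The right `H`-module `H / R⁺H`. -/
noncomputable def quotientModule (i : R →ₐ[k] H) : RightMod k H where
  carrier := H ⧸ augmentationIdeal i

end Quotient

/-! ### Bimodules and the minimum even depth of a ring extension -/

/-- An `A`-`B`-bimodule. -/
structure BiMod (A B : Type u) [Ring A] [Ring B] where
  carrier : Type u
  [addCommGroup : AddCommGroup carrier]
  [leftModule : Module A carrier]
  [rightModule : Module Bᵐᵒᵖ carrier]
  [comm : SMulCommClass A Bᵐᵒᵖ carrier]

attribute [instance] BiMod.addCommGroup BiMod.leftModule BiMod.rightModule BiMod.comm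

namespace BiMod

variable {A B C : Type u} [Ring A] [Ring B] [Ring C]

/-- `X ∥ r · Y` as `A`-`B`-bimodules: there are bimodule maps `X → Y ⊕ ⋯ ⊕ Y → X` (`r` copies of
`Y`) composing to the identity of `X`. -/
def IsSummandOfCopies (X Y : BiMod A B) (r : ℕ) : Prop :=
  ∃ (f : X.carrier →ₗ[A] (Fin r → Y.carrier)) (g : (Fin r → Y.carrier) →ₗ[A] X.carrier),
    (∀ (b : B) (x : X.carrier), f (op b • x) = op b • f x) ∧
    (∀ (b : B) (y : Fin r → Y.carrier), g (op b • y) = op b • g y) ∧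
    g ∘ₗ f = LinearMap.id

/-- Similarity of `A`-`B`-bimodules. -/
def Similar (X Y : BiMod A B) : Prop :=
  (∃ r : ℕ, 0 < r ∧ IsSummandOfCopies X Y r) ∧ (∃ s : ℕ, 0 < s ∧ IsSummandOfCopies Y X s)

/-- The regular bimodule `A`. -/
def regular (A : Type u) [Ring A] : BiMod A A where
  carrier := A

/-- Restriction of the left action along `i : B → A`. -/
def restrictLeft (i : B →+* A) (X : BiMod A C) : BiMod B C :=
  letI : Module B X.carrier := Module.compHom X.carrier i
  haveI : SMulCommClass B Cᵐᵒᵖ X.carrier := ⟨fun b c x => smul_comm (i b) c x⟩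
  { carrier := X.carrier }

/-- Restriction of the right action along `i : B → A`. -/
def restrictRight (i : B →+* A) (X : BiMod C A) : BiMod C B :=
  letI : Module Bᵐᵒᵖ X.carrier := Module.compHom X.carrier i.op
  haveI : SMulCommClass C Bᵐᵒᵖ X.carrier := ⟨fun c b x => smul_comm c (i.op b) x⟩
  { carrier := X.carrier }

section Tensor

variable (X : BiMod A B) (Y : BiMod B C)

/-- The subgroup of `X ⊗_ℤ Y` generated by the elements `x b ⊗ y - x ⊗ b y`. -/
def balancing : AddSubgroup (X.carrier ⊗[ℤ] Y.carrier) :=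
  AddSubgroup.closure {t | ∃ (x : X.carrier) (b : B) (y : Y.carrier),
    t = (op b • x) ⊗ₜ[ℤ] y - x ⊗ₜ[ℤ] (b • y)}

/-- The abelian group `X ⊗_B Y`. -/
abbrev TensorCarrier : Type u := (X.carrier ⊗[ℤ] Y.carrier) ⧸ balancing X Y

/-- The endomorphism `x ⊗ y ↦ f x ⊗ g y` of `X ⊗_B Y`, for additive maps `f`, `g` commuting with
the actions of `B`. -/
def tensorMap (f : X.carrier →+ X.carrier) (g : Y.carrier →+ Y.carrier)
    (hf : ∀ (b : B) (x : X.carrier), f (op b • x) = op b • f x)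
    (hg : ∀ (b : B) (y : Y.carrier), g (b • y) = b • g y) :
    AddMonoid.End (TensorCarrier X Y) :=
  QuotientAddGroup.map _ _
    (TensorProduct.map f.toIntLinearMap g.toIntLinearMap).toAddMonoidHom (by
      rw [balancing, AddSubgroup.closure_le]
      rintro _ ⟨x, b, y, rfl⟩
      refine AddSubgroup.subset_closure ⟨f x, b, g y, ?_⟩
      refine (map_sub (TensorProduct.map f.toIntLinearMap g.toIntLinearMap).toAddMonoidHom
        _ _).trans ?_
      simp [hf, hg])

variable {X Y} in
theorem end_ext {φ ψ : AddMonoid.End (TensorCarrier X Y)}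
    (h : ∀ (x : X.carrier) (y : Y.carrier), φ (QuotientAddGroup.mk (x ⊗ₜ[ℤ] y)) =
      ψ (QuotientAddGroup.mk (x ⊗ₜ[ℤ] y))) : φ = ψ := by
  refine QuotientAddGroup.addMonoidHom_ext _ (AddMonoidHom.ext fun t => ?_)
  induction t using TensorProduct.induction_on with
  | zero => rw [map_zero, map_zero]
  | tmul x y => exact h x y
  | add s t hs ht => rw [map_add, map_add, hs, ht]

/-- The left action of `A` on `X ⊗_B Y`: `a (x ⊗ y) = a x ⊗ y`. -/
def tensorLeft : A →+* AddMonoid.End (TensorCarrier X Y) where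
  toFun a := tensorMap X Y (DistribSMul.toAddMonoidHom X.carrier a) (AddMonoidHom.id _)
    (fun b x => smul_comm a (op b) x) (fun _ _ => rfl)
  map_one' := end_ext fun x y => congrArg QuotientAddGroup.mk
    (show ((1 : A) • x) ⊗ₜ[ℤ] y = x ⊗ₜ[ℤ] y by rw [one_smul])
  map_mul' a a' := end_ext fun x y => congrArg QuotientAddGroup.mk
    (show ((a * a') • x) ⊗ₜ[ℤ] y = (a • a' • x) ⊗ₜ[ℤ] y by rw [mul_smul])
  map_zero' := end_ext fun x y => congrArg QuotientAddGroup.mk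
    (show ((0 : A) • x) ⊗ₜ[ℤ] y = 0 by rw [zero_smul, TensorProduct.zero_tmul])
  map_add' a a' := end_ext fun x y => congrArg QuotientAddGroup.mk
    (show ((a + a') • x) ⊗ₜ[ℤ] y = (a • x) ⊗ₜ[ℤ] y + (a' • x) ⊗ₜ[ℤ] y by
      rw [add_smul, TensorProduct.add_tmul])

/-- The right action of `C` on `X ⊗_B Y`: `(x ⊗ y) c = x ⊗ y c`. -/
def tensorRight : Cᵐᵒᵖ →+* AddMonoid.End (TensorCarrier X Y) where
  toFun c := tensorMap X Y (AddMonoidHom.id _) (DistribSMul.toAddMonoidHom Y.carrier c)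
    (fun _ _ => rfl) (fun b y => (smul_comm b c y).symm)
  map_one' := end_ext fun x y => congrArg QuotientAddGroup.mk
    (show x ⊗ₜ[ℤ] ((1 : Cᵐᵒᵖ) • y) = x ⊗ₜ[ℤ] y by rw [one_smul])
  map_mul' c c' := end_ext fun x y => congrArg QuotientAddGroup.mk
    (show x ⊗ₜ[ℤ] ((c * c') • y) = x ⊗ₜ[ℤ] (c • c' • y) by rw [mul_smul])
  map_zero' := end_ext fun x y => congrArg QuotientAddGroup.mk
    (show x ⊗ₜ[ℤ] ((0 : Cᵐᵒᵖ) • y) = 0 by rw [zero_smul, TensorProduct.tmul_zero])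
  map_add' c c' := end_ext fun x y => congrArg QuotientAddGroup.mk
    (show x ⊗ₜ[ℤ] ((c + c') • y) = x ⊗ₜ[ℤ] (c • y) + x ⊗ₜ[ℤ] (c' • y) by
      rw [add_smul, TensorProduct.tmul_add])

theorem tensorLeft_comm (a : A) (c : Cᵐᵒᵖ) :
    tensorLeft X Y a * tensorRight X Y c = tensorRight X Y c * tensorLeft X Y a :=
  end_ext fun _ _ => rfl

/-- The tensor product `X ⊗_B Y` of an `A`-`B`-bimodule and a `B`-`C`-bimodule, an
`A`-`C`-bimodule. -/
def tensor : BiMod A C :=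
  letI : Module A (TensorCarrier X Y) := Module.compHom _ (tensorLeft X Y)
  letI : Module Cᵐᵒᵖ (TensorCarrier X Y) := Module.compHom _ (tensorRight X Y)
  haveI : SMulCommClass A Cᵐᵒᵖ (TensorCarrier X Y) :=
    ⟨fun a c t => DFunLike.congr_fun (tensorLeft_comm X Y a c) t⟩
  { carrier := TensorCarrier X Y }

end Tensor

/-- `A^{⊗_B (m+1)} = A ⊗_B ⋯ ⊗_B A` (`m + 1` factors) as an `A`-`A`-bimodule, for a ring
extension `i : B → A`. -/
def relTensorPow (i : B →+* A) : ℕ → BiMod A A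
  | 0 => regular A
  | m + 1 => ((relTensorPow i m).restrictRight i).tensor ((regular A).restrictLeft i)

/-- The extension `i : B → A` has right depth `d = 2(m+1)`, a positive even number:
`A^{⊗_B (m+1)} ∼ A^{⊗_B (m+2)}` as `A`-`B`-bimodules. -/
def HasRightEvenDepth (i : B →+* A) (d : ℕ) : Prop :=
  ∃ m : ℕ, d = 2 * (m + 1) ∧
    ((relTensorPow i m).restrictRight i).Similar ((relTensorPow i (m + 1)).restrictRight i)

/-- The extension `i : B → A` has left depth `d = 2(m+1)`, a positive even number:
`A^{⊗_B (m+1)} ∼ A^{⊗_B (m+2)}` as `B`-`A`-bimodules. -/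
def HasLeftEvenDepth (i : B →+* A) (d : ℕ) : Prop :=
  ∃ m : ℕ, d = 2 * (m + 1) ∧
    ((relTensorPow i m).restrictLeft i).Similar ((relTensorPow i (m + 1)).restrictLeft i)

end BiMod

/-! ### The `q`-binomial theorem at a root of unity

Used only to see that the comultiplication of the Taft algebra is well defined. -/

section QBinomial

variable {k : Type u} [Field k]

/-- The `q`-binomial coefficients. -/
def qBinom (q : k) : ℕ → ℕ → k
  | _, 0 => 1
  | 0, _ + 1 => 0
  | m + 1, j + 1 => qBinom q m j + q ^ (j + 1) * qBinom q m (j + 1)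

theorem qBinom_zero_right (q : k) (m : ℕ) : qBinom q m 0 = 1 := by cases m <;> rfl

theorem qBinom_of_lt (q : k) : ∀ m j : ℕ, m < j → qBinom q m j = 0
  | 0, j + 1, _ => rfl
  | m + 1, j + 1, h => by
    rw [qBinom, qBinom_of_lt q m j (by omega), qBinom_of_lt q m (j + 1) (by omega)]
    simp

theorem qBinom_self (q : k) : ∀ m : ℕ, qBinom q m m = 1
  | 0 => rfl
  | m + 1 => by rw [qBinom, qBinom_self q m, qBinom_of_lt q m (m + 1) (by omega)]; simp

theorem qBinom_step (q : k) : ∀ m j : ℕ,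
    q ^ j * (q ^ (j + 1) - 1) * qBinom q m (j + 1) = (q ^ m - q ^ j) * qBinom q m j
  | 0, 0 => by simp [qBinom]
  | 0, j + 1 => by simp [qBinom]
  | m + 1, 0 => by
    have h := qBinom_step q m 0
    simp only [qBinom, qBinom_zero_right] at h ⊢
    linear_combination q * h
  | m + 1, j + 1 => by
    have h := qBinom_step q m j
    have h' := qBinom_step q m (j + 1)
    simp only [qBinom] at h h' ⊢
    linear_combination q ^ (j + 2) * h' + q * h

theorem qBinom_root {q : k} {n : ℕ} (hq : IsPrimitiveRoot q n) :
    ∀ j : ℕ, j + 1 < n → qBinom q n (j + 1) = 0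
  | j, hj => by
    have hq0 : q ≠ 0 := hq.ne_zero (by omega)
    have hne : q ^ (j + 1) - 1 ≠ 0 := sub_ne_zero.mpr (hq.pow_ne_one_of_pos_of_lt (by omega) hj)
    have h := qBinom_step q n j
    have hz : (q ^ n - q ^ j) * qBinom q n j = 0 := by
      cases j with
      | zero => simp [hq.pow_eq_one]
      | succ j => rw [qBinom_root hq j (by omega), mul_zero]
    rw [hz] at h
    exact (mul_eq_zero.mp h).resolve_left (mul_ne_zero (pow_ne_zero _ hq0) hne)

variable {S : Type u} [Ring S] [Algebra k S]

theorem mul_pow_of_qcomm {q : k} {x y : S} (h : x * y = q • (y * x)) (i : ℕ) :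
    x * y ^ i = q ^ i • (y ^ i * x) := by
  induction i with
  | zero => simp
  | succ i ih =>
    rw [pow_succ, ← mul_assoc, ih, smul_mul_assoc, mul_assoc, h, mul_smul_comm, smul_smul,
      ← mul_assoc, pow_succ]

theorem add_pow_qcomm {q : k} {x y : S} (h : x * y = q • (y * x)) (m : ℕ) :
    (y + x) ^ m = ∑ p ∈ Finset.HasAntidiagonal.antidiagonal m, qBinom q m p.1 • (y ^ p.1 * x ^ p.2) := by
  induction m with
  | zero => simp [qBinom]
  | succ m ih =>
    have e1 : ∑ p ∈ Finset.HasAntidiagonal.antidiagonal m, (qBinom q m p.1 * q ^ p.1) • (y ^ p.1 * x ^ (p.2 + 1))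
        = x ^ (m + 1) + ∑ p ∈ Finset.HasAntidiagonal.antidiagonal m,
          (qBinom q m (p.1 + 1) * q ^ (p.1 + 1)) • (y ^ (p.1 + 1) * x ^ p.2) := by
      have a := Finset.Nat.sum_antidiagonal_succ (n := m)
        (f := fun p => (qBinom q m p.1 * q ^ p.1) • (y ^ p.1 * x ^ p.2))
      have b := Finset.Nat.sum_antidiagonal_succ' (n := m)
        (f := fun p => (qBinom q m p.1 * q ^ p.1) • (y ^ p.1 * x ^ p.2))
      rw [a] at b
      simpa [qBinom_zero_right, qBinom_of_lt q m (m + 1) (by omega)] using b.symm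
    rw [pow_succ', ih, add_mul, Finset.mul_sum, Finset.mul_sum, Finset.Nat.sum_antidiagonal_succ]
    have e2 : ∑ p ∈ Finset.HasAntidiagonal.antidiagonal m, x * qBinom q m p.1 • (y ^ p.1 * x ^ p.2)
        = ∑ p ∈ Finset.HasAntidiagonal.antidiagonal m,
          (qBinom q m p.1 * q ^ p.1) • (y ^ p.1 * x ^ (p.2 + 1)) := by
      refine Finset.sum_congr rfl fun p _ => ?_
      rw [mul_smul_comm, ← mul_assoc, mul_pow_of_qcomm h, smul_mul_assoc, smul_smul, mul_assoc,
        ← pow_succ']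
    rw [e2, e1]
    simp only [qBinom, add_smul, Finset.sum_add_distrib, one_smul, pow_zero,
      one_mul, mul_smul_comm, ← mul_assoc, ← pow_succ', mul_comm]
    abel

theorem add_pow_root {q : k} {n : ℕ} (hn : 0 < n) (hq : IsPrimitiveRoot q n) {x y : S}
    (h : x * y = q • (y * x)) : (y + x) ^ n = y ^ n + x ^ n := by
  obtain ⟨m, rfl⟩ : ∃ m, n = m + 1 := ⟨n - 1, by omega⟩
  rw [add_pow_qcomm h, Finset.Nat.sum_antidiagonal_succ, Finset.sum_eq_single (m, 0)]
  · simp [qBinom_zero_right, qBinom_self, add_comm]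
  · rintro ⟨i, j⟩ hp hne
    have hij : i + j = m := by simpa using hp
    have : i ≠ m := by
      rintro rfl
      exact hne (by simp; omega)
    rw [qBinom_root hq i (by omega), zero_smul]
  · intro hp
    exact absurd (by simp) hp

end QBinomial

/-! ### The Taft algebra `U_n(q)` -/

inductive TaftGen : Type
  | G | X

open TaftGen in
/-- The defining relations of the Taft algebra: `Gⁿ = 1`, `Xⁿ = 0`, `GX = q XG`. -/
inductive TaftRel (k : Type u) [Field k] (n : ℕ) (q : k) :
    FreeAlgebra k TaftGen → FreeAlgebra k TaftGen → Prop
  | G_pow : TaftRel k n q (FreeAlgebra.ι k G ^ n) 1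
  | X_pow : TaftRel k n q (FreeAlgebra.ι k X ^ n) 0
  | G_X : TaftRel k n q (FreeAlgebra.ι k G * FreeAlgebra.ι k X)
      (q • (FreeAlgebra.ι k X * FreeAlgebra.ι k G))

/-- The half quantum group `U_n(q) = k⟨G, X | Gⁿ = 1, Xⁿ = 0, GX = q XG⟩`. -/
def Taft (k : Type u) [Field k] (n : ℕ) (q : k) : Type u := RingQuot (TaftRel k n q)

noncomputable instance (k : Type u) [Field k] (n : ℕ) (q : k) : Ring (Taft k n q) :=
  inferInstanceAs (Ring (RingQuot (TaftRel k n q)))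

noncomputable instance (k : Type u) [Field k] (n : ℕ) (q : k) : Algebra k (Taft k n q) :=
  inferInstanceAs (Algebra k (RingQuot (TaftRel k n q)))

namespace Taft

variable {k : Type u} [Field k] (n : ℕ) (q : k)

/-- The quotient map from the free algebra. -/
noncomputable def mk : FreeAlgebra k TaftGen →ₐ[k] Taft k n q :=
  RingQuot.mkAlgHom k (TaftRel k n q)

theorem mk_rel {s t : FreeAlgebra k TaftGen} (h : TaftRel k n q s t) : mk n q s = mk n q t :=
  RingQuot.mkAlgHom_rel k h

noncomputable def gen (x : TaftGen) : Taft k n q := mk n q (FreeAlgebra.ι k x)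

noncomputable abbrev G : Taft k n q := gen n q TaftGen.G

noncomputable abbrev X : Taft k n q := gen n q TaftGen.X

theorem G_pow : G n q ^ n = 1 := by
  simpa [gen] using mk_rel n q TaftRel.G_pow

theorem X_pow : X n q ^ n = 0 := by
  simpa [gen] using mk_rel n q TaftRel.X_pow

theorem G_mul_X : G n q * X n q = q • (X n q * G n q) := by
  simpa [gen] using mk_rel n q TaftRel.G_X

variable {n q} {S : Type u} [Ring S] [Algebra k S]

/-- The algebra map `U_n(q) → S` with `G ↦ g`, `X ↦ x`. -/
noncomputable def lift (g x : S) (hg : g ^ n = 1) (hx : x ^ n = 0) (hgx : g * x = q • (x * g)) :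
    Taft k n q →ₐ[k] S :=
  RingQuot.liftAlgHom k ⟨FreeAlgebra.lift k (fun t => match t with
    | TaftGen.G => g
    | TaftGen.X => x), by
      intro a b h
      cases h <;> simp [hg, hx, hgx]⟩

section Lift

variable (g x : S) (hg : g ^ n = 1) (hx : x ^ n = 0) (hgx : g * x = q • (x * g))

@[simp] theorem lift_G : lift g x hg hx hgx (G n q) = g := by
  exact (RingQuot.liftAlgHom_mkAlgHom_apply _ _ _ _).trans (by simp)

@[simp] theorem lift_X : lift g x hg hx hgx (X n q) = x := by
  exact (RingQuot.liftAlgHom_mkAlgHom_apply _ _ _ _).trans (by simp)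

end Lift

theorem algHom_ext {f f' : Taft k n q →ₐ[k] S} (hG : f (G n q) = f' (G n q))
    (hX : f (X n q) = f' (X n q)) : f = f' := by
  refine RingQuot.ringQuot_ext' k _ _ (FreeAlgebra.hom_ext ?_)
  funext t
  cases t
  · exact hG
  · exact hX

variable (n q)

/-- `Δ(G) = G ⊗ G`, `Δ(X) = X ⊗ G + 1 ⊗ X`. -/
noncomputable def comulHom [NeZero n] [hq : Fact (IsPrimitiveRoot q n)] :
    Taft k n q →ₐ[k] Taft k n q ⊗[k] Taft k n q :=
  lift (G n q ⊗ₜ G n q) (X n q ⊗ₜ G n q + 1 ⊗ₜ X n q)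
    (by rw [Algebra.TensorProduct.tmul_pow, G_pow]; rfl)
    (by
      rw [add_comm, add_pow_root (q := q) (NeZero.pos n) hq.out]
      · simp [Algebra.TensorProduct.tmul_pow, X_pow]
      · simp [G_mul_X])
    (by simp [mul_add, add_mul, G_mul_X, TensorProduct.smul_tmul'])

/-- `ε(G) = 1`, `ε(X) = 0`. -/
noncomputable def counitHom [NeZero n] : Taft k n q →ₐ[k] k :=
  lift 1 0 (one_pow n) (zero_pow (NeZero.ne n)) (by simp)

/-- The bialgebra structure of `U_n(q)` (its antipode plays no role here). -/
noncomputable instance [NeZero n] [hq : Fact (IsPrimitiveRoot q n)] : Bialgebra k (Taft k n q) :=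
  Bialgebra.ofAlgHom (comulHom n q) (counitHom n q)
    (algHom_ext (by simp [comulHom])
      (by simp [comulHom, TensorProduct.add_tmul, TensorProduct.tmul_add, add_assoc,
            Algebra.TensorProduct.one_def]))
    (algHom_ext (by simp [comulHom, counitHom]) (by simp [comulHom, counitHom]))
    (algHom_ext (by simp [comulHom, counitHom]) (by simp [comulHom, counitHom]))

end Taft

/-! ### The Drinfeld double `D(U_n(q))` -/

inductive DoubleGen : Type
  | a | b | c | d

open DoubleGen in
/-- The defining relations of `D(U_n(q))`: `aⁿ = 0 = dⁿ`, `bⁿ = 1 = cⁿ`, `ba = q ab`, `dc = q cd`,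
`db = q bd`, `bc = cb`, `ca = q ac`, `da - q ad = 1 - bc`. -/
inductive DoubleRel (k : Type u) [Field k] (n : ℕ) (q : k) :
    FreeAlgebra k DoubleGen → FreeAlgebra k DoubleGen → Prop
  | a_pow : DoubleRel k n q (FreeAlgebra.ι k a ^ n) 0
  | d_pow : DoubleRel k n q (FreeAlgebra.ι k d ^ n) 0
  | b_pow : DoubleRel k n q (FreeAlgebra.ι k b ^ n) 1
  | c_pow : DoubleRel k n q (FreeAlgebra.ι k c ^ n) 1
  | b_a : DoubleRel k n q (FreeAlgebra.ι k b * FreeAlgebra.ι k a)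
      (q • (FreeAlgebra.ι k a * FreeAlgebra.ι k b))
  | d_c : DoubleRel k n q (FreeAlgebra.ι k d * FreeAlgebra.ι k c)
      (q • (FreeAlgebra.ι k c * FreeAlgebra.ι k d))
  | d_b : DoubleRel k n q (FreeAlgebra.ι k d * FreeAlgebra.ι k b)
      (q • (FreeAlgebra.ι k b * FreeAlgebra.ι k d))
  | b_c : DoubleRel k n q (FreeAlgebra.ι k b * FreeAlgebra.ι k c)
      (FreeAlgebra.ι k c * FreeAlgebra.ι k b)
  | c_a : DoubleRel k n q (FreeAlgebra.ι k c * FreeAlgebra.ι k a)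
      (q • (FreeAlgebra.ι k a * FreeAlgebra.ι k c))
  | d_a : DoubleRel k n q
      (FreeAlgebra.ι k d * FreeAlgebra.ι k a - q • (FreeAlgebra.ι k a * FreeAlgebra.ι k d))
      (1 - FreeAlgebra.ι k b * FreeAlgebra.ι k c)

/-- The Drinfeld double `D(U_n(q))`, by its generators and relations. -/
def TaftDouble (k : Type u) [Field k] (n : ℕ) (q : k) : Type u := RingQuot (DoubleRel k n q)

noncomputable instance (k : Type u) [Field k] (n : ℕ) (q : k) : Ring (TaftDouble k n q) :=
  inferInstanceAs (Ring (RingQuot (DoubleRel k n q)))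

noncomputable instance (k : Type u) [Field k] (n : ℕ) (q : k) : Algebra k (TaftDouble k n q) :=
  inferInstanceAs (Algebra k (RingQuot (DoubleRel k n q)))

namespace TaftDouble

variable {k : Type u} [Field k] (n : ℕ) (q : k)

/-- The quotient map from the free algebra. -/
noncomputable def mk : FreeAlgebra k DoubleGen →ₐ[k] TaftDouble k n q :=
  RingQuot.mkAlgHom k (DoubleRel k n q)

theorem mk_rel {s t : FreeAlgebra k DoubleGen} (h : DoubleRel k n q s t) :
    mk n q s = mk n q t :=
  RingQuot.mkAlgHom_rel k h

noncomputable def gen (x : DoubleGen) : TaftDouble k n q := mk n q (FreeAlgebra.ι k x)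

/-- The embedding `U_n(q) → D(U_n(q))`, `G ↦ b`, `X ↦ a`. -/
noncomputable def incl : Taft k n q →ₐ[k] TaftDouble k n q :=
  Taft.lift (gen n q DoubleGen.b) (gen n q DoubleGen.a)
    (by simpa [gen] using mk_rel n q DoubleRel.b_pow)
    (by simpa [gen] using mk_rel n q DoubleRel.a_pow)
    (by simpa [gen] using mk_rel n q DoubleRel.b_a)

/-- The quotient module `Q = D(R)/R⁺D(R)` for `R = U_n(q)`, as a right `U_n(q)`-module. -/
noncomputable def Q [NeZero n] [Fact (IsPrimitiveRoot q n)] : RightMod k (Taft k n q) :=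
  (quotientModule (incl n q)).restrict (incl n q)

end TaftDouble

end QuantumDepth

/-!
Let `R` be the Taft algebra, `H` its double, `V(w, L)` the `R`-module with basis `κ_0, …, κ_{L-1}` on
which `κ_j G = q ^ (w + j) κ_j` and `κ_j X = κ_{j-1}` (a *string*, `L ≤ n`). Similarity is handled
through the preorder `Dominated`: the identity of `M` is a finite sum of maps factoring through `N`.

**The module `Q`.** Left multiplication by `c` acts on `Q`, and its eigenspaces split `Q` over `H` into
`n` modules with basis `κ_0, …, κ_{n-1}`, where `d` raises the index, `G` acts on `κ_j` by `q ^ j`, and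
`κ_j X` is an explicit multiple of `κ_{j-1}` (`exists_decomposition`). Over `R` they break up where
this multiple vanishes; so all strings `V(0, N)` and `V(w, n - w)` are direct summands of `Q`. On the
other hand the weights of each of these `n` modules are distinct, whence every vector of `Q` fixed by
`G` is killed by `X` (`killed_Q`).

**The module `Q ⊗ Q`.** Every finite-dimensional `R`-module is a direct sum of strings
(`dominated_of_string`), and each string that is not one of the above is a direct summand of a tensor
product of two of those, by explicit maps whose composition is a nonzero `q`-binomial coefficient
(`string_dominated_tensor_of_le`, `string_dominated_tensor_of_lt`). So `Q ⊗ Q` dominates every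
finite-dimensional module, and all tensor powers from the second on are similar. In `V(1, n)`, a
summand of a power of `Q ⊗ Q`, the top vector is fixed by `G` and not killed by `X`; so `Q` does not
dominate `Q ⊗ Q`. Nor does the trivial module dominate `Q`.

**Bimodules.** The double is a bialgebra, and for a right `H`-module `V` the space `H ⊗ V` is an
`H`-bimodule, by left multiplication and the diagonal right action. The map
`m ⊗ y ↦ (m ⊗ [1]) y` is an isomorphism from `(H ⊗ V) ⊗_R H` to `H ⊗ (V ⊗ Q)` (`relTensor_isom`), so
`H^{⊗_R (m+1)}` is `H ⊗ Q^{⊗ m}`. As `H`-`R`-bimodules, `H ⊗ V` and `H ⊗ W` are similar exactly when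
`V` and `W` are similar over `R`: one direction applies `H ⊗ -`, the other divides by the left action
of the augmentation ideal. The same holds for `R`-`H`-bimodules, as `H ⊗ V` is free over `1 ⊗ V` for
the diagonal action too (`leftFree_bijective`). So depth `2(m + 1)` means that `Q^{⊗ m}` and
`Q^{⊗ (m+1)}` are similar over `R`, which fails for `m = 0, 1` and holds for `m = 2`.
-/

set_option linter.unusedSectionVars false

open scoped RightActions

namespace QuantumDepth

/-! ### Domination of modules -/

section Dominated

variable (A : Type u) [Ring A]

/-- `M` is dominated by `N` if the identity of `M` is a finite sum of endomorphisms factoring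
through `N`; equivalently, `M` is a direct summand of a finite power of `N`. -/
def Dominated (M N : Type u) [AddCommGroup M] [Module A M] [AddCommGroup N] [Module A N] : Prop :=
  ∃ (ι : Type) (_ : Fintype ι) (f : ι → M →ₗ[A] N) (g : ι → N →ₗ[A] M),
    ∀ x, ∑ i, g i (f i x) = x

variable {A}
variable {M N P : Type u} [AddCommGroup M] [Module A M] [AddCommGroup N] [Module A N]
  [AddCommGroup P] [Module A P]

theorem Dominated.of_comp (f : M →ₗ[A] N) (g : N →ₗ[A] M) (h : ∀ x, g (f x) = x) :
    Dominated A M N :=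
  ⟨Unit, inferInstance, fun _ => f, fun _ => g, by simpa using h⟩

theorem Dominated.of_equiv (e : M ≃ₗ[A] N) : Dominated A M N :=
  .of_comp e.toLinearMap e.symm.toLinearMap (by simp)

theorem Dominated.refl : Dominated A M M := .of_equiv (LinearEquiv.refl A M)

theorem Dominated.trans (h : Dominated A M N) (h' : Dominated A N P) : Dominated A M P := by
  obtain ⟨ι, _, f, g, hfg⟩ := h
  obtain ⟨κ, _, f', g', hfg'⟩ := h'
  refine ⟨ι × κ, inferInstance, fun p => f' p.2 ∘ₗ f p.1, fun p => g p.1 ∘ₗ g' p.2, fun x => ?_⟩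
  rw [Fintype.sum_prod_type]
  simp only [LinearMap.comp_apply, ← map_sum, hfg', hfg]

/-- If `M` is split into two parts by the decomposition `e + e' = 1`, and `e` factors through `N` and
`e'` through `P`, then `M` is dominated by whatever dominates both `N` and `P`. -/
theorem Dominated.add {e e' : M →ₗ[A] M} (he : ∀ x, e x + e' x = x)
    (f₁ : M →ₗ[A] N) (g₁ : N →ₗ[A] M) (h₁ : ∀ x, g₁ (f₁ x) = e x)
    (f₂ : M →ₗ[A] P) (g₂ : P →ₗ[A] M) (h₂ : ∀ x, g₂ (f₂ x) = e' x)
    {Q : Type u} [AddCommGroup Q] [Module A Q] (hN : Dominated A N Q) (hP : Dominated A P Q) :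
    Dominated A M Q := by
  obtain ⟨ι, _, f, g, hfg⟩ := hN
  obtain ⟨κ, _, f', g', hfg'⟩ := hP
  refine ⟨ι ⊕ κ, inferInstance, Sum.elim (fun i => f i ∘ₗ f₁) (fun j => f' j ∘ₗ f₂),
    Sum.elim (fun i => g₁ ∘ₗ g i) (fun j => g₂ ∘ₗ g' j), fun x => ?_⟩
  rw [Fintype.sum_sum_type]
  simp only [Sum.elim_inl, Sum.elim_inr, LinearMap.comp_apply, ← map_sum, hfg, hfg', h₁, h₂, he]

theorem Dominated.pi {n : ℕ} {M : Fin n → Type u} [∀ i, AddCommGroup (M i)]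
    [∀ i, Module A (M i)] (h : ∀ i, Dominated A (M i) N) : Dominated A (∀ i, M i) N := by
  choose ι inst f g hfg using h
  refine ⟨Σ i, ι i, inferInstance, fun p => f p.1 p.2 ∘ₗ LinearMap.proj p.1,
    fun p => LinearMap.single A M p.1 ∘ₗ g p.1 p.2, fun x => ?_⟩
  rw [Fintype.sum_sigma]
  refine (Finset.sum_congr rfl fun i _ => ?_).trans (LinearMap.sum_single_apply M x)
  exact (map_sum (LinearMap.single A M i) (fun y => g i y (f i y (x i))) _).symm.trans
    (congrArg (LinearMap.single A M i) (hfg i (x i)))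

theorem Dominated.apply {n : ℕ} {M : Fin n → Type u} [∀ i, AddCommGroup (M i)]
    [∀ i, Module A (M i)] (i : Fin n) : Dominated A (M i) (∀ i, M i) :=
  .of_comp (LinearMap.single A M i) (LinearMap.proj i) (by simp)

/-- An index set may be empty in `Dominated`, while a positive number of copies is asked for in
`IsSimilar`; a zero summand, indexed by `none`, makes up for it. -/
theorem dominated_iff : Dominated A M N ↔ ∃ r : ℕ, 0 < r ∧ IsSummand A M (Fin r → N) := by
  constructor
  · rintro ⟨ι, _, f, g, hfg⟩
    let e := Fintype.equivFin (Option ι)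
    let f' : Option ι → M →ₗ[A] N := fun o => o.elim 0 f
    let g' : Option ι → N →ₗ[A] M := fun o => o.elim 0 g
    refine ⟨Fintype.card (Option ι), Fintype.card_pos,
      LinearMap.pi fun j => f' (e.symm j), ∑ j, g' (e.symm j) ∘ₗ LinearMap.proj j, ?_⟩
    ext x
    simp only [LinearMap.comp_apply, LinearMap.sum_apply, LinearMap.proj_apply,
      LinearMap.pi_apply, LinearMap.id_apply]
    rw [e.symm.sum_comp fun o => g' o (f' o x), Fintype.sum_option]
    simpa [f', g'] using hfg x
  · rintro ⟨r, -, f, g, hfg⟩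
    exact (Dominated.of_comp f g fun x => LinearMap.congr_fun hfg x).trans (.pi fun _ => .refl)

theorem isSimilar_iff : IsSimilar A M N ↔ Dominated A M N ∧ Dominated A N M := by
  rw [IsSimilar, ← dominated_iff, ← dominated_iff]

end Dominated

/-! ### Domination of bimodules -/

namespace BiMod

variable {A B C : Type u} [Ring A] [Ring B] [Ring C]

/-- Homomorphisms of bimodules, as a property of additive maps. -/
structure IsHom {X Y : BiMod A B} (f : X.carrier →+ Y.carrier) : Prop where
  left : ∀ (a : A) x, f (a • x) = a • f x
  right : ∀ (b : B) x, f (op b • x) = op b • f x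

theorem IsHom.comp {X Y Z : BiMod A B} {g : Y.carrier →+ Z.carrier} {f : X.carrier →+ Y.carrier}
    (hg : IsHom g) (hf : IsHom f) : IsHom (X := X) (Y := Z) (g.comp f) :=
  ⟨fun a x => by simp [hf.left, hg.left], fun b x => by simp [hf.right, hg.right]⟩

/-- The bimodule version of `QuantumDepth.Dominated`. -/
def Dominated (X Y : BiMod A B) : Prop :=
  ∃ (ι : Type) (_ : Fintype ι) (f : ι → X.carrier →+ Y.carrier) (g : ι → Y.carrier →+ X.carrier),
    (∀ i, IsHom (f i)) ∧ (∀ i, IsHom (g i)) ∧ ∀ x, ∑ i, g i (f i x) = x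

theorem Dominated.trans {X Y Z : BiMod A B} (h : Dominated X Y) (h' : Dominated Y Z) :
    Dominated X Z := by
  obtain ⟨ι, _, f, g, hf, hg, hfg⟩ := h
  obtain ⟨κ, _, f', g', hf', hg', hfg'⟩ := h'
  refine ⟨ι × κ, inferInstance, fun p => (f' p.2).comp (f p.1), fun p => (g p.1).comp (g' p.2),
    fun p => (hf' _).comp (hf _), fun p => (hg _).comp (hg' _), fun x => ?_⟩
  rw [Fintype.sum_prod_type]
  simp only [AddMonoidHom.comp_apply, ← map_sum, hfg', hfg]

/-- Two bimodules are isomorphic. -/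
def Isom (X Y : BiMod A B) : Prop := ∃ e : X.carrier ≃+ Y.carrier, IsHom e.toAddMonoidHom

theorem IsHom.symm {X Y : BiMod A B} {e : X.carrier ≃+ Y.carrier} (he : IsHom e.toAddMonoidHom) :
    IsHom e.symm.toAddMonoidHom := by
  refine ⟨fun a x => e.injective ?_, fun a x => e.injective ?_⟩
  · exact (e.apply_symm_apply _).trans <| Eq.symm <|
      (he.left a (e.symm x)).trans (congrArg _ (e.apply_symm_apply x))
  · exact (e.apply_symm_apply _).trans <| Eq.symm <|
      (he.right a (e.symm x)).trans (congrArg _ (e.apply_symm_apply x))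

theorem Isom.symm {X Y : BiMod A B} (h : Isom X Y) : Isom Y X :=
  let ⟨e, he⟩ := h
  ⟨e.symm, he.symm⟩

theorem Isom.trans {X Y Z : BiMod A B} (h : Isom X Y) (h' : Isom Y Z) : Isom X Z := by
  obtain ⟨e, he⟩ := h
  obtain ⟨e', he'⟩ := h'
  exact ⟨e.trans e', he'.comp he⟩

theorem Isom.dominated {X Y : BiMod A B} (h : Isom X Y) : Dominated X Y :=
  let ⟨e, he⟩ := h
  ⟨Unit, inferInstance, fun _ => e.toAddMonoidHom, fun _ => e.symm.toAddMonoidHom,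
    fun _ => he, fun _ => he.symm, by simp⟩

theorem Isom.restrictLeft {X Y : BiMod A C} (i : B →+* A) (h : Isom X Y) :
    Isom (X.restrictLeft i) (Y.restrictLeft i) := by
  obtain ⟨e, he⟩ := h
  exact ⟨e, fun b x => he.left (i b) x, he.right⟩

theorem Isom.restrictRight {X Y : BiMod C A} (i : B →+* A) (h : Isom X Y) :
    Isom (X.restrictRight i) (Y.restrictRight i) := by
  obtain ⟨e, he⟩ := h
  exact ⟨e, he.left, fun b x => he.right (i b) x⟩

theorem dominated_iff {X Y : BiMod A B} :
    Dominated X Y ↔ ∃ r : ℕ, 0 < r ∧ IsSummandOfCopies X Y r := by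
  constructor
  · rintro ⟨ι, _, f, g, hf, hg, hfg⟩
    let e := Fintype.equivFin (Option ι)
    let f' : Option ι → X.carrier →ₗ[A] Y.carrier := fun o =>
      o.elim 0 fun i => { f i with map_smul' := (hf i).left }
    let g' : Option ι → Y.carrier →ₗ[A] X.carrier := fun o =>
      o.elim 0 fun i => { g i with map_smul' := (hg i).left }
    have hf' : ∀ o (b : B) x, f' o (op b • x) = op b • f' o x := by
      rintro (_ | i) b x
      · exact (smul_zero _).symm
      · exact (hf i).right b x
    have hg' : ∀ o (b : B) x, g' o (op b • x) = op b • g' o x := by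
      rintro (_ | i) b x
      · exact (smul_zero _).symm
      · exact (hg i).right b x
    refine ⟨Fintype.card (Option ι), Fintype.card_pos,
      LinearMap.pi fun j => f' (e.symm j), ∑ j, g' (e.symm j) ∘ₗ LinearMap.proj j, ?_, ?_, ?_⟩
    · intro b x
      funext j
      exact hf' _ b x
    · intro b y
      simp only [LinearMap.sum_apply, LinearMap.comp_apply, LinearMap.proj_apply, Pi.smul_apply,
        hg', Finset.smul_sum]
    · ext x
      simp only [LinearMap.comp_apply, LinearMap.sum_apply, LinearMap.proj_apply,
        LinearMap.pi_apply, LinearMap.id_apply]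
      rw [e.symm.sum_comp fun o => g' o (f' o x), Fintype.sum_option]
      simpa [f', g'] using hfg x
  · rintro ⟨r, -, f, g, hf, hg, hfg⟩
    refine ⟨Fin r, inferInstance,
      fun j => (LinearMap.proj (R := A) (φ := fun _ : Fin r => Y.carrier) j ∘ₗ f).toAddMonoidHom,
      fun j => (g ∘ₗ LinearMap.single A (fun _ => Y.carrier) j).toAddMonoidHom, fun j => ⟨?_, ?_⟩,
      fun j => ⟨?_, ?_⟩, fun x => ?_⟩
    · intro a x
      simp
    · intro b x
      simp [hf]
    · intro a x
      simp
    · intro b y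
      simp only [LinearMap.toAddMonoidHom_coe, LinearMap.comp_apply, LinearMap.coe_single]
      rw [← hg, Pi.single_smul]
    · simp only [LinearMap.toAddMonoidHom_coe, LinearMap.comp_apply, ← map_sum]
      exact (congrArg g (LinearMap.sum_single_apply (fun _ => Y.carrier) (f x))).trans
        (LinearMap.congr_fun hfg x)

theorem similar_iff {X Y : BiMod A B} : Similar X Y ↔ Dominated X Y ∧ Dominated Y X := by
  rw [Similar, ← dominated_iff, ← dominated_iff]

theorem similar_congr {X X' Y Y' : BiMod A B} (hX : Isom X X') (hY : Isom Y Y') :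
    Similar X Y ↔ Similar X' Y' := by
  rw [similar_iff, similar_iff]
  constructor
  · rintro ⟨h, h'⟩
    exact ⟨(hX.symm.dominated.trans h).trans hY.dominated,
      (hY.symm.dominated.trans h').trans hX.dominated⟩
  · rintro ⟨h, h'⟩
    exact ⟨(hX.dominated.trans h).trans hY.symm.dominated,
      (hY.dominated.trans h').trans hX.symm.dominated⟩

end BiMod

/-! ### Tensor products of right modules -/

namespace RightMod

variable {k H : Type u} [Field k] [Ring H]

section Algebra

variable [Algebra k H]

theorem algebraMap_op_smul {M : Type u} [AddCommGroup M] [Module k M] [Module Hᵐᵒᵖ M]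
    [IsScalarTower k Hᵐᵒᵖ M] (c : k) (v : M) : v <• algebraMap k H c = c • v :=
  algebraMap_smul Hᵐᵒᵖ c v

theorem smul_op_smul {M : Type u} [AddCommGroup M] [Module k M] [Module Hᵐᵒᵖ M]
    [IsScalarTower k Hᵐᵒᵖ M] (c : k) (v : M) (h : H) : (c • v) <• h = c • (v <• h) :=
  smul_comm (op h) c v

theorem op_mul_smul {M : Type u} [AddCommGroup M] [Module Hᵐᵒᵖ M] (v : M) (x y : H) :
    v <• (x * y) = v <• x <• y := by
  rw [MulOpposite.op_mul, mul_smul]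

/-- The right module on `M` given by an algebra map `H → (End M)ᵐᵒᵖ`. -/
noncomputable def ofAlgHom {M : Type u} [AddCommGroup M] [Module k M]
    (ρ : H →ₐ[k] (Module.End k M)ᵐᵒᵖ) : RightMod k H :=
  letI : Module Hᵐᵒᵖ M := Module.compHom M (AlgHom.opComm ρ).toRingHom
  haveI : IsScalarTower k Hᵐᵒᵖ M := ⟨fun c r v => by
    change AlgHom.opComm ρ (c • r) v = c • (AlgHom.opComm ρ r v)
    rw [map_smul, LinearMap.smul_apply]⟩
  { carrier := M }

theorem ofAlgHom_smul {M : Type u} [AddCommGroup M] [Module k M]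
    (ρ : H →ₐ[k] (Module.End k M)ᵐᵒᵖ) (v : (ofAlgHom ρ).carrier) (h : H) :
    v <• h = (MulOpposite.unop (ρ h) : Module.End k M) v := rfl

end Algebra

variable [Bialgebra k H]

/-- The elementary tensor `v ⊗ w` in `V ⊗ W`. -/
noncomputable def tmul (V W : RightMod k H) :
    V.carrier →ₗ[k] W.carrier →ₗ[k] (V.tensor W).carrier :=
  TensorProduct.mk k V.carrier W.carrier

variable {V W V' W' U : RightMod k H}

theorem tensor_induction {p : (V.tensor W).carrier → Prop} (zero : p 0)
    (tmul : ∀ v w, p (V.tmul W v w)) (add : ∀ s t, p s → p t → p (s + t)) (t) : p t :=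
  TensorProduct.induction_on t zero tmul add

/-- The linear map on `V ⊗ W` induced by a bilinear map. -/
noncomputable def tensorLift {P : Type u} [AddCommGroup P] [Module k P]
    (f : V.carrier →ₗ[k] W.carrier →ₗ[k] P) : (V.tensor W).carrier →ₗ[k] P :=
  TensorProduct.lift f

theorem tensorLift_tmul {P : Type u} [AddCommGroup P] [Module k P]
    (f : V.carrier →ₗ[k] W.carrier →ₗ[k] P) (v : V.carrier) (w : W.carrier) :
    tensorLift f (V.tmul W v w) = f v w :=
  TensorProduct.lift.tmul v w

theorem tensor_ext {P : Type u} [AddCommGroup P] [Module k P]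
    {f g : (V.tensor W).carrier →ₗ[k] P} (h : ∀ v w, f (V.tmul W v w) = g (V.tmul W v w)) :
    f = g :=
  TensorProduct.ext' h

/-- The action of `H ⊗ H` on `V ⊗ W`, `(v ⊗ w) (x ⊗ y) = v x ⊗ w y`. -/
noncomputable def tensorAct₂ (V W : RightMod k H) :
    H ⊗[k] H →ₗ[k] (V.tensor W).carrier →ₗ[k] (V.tensor W).carrier :=
  TensorProduct.lift <| LinearMap.mk₂ k (fun x y => tensorLift
      ((V.tmul W).compl₁₂ (Algebra.lsmul k k V.carrier (op x)) (Algebra.lsmul k k W.carrier (op y))))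
    (fun x x' y => tensor_ext fun v w => by simp [tensorLift_tmul])
    (fun c x y => tensor_ext fun v w => by simp [tensorLift_tmul])
    (fun x y y' => tensor_ext fun v w => by simp [tensorLift_tmul])
    (fun c x y => tensor_ext fun v w => by simp [tensorLift_tmul])

theorem tensorAct₂_tmul (x y : H) (v : V.carrier) (w : W.carrier) :
    tensorAct₂ V W (x ⊗ₜ y) (V.tmul W v w) = V.tmul W (v <• x) (w <• y) := by
  simp [tensorAct₂, tensorLift_tmul]

/-- The diagonal action is the action of `H ⊗ H` precomposed with the comultiplication. -/
theorem tensor_smul (h : H) (t : (V.tensor W).carrier) :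
    t <• h = tensorAct₂ V W (Coalgebra.comul (R := k) h) t := by
  have key : ∀ s : H ⊗[k] H, (Module.endTensorEndAlgHom (R := k) (S := k) (A := k))
      ((Algebra.TensorProduct.map (Algebra.lsmul k k V.carrier) (Algebra.lsmul k k W.carrier))
      ((Algebra.TensorProduct.opAlgEquiv k k H H).symm (op s))) = tensorAct₂ V W s := by
    intro s
    induction s using TensorProduct.induction_on with
    | zero => simp only [MulOpposite.op_zero, map_zero]; rfl
    | tmul x y =>
      refine tensor_ext fun v w => Eq.trans ?_ (tensorAct₂_tmul x y v w).symm
      rw [Algebra.TensorProduct.opAlgEquiv_symm_tmul]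
      rfl
    | add s s' hs hs' =>
      rw [MulOpposite.op_add, map_add, map_add, map_add, hs, hs', map_add]; rfl
  exact LinearMap.congr_fun (key _) t

theorem tmul_smul_of_grouplike {g : H} (hg : Coalgebra.comul (R := k) g = g ⊗ₜ g)
    (v : V.carrier) (w : W.carrier) : V.tmul W v w <• g = V.tmul W (v <• g) (w <• g) := by
  rw [tensor_smul, hg, tensorAct₂_tmul]

/-- For `Δ(x) = x ⊗ g + 1 ⊗ x`. -/
theorem tmul_smul_of_primitive {g x : H} (hx : Coalgebra.comul (R := k) x = x ⊗ₜ g + 1 ⊗ₜ x)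
    (v : V.carrier) (w : W.carrier) :
    V.tmul W v w <• x = V.tmul W (v <• x) (w <• g) + V.tmul W v (w <• x) := by
  rw [tensor_smul, hx, map_add, LinearMap.add_apply, tensorAct₂_tmul, tensorAct₂_tmul,
    MulOpposite.op_one, one_smul]

theorem trivial_smul (c : (trivial k H).carrier) (h : H) :
    c <• h = (Coalgebra.counit (R := k) h • c : (trivial k H).carrier) := rfl

/-- The tensor product of two maps of right modules. -/
noncomputable def tensorMap (f : V.carrier →ₗ[Hᵐᵒᵖ] V'.carrier)
    (g : W.carrier →ₗ[Hᵐᵒᵖ] W'.carrier) :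
    (V.tensor W).carrier →ₗ[Hᵐᵒᵖ] (V'.tensor W').carrier :=
  { tensorLift ((V'.tmul W').compl₁₂ (f.restrictScalars k) (g.restrictScalars k)) with
    map_smul' := by
      intro h t
      obtain ⟨h, rfl⟩ := MulOpposite.op_surjective h
      simp only [AddHom.toFun_eq_coe, LinearMap.coe_toAddHom, RingHom.id_apply]
      rw [tensor_smul, tensor_smul]
      generalize Coalgebra.comul (R := k) h = s
      induction t using tensor_induction with
      | zero => simp only [map_zero]
      | add t t' ht ht' => simp only [map_add, ht, ht']
      | tmul v w =>
        induction s using TensorProduct.induction_on with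
        | zero => simp
        | add s s' hs hs' => simp only [map_add, LinearMap.add_apply, hs, hs']
        | tmul x y => simp [tensorAct₂_tmul, tensorLift_tmul] }

theorem tensorMap_tmul (f : V.carrier →ₗ[Hᵐᵒᵖ] V'.carrier) (g : W.carrier →ₗ[Hᵐᵒᵖ] W'.carrier)
    (v : V.carrier) (w : W.carrier) :
    tensorMap f g (V.tmul W v w) = V'.tmul W' (f v) (g w) :=
  tensorLift_tmul _ v w

theorem dominated_tensor (h : Dominated Hᵐᵒᵖ V.carrier V'.carrier)
    (h' : Dominated Hᵐᵒᵖ W.carrier W'.carrier) :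
    Dominated Hᵐᵒᵖ (V.tensor W).carrier (V'.tensor W').carrier := by
  obtain ⟨ι, _, f, g, hfg⟩ := h
  obtain ⟨κ, _, f', g', hfg'⟩ := h'
  refine ⟨ι × κ, inferInstance, fun p => tensorMap (f p.1) (f' p.2),
    fun p => tensorMap (g p.1) (g' p.2), fun t => ?_⟩
  induction t using tensor_induction with
  | zero => simp
  | add t t' ht ht' => simp only [map_add, Finset.sum_add_distrib, ht, ht']
  | tmul v w =>
    rw [Fintype.sum_prod_type]
    simp only [tensorMap_tmul, ← map_sum, hfg', ← LinearMap.sum_apply, hfg]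

theorem similar_iff : V.Similar W ↔
    Dominated Hᵐᵒᵖ V.carrier W.carrier ∧ Dominated Hᵐᵒᵖ W.carrier V.carrier :=
  isSimilar_iff

instance [FiniteDimensional k V.carrier] [FiniteDimensional k W.carrier] :
    FiniteDimensional k (V.tensor W).carrier :=
  inferInstanceAs (FiniteDimensional k (V.carrier ⊗[k] W.carrier))

instance : FiniteDimensional k (trivial k H).carrier :=
  inferInstanceAs (FiniteDimensional k k)

end RightMod

/-! ### Generators of the Taft algebra and of its double -/

namespace Taft

variable {k : Type u} [Field k] {n : ℕ} {q : k}

theorem induction {p : Taft k n q → Prop} (algebraMap : ∀ c, p (algebraMap k _ c))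
    (G : p (G n q)) (X : p (X n q)) (mul : ∀ x y, p x → p y → p (x * y))
    (add : ∀ x y, p x → p y → p (x + y)) (x) : p x := by
  obtain ⟨x, rfl⟩ : ∃ y, mk n q y = x := RingQuot.mkAlgHom_surjective k _ x
  induction x using FreeAlgebra.induction with
  | grade0 r => rw [AlgHom.commutes]; exact algebraMap r
  | grade1 t => cases t; exacts [G, X]
  | mul a b ha hb => rw [map_mul]; exact mul _ _ ha hb
  | add a b ha hb => rw [map_add]; exact add _ _ ha hb

section Bialgebra

variable [NeZero n] [hq : Fact (IsPrimitiveRoot q n)]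

theorem comul_G : Coalgebra.comul (R := k) (G n q) = G n q ⊗ₜ G n q :=
  lift_G ..

theorem comul_X : Coalgebra.comul (R := k) (X n q) = X n q ⊗ₜ G n q + 1 ⊗ₜ X n q :=
  lift_X ..

theorem counit_G : Coalgebra.counit (R := k) (G n q) = 1 :=
  lift_G (S := k) ..

theorem counit_X : Coalgebra.counit (R := k) (X n q) = 0 :=
  lift_X (S := k) ..

end Bialgebra

theorem map_smul_of_generators {M N : Type u} [AddCommGroup M] [Module k M]
    [Module (Taft k n q)ᵐᵒᵖ M] [IsScalarTower k (Taft k n q)ᵐᵒᵖ M] [AddCommGroup N] [Module k N]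
    [Module (Taft k n q)ᵐᵒᵖ N] [IsScalarTower k (Taft k n q)ᵐᵒᵖ N] (f : M →+ N)
    (hk : ∀ (c : k) v, f (c • v) = c • f v)
    (hG : ∀ v, f (v <• G n q) = f v <• G n q) (hX : ∀ v, f (v <• X n q) = f v <• X n q)
    (x : Taft k n q) : ∀ v, f (v <• x) = f v <• x := by
  induction x using induction with
  | algebraMap c => simpa only [RightMod.algebraMap_op_smul] using hk c
  | G => exact hG
  | X => exact hX
  | mul x y hx hy => intro v; rw [RightMod.op_mul_smul, RightMod.op_mul_smul, hy, hx]
  | add x y hx hy => intro v; rw [MulOpposite.op_add, add_smul, add_smul, map_add, hx, hy]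

/-- A linear map commuting with the actions of `G` and `X` is a map of right modules. -/
def linearMap {M N : Type u} [AddCommGroup M] [Module k M]
    [Module (Taft k n q)ᵐᵒᵖ M] [IsScalarTower k (Taft k n q)ᵐᵒᵖ M] [AddCommGroup N] [Module k N]
    [Module (Taft k n q)ᵐᵒᵖ N] [IsScalarTower k (Taft k n q)ᵐᵒᵖ N] (f : M →ₗ[k] N)
    (hG : ∀ v, f (v <• G n q) = f v <• G n q) (hX : ∀ v, f (v <• X n q) = f v <• X n q) :
    M →ₗ[(Taft k n q)ᵐᵒᵖ] N :=
  { f with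
    map_smul' := fun x v => map_smul_of_generators f.toAddMonoidHom (fun c v => f.map_smul c v)
      hG hX x.unop v }

end Taft

namespace TaftDouble

variable {k : Type u} [Field k] {n : ℕ} {q : k}

variable (n q) in
noncomputable abbrev a : TaftDouble k n q := gen n q DoubleGen.a

variable (n q) in
noncomputable abbrev b : TaftDouble k n q := gen n q DoubleGen.b

variable (n q) in
noncomputable abbrev c : TaftDouble k n q := gen n q DoubleGen.c

variable (n q) in
noncomputable abbrev d : TaftDouble k n q := gen n q DoubleGen.d

theorem b_pow : b n q ^ n = 1 := by simpa [gen] using mk_rel n q DoubleRel.b_pow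
theorem c_pow : c n q ^ n = 1 := by simpa [gen] using mk_rel n q DoubleRel.c_pow
theorem a_pow : a n q ^ n = 0 := by simpa [gen] using mk_rel n q DoubleRel.a_pow
theorem d_pow : d n q ^ n = 0 := by simpa [gen] using mk_rel n q DoubleRel.d_pow
theorem b_a : b n q * a n q = q • (a n q * b n q) := by
  simpa [gen] using mk_rel n q DoubleRel.b_a
theorem d_c : d n q * c n q = q • (c n q * d n q) := by
  simpa [gen] using mk_rel n q DoubleRel.d_c
theorem d_b : d n q * b n q = q • (b n q * d n q) := by
  simpa [gen] using mk_rel n q DoubleRel.d_b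
theorem b_c : b n q * c n q = c n q * b n q := by
  simpa [gen] using mk_rel n q DoubleRel.b_c
theorem c_a : c n q * a n q = q • (a n q * c n q) := by
  simpa [gen] using mk_rel n q DoubleRel.c_a
theorem d_a : d n q * a n q = q • (a n q * d n q) + (1 - b n q * c n q) := by
  rw [← sub_eq_iff_eq_add']
  simpa [gen] using mk_rel n q DoubleRel.d_a

theorem incl_G : incl n q (Taft.G n q) = b n q := Taft.lift_G ..
theorem incl_X : incl n q (Taft.X n q) = a n q := Taft.lift_X ..

theorem induction {p : TaftDouble k n q → Prop} (algebraMap : ∀ c, p (algebraMap k _ c))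
    (a : p (a n q)) (b : p (b n q)) (c : p (c n q)) (d : p (d n q))
    (mul : ∀ x y, p x → p y → p (x * y)) (add : ∀ x y, p x → p y → p (x + y)) (x) : p x := by
  obtain ⟨x, rfl⟩ : ∃ y, mk n q y = x := RingQuot.mkAlgHom_surjective k _ x
  induction x using FreeAlgebra.induction with
  | grade0 r => rw [AlgHom.commutes]; exact algebraMap r
  | grade1 t => cases t; exacts [a, b, c, d]
  | mul a b ha hb => rw [map_mul]; exact mul _ _ ha hb
  | add a b ha hb => rw [map_add]; exact add _ _ ha hb

section Lift

variable {S : Type u} [Ring S] [Algebra k S]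

variable (n q) in
/-- The defining relations of the double, for four elements of an algebra. -/
structure Relations (a' b' c' d' : S) : Prop where
  a_pow : a' ^ n = 0
  d_pow : d' ^ n = 0
  b_pow : b' ^ n = 1
  c_pow : c' ^ n = 1
  b_a : b' * a' = q • (a' * b')
  d_c : d' * c' = q • (c' * d')
  d_b : d' * b' = q • (b' * d')
  b_c : b' * c' = c' * b'
  c_a : c' * a' = q • (a' * c')
  d_a : d' * a' - q • (a' * d') = 1 - b' * c'

variable {a' b' c' d' : S} (h : Relations n q a' b' c' d')

/-- The algebra map out of the double with prescribed values on the generators. -/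
noncomputable def lift : TaftDouble k n q →ₐ[k] S :=
  RingQuot.liftAlgHom k ⟨FreeAlgebra.lift k (fun t => match t with
    | DoubleGen.a => a'
    | DoubleGen.b => b'
    | DoubleGen.c => c'
    | DoubleGen.d => d'), by
      intro x y hxy
      cases hxy <;> simp [h.a_pow, h.d_pow, h.b_pow, h.c_pow, h.b_a, h.d_c, h.d_b, h.b_c, h.c_a,
        h.d_a]⟩

@[simp] theorem lift_a : lift h (a n q) = a' :=
  (RingQuot.liftAlgHom_mkAlgHom_apply _ _ _ _).trans (by simp)

@[simp] theorem lift_b : lift h (b n q) = b' :=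
  (RingQuot.liftAlgHom_mkAlgHom_apply _ _ _ _).trans (by simp)

@[simp] theorem lift_c : lift h (c n q) = c' :=
  (RingQuot.liftAlgHom_mkAlgHom_apply _ _ _ _).trans (by simp)

@[simp] theorem lift_d : lift h (d n q) = d' :=
  (RingQuot.liftAlgHom_mkAlgHom_apply _ _ _ _).trans (by simp)

end Lift

theorem algHom_ext {S : Type u} [Ring S] [Algebra k S] {f f' : TaftDouble k n q →ₐ[k] S}
    (ha : f (a n q) = f' (a n q)) (hb : f (b n q) = f' (b n q)) (hc : f (c n q) = f' (c n q))
    (hd : f (d n q) = f' (d n q)) : f = f' := by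
  refine RingQuot.ringQuot_ext' k _ _ (FreeAlgebra.hom_ext ?_)
  funext t
  cases t
  exacts [ha, hb, hc, hd]

/-- Equivariance can be checked on the four generators. -/
theorem map_smul_of_generators {M N : Type u} [AddCommGroup M] [Module k M]
    [Module (TaftDouble k n q)ᵐᵒᵖ M] [IsScalarTower k (TaftDouble k n q)ᵐᵒᵖ M] [AddCommGroup N]
    [Module k N] [Module (TaftDouble k n q)ᵐᵒᵖ N] [IsScalarTower k (TaftDouble k n q)ᵐᵒᵖ N]
    (f : M →+ N) (hk : ∀ (c : k) v, f (c • v) = c • f v)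
    (ha : ∀ v, f (v <• a n q) = f v <• a n q) (hb : ∀ v, f (v <• b n q) = f v <• b n q)
    (hc : ∀ v, f (v <• c n q) = f v <• c n q) (hd : ∀ v, f (v <• d n q) = f v <• d n q)
    (x : TaftDouble k n q) : ∀ v, f (v <• x) = f v <• x := by
  induction x using induction with
  | algebraMap c => simpa only [RightMod.algebraMap_op_smul] using hk c
  | a => exact ha
  | b => exact hb
  | c => exact hc
  | d => exact hd
  | mul x y hx hy => intro v; rw [RightMod.op_mul_smul, RightMod.op_mul_smul, hy, hx]
  | add x y hx hy => intro v; rw [MulOpposite.op_add, add_smul, add_smul, map_add, hx, hy]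

/-! ### The bialgebra structure of the double -/

section Bialgebra

variable [NeZero n] [hq : Fact (IsPrimitiveRoot q n)]

variable (n q) in
/-- `b` and `c` are grouplike, `Δ(a) = a ⊗ b + 1 ⊗ a` and `Δ(d) = d ⊗ c + 1 ⊗ d`. -/
noncomputable def comulHom : TaftDouble k n q →ₐ[k] TaftDouble k n q ⊗[k] TaftDouble k n q :=
  lift (a' := a n q ⊗ₜ b n q + 1 ⊗ₜ a n q) (b' := b n q ⊗ₜ b n q) (c' := c n q ⊗ₜ c n q)
    (d' := d n q ⊗ₜ c n q + 1 ⊗ₜ d n q) <| .mk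
    (by
      rw [add_comm, add_pow_root (q := q) (NeZero.pos n) hq.out]
      · simp [Algebra.TensorProduct.tmul_pow, a_pow]
      · simp [b_a])
    (by
      rw [add_pow_root (q := q) (NeZero.pos n) hq.out]
      · simp [Algebra.TensorProduct.tmul_pow, d_pow]
      · simp [d_c])
    (by rw [Algebra.TensorProduct.tmul_pow, b_pow]; rfl)
    (by rw [Algebra.TensorProduct.tmul_pow, c_pow]; rfl)
    (by simp [mul_add, add_mul, b_a, TensorProduct.smul_tmul'])
    (by simp [mul_add, add_mul, d_c, TensorProduct.smul_tmul'])
    (by simp [mul_add, add_mul, d_b, b_c, TensorProduct.smul_tmul'])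
    (by simp [b_c])
    (by simp [mul_add, add_mul, c_a, b_c, TensorProduct.smul_tmul'])
    (by
      simp only [mul_add, add_mul, Algebra.TensorProduct.tmul_mul_tmul, mul_one, one_mul, d_a, c_a,
        d_b, b_c, TensorProduct.add_tmul, TensorProduct.tmul_add, TensorProduct.tmul_sub,
        TensorProduct.sub_tmul, smul_add, TensorProduct.tmul_smul, ← TensorProduct.smul_tmul',
        Algebra.TensorProduct.one_def]
      abel)

variable (n q) in
/-- `ε(a) = ε(d) = 0` and `ε(b) = ε(c) = 1`. -/
noncomputable def counitHom : TaftDouble k n q →ₐ[k] k :=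
  lift (a' := 0) (b' := 1) (c' := 1) (d' := 0) <| .mk
    (zero_pow (NeZero.ne n)) (zero_pow (NeZero.ne n)) (one_pow n) (one_pow n)
    (by simp) (by simp) (by simp) (by simp) (by simp) (by simp)

noncomputable instance : Bialgebra k (TaftDouble k n q) :=
  Bialgebra.ofAlgHom (comulHom n q) (counitHom n q)
    (algHom_ext
      (by simp [comulHom, TensorProduct.add_tmul, TensorProduct.tmul_add, add_assoc,
            Algebra.TensorProduct.one_def])
      (by simp [comulHom]) (by simp [comulHom])
      (by simp [comulHom, TensorProduct.add_tmul, TensorProduct.tmul_add, add_assoc,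
            Algebra.TensorProduct.one_def]))
    (algHom_ext (by simp [comulHom, counitHom]) (by simp [comulHom, counitHom])
      (by simp [comulHom, counitHom]) (by simp [comulHom, counitHom]))
    (algHom_ext (by simp [comulHom, counitHom]) (by simp [comulHom, counitHom])
      (by simp [comulHom, counitHom]) (by simp [comulHom, counitHom]))

theorem comul_a : Coalgebra.comul (R := k) (a n q) = a n q ⊗ₜ b n q + 1 ⊗ₜ a n q := lift_a ..
theorem comul_b : Coalgebra.comul (R := k) (b n q) = b n q ⊗ₜ b n q := lift_b ..
theorem comul_c : Coalgebra.comul (R := k) (c n q) = c n q ⊗ₜ c n q := lift_c ..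
theorem comul_d : Coalgebra.comul (R := k) (d n q) = d n q ⊗ₜ c n q + 1 ⊗ₜ d n q := lift_d ..
theorem counit_a : Coalgebra.counit (R := k) (a n q) = 0 := lift_a (S := k) ..
theorem counit_b : Coalgebra.counit (R := k) (b n q) = 1 := lift_b (S := k) ..
theorem counit_c : Coalgebra.counit (R := k) (c n q) = 1 := lift_c (S := k) ..
theorem counit_d : Coalgebra.counit (R := k) (d n q) = 0 := lift_d (S := k) ..

end Bialgebra

end TaftDouble

/-! ### Spectral projections of an operator of order `n` -/

section WeightSum

variable {k : Type u} [Field k] {n : ℕ} [NeZero n] {q : k} {S : Type u} [Ring S] [Algebra k S]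

/-- For `g ^ n = 1`, the element `n • e`, where `e` is the projection onto the eigenspace of `g` of
eigenvalue `q ^ w`. -/
noncomputable def weightSum (n : ℕ) (q : k) (g : S) (w : ℕ) : S :=
  ∑ m ∈ Finset.range n, ((q⁻¹) ^ (w * m)) • g ^ m

theorem mul_weightSum (hq : IsPrimitiveRoot q n) {g : S} (hg : g ^ n = 1) (w : ℕ) :
    g * weightSum n q g w = q ^ w • weightSum n q g w := by
  have hq0 : q ≠ 0 := hq.ne_zero (NeZero.ne n)
  have key : ∀ m, g * (((q⁻¹) ^ (w * m)) • g ^ m) =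
      q ^ w • (((q⁻¹) ^ (w * (m + 1))) • g ^ (m + 1)) := by
    intro m
    rw [mul_smul_comm, ← pow_succ', smul_smul, mul_add, pow_add (q⁻¹), mul_one, mul_left_comm,
      ← mul_pow, mul_inv_cancel₀ hq0, one_pow, mul_one]
  have h0 : ((q⁻¹) ^ (w * n)) • g ^ n = ((q⁻¹) ^ (w * 0)) • g ^ 0 := by
    rw [hg, mul_comm, pow_mul, inv_pow, hq.pow_eq_one]
    simp
  rw [weightSum, Finset.mul_sum, Finset.sum_congr rfl fun m _ => key m, ← Finset.smul_sum]
  have := Finset.sum_range_succ (fun m => ((q⁻¹) ^ (w * m)) • g ^ m) n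
  rw [Finset.sum_range_succ', h0, add_left_inj] at this
  rw [this]

theorem weightSum_mul (g : S) (w : ℕ) : weightSum n q g w * g = g * weightSum n q g w := by
  simp only [weightSum, Finset.sum_mul, Finset.mul_sum, smul_mul_assoc, mul_smul_comm, ← pow_succ,
    ← pow_succ']

theorem weightSum_smul_of_smul_eq (hq : IsPrimitiveRoot q n) {M : Type u} [AddCommGroup M]
    [Module k M] [Module S M] [IsScalarTower k S M] {g : S} {w : ℕ} {v : M}
    (hv : g • v = q ^ w • v) : weightSum n q g w • v = (n : k) • v := by
  have hq0 : q ≠ 0 := hq.ne_zero (NeZero.ne n)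
  have h : ∀ m, g ^ m • v = q ^ (w * m) • v := by
    intro m
    induction m with
    | zero => simp
    | succ m ih =>
      rw [pow_succ, mul_smul, hv, smul_comm, ih, smul_smul, ← pow_add, mul_add, mul_one, add_comm]
  rw [weightSum, Finset.sum_smul]
  simp only [smul_assoc, h, smul_smul, ← mul_pow, inv_mul_cancel₀ hq0, one_pow, one_smul]
  simp [← Nat.cast_smul_eq_nsmul k]

theorem exists_pow_eq_pow_add (hq : q ^ n = 1) (e l : ℕ) : ∃ w < n, q ^ e = q ^ (w + l) := by
  have hmod : ∀ m, q ^ (m % n) = q ^ m := fun m => by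
    conv_rhs => rw [← Nat.mod_add_div m n, pow_add, pow_mul, hq, one_pow, mul_one]
  refine ⟨(e + l * (n - 1)) % n, Nat.mod_lt _ (NeZero.pos n), ?_⟩
  obtain ⟨m, rfl⟩ : ∃ m, n = m + 1 := ⟨n - 1, by have := NeZero.pos n; omega⟩
  rw [pow_add, hmod, ← pow_add, Nat.add_sub_cancel, show e + l * m + l = e + (m + 1) * l by ring,
    pow_add q e, pow_mul, hq, one_pow, mul_one]

/-- The projections onto the eigenspaces of `g` sum to the identity. -/
theorem sum_weightSum (hq : IsPrimitiveRoot q n) (g : S) :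
    ∑ w ∈ Finset.range n, weightSum n q g w = (n : k) • 1 := by
  simp only [weightSum]
  rw [Finset.sum_comm, Finset.sum_eq_single 0]
  · simp [Algebra.smul_def]
  · intro m hm hm0
    have hm' : (q⁻¹) ^ m ≠ 1 :=
      hq.inv.pow_ne_one_of_pos_of_lt hm0 (Finset.mem_range.mp hm)
    have h := mul_neg_geom_sum ((q⁻¹) ^ m) n
    rw [← pow_mul, mul_comm m, pow_mul, hq.inv.pow_eq_one, one_pow, sub_self] at h
    have h' := (mul_eq_zero.mp h).resolve_left (sub_ne_zero.mpr hm'.symm)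
    rw [← Finset.sum_smul]
    simp only [mul_comm _ m, pow_mul, h', zero_smul]
  · intro h
    exact absurd (Finset.mem_range.mpr (NeZero.pos n)) h

end WeightSum

/-! ### String modules over the Taft algebra -/

namespace Taft

variable {k : Type u} [Field k] {n : ℕ} {q : k}

section Operators

variable {N : ℕ}

/-- The coordinate functionals of `k ^ N`, extended by zero. -/
def coordFn (j : ℕ) : (Fin N → k) →ₗ[k] k :=
  if h : j < N then LinearMap.proj ⟨j, h⟩ else 0

theorem coordFn_val (v : Fin N → k) (i : Fin N) : coordFn i v = v i := by
  simp [coordFn]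

theorem coordFn_of_le {j : ℕ} (h : N ≤ j) (v : Fin N → k) : coordFn j v = 0 := by
  simp [coordFn, not_lt.mpr h]

theorem coordFn_ext {v w : Fin N → k} (h : ∀ j < N, coordFn j v = coordFn j w) : v = w := by
  funext i
  rw [← coordFn_val v, ← coordFn_val w, h i i.2]

/-- The vector with prescribed coordinates. -/
def ofCoords (f : ℕ → (Fin N → k) →ₗ[k] k) : (Fin N → k) →ₗ[k] (Fin N → k) :=
  LinearMap.pi fun i => f i

theorem coordFn_ofCoords (f : ℕ → (Fin N → k) →ₗ[k] k) {j : ℕ} (h : j < N) (v : Fin N → k) :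
    coordFn j (ofCoords f v) = f j v := by
  simp [coordFn, h, ofCoords]

/-- The operator scaling the `j`-th coordinate by `q ^ (w + j)`. -/
def scaleOp (N : ℕ) (q : k) (w : ℕ) : (Fin N → k) →ₗ[k] (Fin N → k) :=
  ofCoords fun j => q ^ (w + j) • coordFn j

/-- The weighted shift `κ_j ↦ α_j κ_{j-1}`. -/
def lowerOp (N : ℕ) (α : ℕ → k) : (Fin N → k) →ₗ[k] (Fin N → k) :=
  ofCoords fun j => α (j + 1) • coordFn (j + 1)

theorem coordFn_scaleOp (w j : ℕ) (v : Fin N → k) :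
    coordFn j (scaleOp N q w v) = q ^ (w + j) * coordFn j v := by
  by_cases h : j < N
  · rw [scaleOp, coordFn_ofCoords _ h]; rfl
  · rw [coordFn_of_le (not_lt.mp h), coordFn_of_le (not_lt.mp h), mul_zero]

theorem coordFn_lowerOp (α : ℕ → k) (j : ℕ) (v : Fin N → k) :
    coordFn j (lowerOp N α v) = α (j + 1) * coordFn (j + 1) v := by
  by_cases h : j < N
  · rw [lowerOp, coordFn_ofCoords _ h]; rfl
  · rw [coordFn_of_le (not_lt.mp h), coordFn_of_le (by omega), mul_zero]

theorem scaleOp_pow (hq : q ^ n = 1) (w : ℕ) : scaleOp N q w ^ n = 1 := by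
  have h : ∀ m j (v : Fin N → k),
      coordFn j ((scaleOp N q w ^ m) v) = (q ^ (w + j)) ^ m * coordFn j v := by
    intro m
    induction m with
    | zero => simp
    | succ m ih => intro j v; rw [pow_succ', Module.End.mul_apply, coordFn_scaleOp, ih]; ring
  refine LinearMap.ext fun v => coordFn_ext fun j _ => ?_
  rw [h, ← pow_mul, mul_comm (w + j), pow_mul, hq, one_pow, one_mul]
  rfl

theorem lowerOp_pow (hN : N ≤ n) (α : ℕ → k) : lowerOp N α ^ n = 0 := by
  have h : ∀ m j (v : Fin N → k), N ≤ j + m → coordFn j ((lowerOp N α ^ m) v) = 0 := by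
    intro m
    induction m with
    | zero => intro j v hj; exact coordFn_of_le hj _
    | succ m ih =>
      intro j v hj
      rw [pow_succ', Module.End.mul_apply, coordFn_lowerOp, ih _ _ (by omega), mul_zero]
  refine LinearMap.ext fun v => coordFn_ext fun j _ => ?_
  rw [h _ _ _ (by omega), LinearMap.zero_apply, map_zero]

theorem lowerOp_scaleOp (w : ℕ) (α : ℕ → k) :
    lowerOp N α * scaleOp N q w = q • (scaleOp N q w * lowerOp N α) := by
  refine LinearMap.ext fun v => coordFn_ext fun j _ => ?_
  rw [Module.End.mul_apply, coordFn_lowerOp, coordFn_scaleOp, LinearMap.smul_apply, map_smul,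
    Module.End.mul_apply, coordFn_scaleOp, coordFn_lowerOp, smul_eq_mul]
  ring

end Operators

section WeightedString

variable [NeZero n] [hq : Fact (IsPrimitiveRoot q n)] {N : ℕ}

variable (q) (w : ℕ) (hN : N ≤ n) (α : ℕ → k)

/-- The right module with basis `κ_0, …, κ_{N-1}`, on which `κ_j G = q ^ (w + j) κ_j` and
`κ_j X = α_j κ_{j-1}`, with `κ_{-1} = 0`. -/
noncomputable def weightedString : RightMod k (Taft k n q) :=
  .ofAlgHom (M := Fin N → k) <| lift (op (scaleOp N q w)) (op (lowerOp N α))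
    (by rw [← MulOpposite.op_pow, scaleOp_pow hq.out.pow_eq_one, MulOpposite.op_one])
    (by rw [← MulOpposite.op_pow, lowerOp_pow hN, MulOpposite.op_zero])
    (by rw [← MulOpposite.op_mul, ← MulOpposite.op_mul, lowerOp_scaleOp, MulOpposite.op_smul])

/-- The `j`-th coordinate with respect to the basis `κ`, and `0` for `j ≥ N`. -/
def coord (j : ℕ) : (weightedString q w hN α).carrier →ₗ[k] k :=
  coordFn (N := N) j

/-- The basis vector `κ_j`, and `0` for `j ≥ N`. -/
def basisVec (j : ℕ) : (weightedString q w hN α).carrier :=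
  fun i : Fin N => if (i : ℕ) = j then (1 : k) else 0

variable {q w hN α}

theorem coord_basisVec (i j : ℕ) :
    coord q w hN α i (basisVec q w hN α j) = if i = j ∧ i < N then 1 else 0 := by
  change coordFn i (fun i : Fin N => if (i : ℕ) = j then (1 : k) else 0) = _
  by_cases h : i < N <;> simp [coordFn, h]

theorem coord_of_le {j : ℕ} (h : N ≤ j) (v) : coord q w hN α j v = 0 :=
  coordFn_of_le h _

theorem coord_ext {v v' : (weightedString q w hN α).carrier}
    (h : ∀ j < N, coord q w hN α j v = coord q w hN α j v') : v = v' :=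
  coordFn_ext h

theorem basisVec_of_le {j : ℕ} (h : N ≤ j) : basisVec q w hN α j = 0 :=
  coord_ext fun i hi => by rw [coord_basisVec, map_zero, if_neg (by omega)]

theorem sum_coord (v : (weightedString q w hN α).carrier) :
    ∑ j ∈ Finset.range N, coord q w hN α j v • basisVec q w hN α j = v :=
  coord_ext fun i hi => by
    rw [map_sum, Finset.sum_eq_single_of_mem i (Finset.mem_range.mpr hi)]
    · simp [coord_basisVec, hi]
    · intro j _ hj
      simp [coord_basisVec, hj.symm]

theorem coord_smul_G (j : ℕ) (v : (weightedString q w hN α).carrier) :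
    coord q w hN α j (v <• G n q) = q ^ (w + j) * coord q w hN α j v := by
  have h : v <• G n q = scaleOp N q w v := by
    refine (RightMod.ofAlgHom_smul _ v _).trans ?_
    rw [lift_G]
    rfl
  exact (congrArg (coord q w hN α j) h).trans (coordFn_scaleOp w j v)

theorem coord_smul_X (j : ℕ) (v : (weightedString q w hN α).carrier) :
    coord q w hN α j (v <• X n q) = α (j + 1) * coord q w hN α (j + 1) v := by
  have h : v <• X n q = lowerOp N α v := by
    refine (RightMod.ofAlgHom_smul _ v _).trans ?_
    rw [lift_X]
    rfl
  exact (congrArg (coord q w hN α j) h).trans (coordFn_lowerOp α j v)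

theorem basisVec_smul_G (j : ℕ) :
    basisVec q w hN α j <• G n q = q ^ (w + j) • basisVec q w hN α j :=
  coord_ext fun i hi => by
    rw [coord_smul_G, map_smul, coord_basisVec, smul_eq_mul]
    split_ifs with h
    · rw [h.1]
    · simp

theorem basisVec_zero_smul_X : basisVec q w hN α 0 <• X n q = 0 :=
  coord_ext fun i hi => by simp [coord_smul_X, coord_basisVec]

theorem basisVec_succ_smul_X {j : ℕ} (hj : j + 1 < N) :
    basisVec q w hN α (j + 1) <• X n q = α (j + 1) • basisVec q w hN α j :=
  coord_ext fun i hi => by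
    rw [coord_smul_X, map_smul, coord_basisVec, coord_basisVec]
    by_cases h : i = j
    · simp [h, hj, show j < N by omega]
    · simp [h]

theorem weightedString_hom_ext {P : Type u} [AddCommGroup P] [Module k P]
    {f g : (weightedString q w hN α).carrier →ₗ[k] P}
    (h : ∀ j < N, f (basisVec q w hN α j) = g (basisVec q w hN α j)) : f = g := by
  refine LinearMap.ext fun v => ?_
  rw [← sum_coord v, map_sum, map_sum]
  exact Finset.sum_congr rfl fun j hj => by
    rw [map_smul, map_smul, h j (Finset.mem_range.mp hj)]

variable (q w hN α) in
/-- The linear map sending `κ_j` to `f j`. -/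
noncomputable def weightedStringLift {P : Type u} [AddCommGroup P] [Module k P] (f : ℕ → P) :
    (weightedString q w hN α).carrier →ₗ[k] P :=
  ∑ j ∈ Finset.range N, (coord q w hN α j).smulRight (f j)

theorem weightedStringLift_basisVec {P : Type u} [AddCommGroup P] [Module k P] (f : ℕ → P) {j : ℕ}
    (hj : j < N) : weightedStringLift q w hN α f (basisVec q w hN α j) = f j := by
  rw [weightedStringLift, LinearMap.sum_apply,
    Finset.sum_eq_single_of_mem j (Finset.mem_range.mpr hj)]
  · simp [coord_basisVec, hj]
  · intro i _ hij
    simp [coord_basisVec, hij]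

/-- A family transforming like the basis `κ` defines a map of right modules. -/
theorem exists_hom_of_basisVec {P : Type u} [AddCommGroup P] [Module k P]
    [Module (Taft k n q)ᵐᵒᵖ P] [IsScalarTower k (Taft k n q)ᵐᵒᵖ P] (F : ℕ → P)
    (hG : ∀ j < N, F j <• G n q = q ^ (w + j) • F j) (h0 : F 0 <• X n q = 0)
    (h1 : ∀ j, j + 1 < N → F (j + 1) <• X n q = α (j + 1) • F j) :
    ∃ f : (weightedString q w hN α).carrier →ₗ[(Taft k n q)ᵐᵒᵖ] P,
      ∀ j < N, f (basisVec q w hN α j) = F j := by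
  let f := weightedStringLift q w hN α F
  have hf : ∀ j < N, f (basisVec q w hN α j) = F j := fun j hj => weightedStringLift_basisVec F hj
  have hfG : f ∘ₗ Algebra.lsmul k k _ (op (G n q)) = Algebra.lsmul k k _ (op (G n q)) ∘ₗ f :=
    weightedString_hom_ext fun j hj => by
      change f (_ <• G n q) = f _ <• G n q
      rw [basisVec_smul_G, map_smul, hf j hj, hG j hj]
  have hfX : f ∘ₗ Algebra.lsmul k k _ (op (X n q)) = Algebra.lsmul k k _ (op (X n q)) ∘ₗ f :=
    weightedString_hom_ext fun j hj => by
      change f (_ <• X n q) = f _ <• X n q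
      rw [hf j hj]
      cases j with
      | zero => rw [basisVec_zero_smul_X, map_zero, h0]
      | succ j => rw [basisVec_succ_smul_X hj, map_smul, hf j (by omega), h1 j hj]
  exact ⟨linearMap f (LinearMap.congr_fun hfG) (LinearMap.congr_fun hfX), hf⟩

end WeightedString

/-! ### Detecting strings as direct summands -/

theorem op_G_pow : op (G n q) ^ n = 1 := by
  rw [← MulOpposite.op_pow, G_pow, MulOpposite.op_one]

theorem smul_X_pow_smul_G {M : Type u} [AddCommGroup M] [Module k M] [Module (Taft k n q)ᵐᵒᵖ M]
    [IsScalarTower k (Taft k n q)ᵐᵒᵖ M] {c : k} {v : M} (hv : v <• G n q = c • v) (m : ℕ) :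
    q ^ m • (v <• X n q ^ m <• G n q) = c • (v <• X n q ^ m) := by
  have h := mul_pow_of_qcomm (G_mul_X n q) m
  have h' := congrArg (fun x => v <• x) h
  simp only [MulOpposite.op_smul, smul_assoc, RightMod.op_mul_smul, hv] at h'
  rw [← h', smul_comm]

section Summand

variable [NeZero n] [hq : Fact (IsPrimitiveRoot q n)]

variable (q) in
/-- The string module of length `N` with socle of weight `q ^ w`. -/
noncomputable abbrev string (w : ℕ) {N : ℕ} (hN : N ≤ n) : RightMod k (Taft k n q) :=
  weightedString q w hN fun _ => 1

variable {M : Type u} [AddCommGroup M] [Module k M] [Module (Taft k n q)ᵐᵒᵖ M]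
  [IsScalarTower k (Taft k n q)ᵐᵒᵖ M]

/-- If `v` has the weight of the top of a string `V` of length `l + 1`, if `X ^ (l + 1)` kills `v`,
and if a functional `ξ` of the weight of the socle of `V`, vanishing on `M X ^ (l + 1)`, is nonzero on
`v X ^ l`, then `V` is a retract of `M`: the embedding is given by the vectors `v X ^ (l - j)`, the
retraction, up to the scalar `ξ (v X ^ l)`, by the functionals `x ↦ ξ (x X ^ j)`. -/
theorem string_retract {w l : ℕ} (hl : l + 1 ≤ n) {v : M} {ξ : M →ₗ[k] k}
    (hvG : v <• G n q = q ^ (w + l) • v) (hvX : v <• X n q ^ (l + 1) = 0)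
    (hξG : ∀ x, ξ (x <• G n q) = q ^ w * ξ x) (hξX : ∀ x, ξ (x <• X n q ^ (l + 1)) = 0)
    (h : ξ (v <• X n q ^ l) ≠ 0) :
    ∃ (f : (string q w hl).carrier →ₗ[(Taft k n q)ᵐᵒᵖ] M)
      (g : M →ₗ[(Taft k n q)ᵐᵒᵖ] (string q w hl).carrier), ∀ x, g (f x) = x := by
  have hq0 : q ≠ 0 := hq.out.ne_zero (NeZero.ne n)
  have hXX : ∀ (x : M) i j, x <• X n q ^ i <• X n q ^ j = x <• X n q ^ (i + j) := by
    intro x i j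
    rw [← RightMod.op_mul_smul, pow_add]
  obtain ⟨f, hf⟩ := exists_hom_of_basisVec (w := w) (hN := hl) (α := fun _ => (1 : k))
    (fun j => v <• X n q ^ (l - j))
    (fun j hj => by
      have := smul_X_pow_smul_G hvG (l - j)
      rw [show w + l = (l - j) + (w + j) by omega, pow_add, mul_smul] at this
      exact smul_right_injective M (pow_ne_zero (l - j) hq0) this)
    (by rw [← RightMod.op_mul_smul, ← pow_succ, Nat.sub_zero, hvX])
    (fun j hj => by
      rw [← RightMod.op_mul_smul, ← pow_succ, show l - (j + 1) + 1 = l - j by omega, one_smul])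
  let g₀ : M →ₗ[k] (string q w hl).carrier := ∑ j ∈ Finset.range (l + 1),
    (ξ ∘ₗ Algebra.lsmul k k M (op (X n q ^ j))).smulRight (basisVec q w hl _ j)
  have hg₀ : ∀ j < l + 1, ∀ x, coord q w hl _ j (g₀ x) = ξ (x <• X n q ^ j) := by
    intro j hj x
    simp only [g₀, LinearMap.sum_apply, map_sum, LinearMap.smulRight_apply, map_smul]
    rw [Finset.sum_eq_single_of_mem j (Finset.mem_range.mpr hj)]
    · rw [LinearMap.comp_apply, Algebra.lsmul_coe]
      simp [coord_basisVec, hj]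
    · intro i _ hij
      simp [coord_basisVec, hij.symm]
  have hgG : ∀ x, g₀ (x <• G n q) = g₀ x <• G n q := fun x => coord_ext fun j hj => by
    rw [hg₀ j hj, coord_smul_G, hg₀ j hj, ← RightMod.op_mul_smul,
      mul_pow_of_qcomm (G_mul_X n q), MulOpposite.op_smul, smul_assoc, ξ.map_smul,
      RightMod.op_mul_smul, hξG, smul_eq_mul]
    ring
  have hgX : ∀ x, g₀ (x <• X n q) = g₀ x <• X n q := fun x => coord_ext fun j hj => by
    rw [hg₀ j hj, coord_smul_X, ← RightMod.op_mul_smul, ← pow_succ', one_mul]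
    rcases Nat.lt_or_ge (j + 1) (l + 1) with h | h
    · rw [hg₀ _ h]
    · rw [coord_of_le h, show j = l by omega, hξX]
  have hξ : ∀ i j, i < l + 1 → j < l + 1 → i ≠ j → ξ (v <• X n q ^ (l - j + i)) = 0 := by
    intro i j hi hj hij
    rcases Nat.lt_or_ge j i with h | h
    · rw [show l - j + i = (l + 1) + (i - j - 1) by omega, ← hXX, hvX, smul_zero, map_zero]
    · -- the two weights of this vector differ by `q ^ (j - i)`
      have h1 := congrArg ξ (smul_X_pow_smul_G hvG (l - j + i))
      rw [ξ.map_smul, ξ.map_smul, hξG, show w + l = (l - j + i) + (w + (j - i)) by omega,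
        smul_eq_mul, smul_eq_mul, pow_add q (l - j + i), mul_assoc, pow_add q w, mul_assoc] at h1
      have h2 := mul_left_cancel₀ (pow_ne_zero _ hq0) (mul_left_cancel₀ (pow_ne_zero _ hq0) h1)
      have h3 : (q ^ (j - i) - 1) * ξ (v <• X n q ^ (l - j + i)) = 0 := by
        rw [sub_mul, ← h2, one_mul, sub_self]
      exact (mul_eq_zero.mp h3).resolve_left
        (sub_ne_zero.mpr (hq.out.pow_ne_one_of_pos_of_lt (by omega) (by omega)))
  have hgf : g₀ ∘ₗ f.restrictScalars k = ξ (v <• X n q ^ l) • LinearMap.id :=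
    weightedString_hom_ext fun j hj => coord_ext fun i hi => by
      rw [LinearMap.comp_apply, LinearMap.coe_restrictScalars, hf j hj, hg₀ i hi, hXX,
        LinearMap.smul_apply, LinearMap.id_apply, LinearMap.map_smul, coord_basisVec]
      by_cases hij : i = j
      · simp [hij, hj, show l - j + j = l by omega]
      · rw [hξ i j hi hj hij, if_neg fun h => hij h.1, smul_zero]
  refine ⟨f, linearMap ((ξ (v <• X n q ^ l))⁻¹ • g₀) (fun x => ?_) (fun x => ?_), fun x => ?_⟩
  · rw [LinearMap.smul_apply, hgG, LinearMap.smul_apply, smul_comm]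
  · rw [LinearMap.smul_apply, hgX, LinearMap.smul_apply, smul_comm]
  · exact (congrArg ((ξ (v <• X n q ^ l))⁻¹ • ·) (LinearMap.congr_fun hgf x)).trans
      (inv_smul_smul₀ h x)

theorem coord_zero_smul_X_pow {w N : ℕ} {hN : N ≤ n} : ∀ (j : ℕ) (v : (string q w hN).carrier),
    coord q w hN _ 0 (v <• X n q ^ j) = coord q w hN _ j v
  | 0, v => by simp
  | j + 1, v => by
    rw [pow_succ', RightMod.op_mul_smul, coord_zero_smul_X_pow j, coord_smul_X, one_mul]

theorem basisVec_smul_X_pow {w N : ℕ} {hN : N ≤ n} : ∀ (j : ℕ) {m : ℕ}, m < N →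
    basisVec q w hN (fun _ => 1) m <• X n q ^ j =
      if j ≤ m then basisVec q w hN _ (m - j) else 0
  | 0, m, _ => by simp
  | j + 1, 0, _ => by
    rw [pow_succ', RightMod.op_mul_smul, basisVec_zero_smul_X, smul_zero, if_neg (by omega)]
  | j + 1, m + 1, hm => by
    rw [pow_succ', RightMod.op_mul_smul, basisVec_succ_smul_X hm, one_smul,
      basisVec_smul_X_pow j (by omega), Nat.add_sub_add_right]
    simp only [Nat.add_le_add_iff_right]

/-- A string `V` is a direct summand of `M` if some map `g : M → V` is nonzero at the top of `V` on
a vector `v` behaving like the top vector of `V`. -/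
theorem string_dominated_of_hom {w l : ℕ} (hl : l + 1 ≤ n)
    (g : M →ₗ[(Taft k n q)ᵐᵒᵖ] (string q w hl).carrier) {v : M}
    (hvG : v <• G n q = q ^ (w + l) • v) (hvX : v <• X n q ^ (l + 1) = 0)
    (h : coord q w hl _ l (g v) ≠ 0) :
    Dominated (Taft k n q)ᵐᵒᵖ (string q w hl).carrier M := by
  obtain ⟨f', g', hfg⟩ := string_retract (w := w) hl (v := v)
    (ξ := coord q w hl _ 0 ∘ₗ g.restrictScalars k) hvG hvX
    (fun x => by
      rw [LinearMap.comp_apply, LinearMap.coe_restrictScalars, map_smul, coord_smul_G]; rfl)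
    (fun x => by
      rw [LinearMap.comp_apply, LinearMap.coe_restrictScalars, map_smul, coord_zero_smul_X_pow,
        coord_of_le le_rfl])
    (by rwa [LinearMap.comp_apply, LinearMap.coe_restrictScalars, map_smul, coord_zero_smul_X_pow])
  exact .of_comp f' g' hfg

/-- If a composition `V → M → V` of maps of right modules, with `V` a string, does not kill the
socle of `V`, then `V` is a direct summand of `M`. -/
theorem string_dominated_of_comp {w l : ℕ} (hl : l + 1 ≤ n)
    (f : (string q w hl).carrier →ₗ[(Taft k n q)ᵐᵒᵖ] M)
    (g : M →ₗ[(Taft k n q)ᵐᵒᵖ] (string q w hl).carrier)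
    (h : coord q w hl _ 0 (g (f (basisVec q w hl _ 0))) ≠ 0) :
    Dominated (Taft k n q)ᵐᵒᵖ (string q w hl).carrier M := by
  refine string_dominated_of_hom hl g (v := f (basisVec q w hl _ l)) ?_ ?_ ?_
  · rw [← map_smul, basisVec_smul_G, ← LinearMap.coe_restrictScalars k, map_smul]
  · rw [← map_smul, basisVec_smul_X_pow _ (by omega), if_neg (by omega), map_zero]
  · rwa [← coord_zero_smul_X_pow, ← map_smul, ← map_smul, basisVec_smul_X_pow _ (by omega),
      if_pos le_rfl, Nat.sub_self]

/-- Every finite-dimensional right module over the Taft algebra is a direct sum of strings; hence a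
module dominating all strings dominates all finite-dimensional modules. -/
theorem dominated_of_string {P : Type u} [AddCommGroup P] [Module (Taft k n q)ᵐᵒᵖ P]
    (hP : ∀ (w l : ℕ) (_ : w < n) (hl : l + 1 ≤ n),
      Dominated (Taft k n q)ᵐᵒᵖ (string q w hl).carrier P) [FiniteDimensional k M] :
    Dominated (Taft k n q)ᵐᵒᵖ M P := by
  obtain ⟨r, hr⟩ : ∃ r, Module.finrank k M = r := ⟨_, rfl⟩
  induction r using Nat.strong_induction_on generalizing M with
  | _ r ih =>
  rcases subsingleton_or_nontrivial M with hM | hM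
  · exact ⟨Empty, inferInstance, Empty.elim, Empty.elim, fun x => Subsingleton.elim _ _⟩
  have hq0 : q ≠ 0 := hq.out.ne_zero (NeZero.ne n)
  have hn0 : (n : k) ≠ 0 := (hq.out.neZero').out
  -- the nilpotency index `l + 1` of `X`, and a weight vector not killed by `X ^ l`
  classical
  have hex : ∃ m, ∀ v : M, v <• X n q ^ m = 0 := ⟨n, fun v => by simp [X_pow]⟩
  obtain ⟨l, hl⟩ : ∃ l, Nat.find hex = l + 1 := Nat.exists_eq_succ_of_ne_zero fun h0 => by
    obtain ⟨v, hv⟩ := exists_ne (0 : M)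
    have := Nat.find_spec hex v
    rw [h0, pow_zero, MulOpposite.op_one, one_smul] at this
    exact hv this
  have hX : ∀ v : M, v <• X n q ^ (l + 1) = 0 := hl ▸ Nat.find_spec hex
  have hln : l + 1 ≤ n := hl ▸ Nat.find_min' hex fun v => by simp [X_pow]
  obtain ⟨v₀, hv₀⟩ : ∃ v : M, v <• X n q ^ l ≠ 0 := by
    have := Nat.find_min hex (m := l) (by omega)
    push Not at this
    exact this
  let p : ℕ → (Taft k n q)ᵐᵒᵖ := weightSum n q (op (G n q))
  have hpG : ∀ w (x : M), (p w • x) <• G n q = q ^ w • p w • x := fun w x => by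
    rw [← mul_smul, mul_weightSum hq.out op_G_pow, smul_assoc]
  obtain ⟨e, he⟩ : ∃ e, (p e • v₀) <• X n q ^ l ≠ 0 := by
    by_contra! hcon
    have h1 : ∑ w ∈ Finset.range n, (p w • v₀) <• X n q ^ l = (n : k) • (v₀ <• X n q ^ l) := by
      rw [← Finset.smul_sum, ← Finset.sum_smul, sum_weightSum hq.out, smul_assoc, one_smul,
        smul_comm]
    rw [Finset.sum_eq_zero fun w _ => hcon w] at h1
    exact hv₀ ((smul_eq_zero.mp h1.symm).resolve_left hn0)
  -- the weight of the socle of the string generated by `p e • v₀`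
  obtain ⟨w, hwn, hw⟩ := exists_pow_eq_pow_add hq.out.pow_eq_one e l
  have hvG := hpG e v₀
  rw [hw] at hvG
  set v := p e • v₀ with hv
  have huG : v <• X n q ^ l <• G n q = q ^ w • (v <• X n q ^ l) := by
    have := smul_X_pow_smul_G hvG l
    rw [add_comm, pow_add, mul_smul] at this
    exact smul_right_injective M (pow_ne_zero l hq0) this
  obtain ⟨η, hη⟩ : ∃ η : Module.Dual k M, η (v <• X n q ^ l) ≠ 0 := by
    by_contra! hcon
    exact he ((Module.forall_dual_apply_eq_zero_iff k _).mp hcon)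
  obtain ⟨f, g, hgf⟩ := string_retract (w := w) hln (v := v)
    (ξ := η ∘ₗ Algebra.lsmul k k M (p w)) hvG (hX v)
    (fun x => by
      change η (p w • x <• G n q) = q ^ w * η (p w • x)
      rw [← mul_smul, weightSum_mul, mul_weightSum hq.out op_G_pow, smul_assoc, η.map_smul,
        smul_eq_mul])
    (fun x => by rw [hX, map_zero])
    (by
      change η (p w • (v <• X n q ^ l)) ≠ 0
      rw [weightSum_smul_of_smul_eq hq.out huG, map_smul]
      exact mul_ne_zero hn0 hη)
  -- split off the string, and continue with the kernel of the retraction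
  let K := LinearMap.ker g
  have hK : Module.finrank k K < r := by
    have hlt : K.restrictScalars k < ⊤ := by
      refine lt_top_iff_ne_top.mpr fun htop => ?_
      have h1 : f (basisVec q w hln _ 0) ∈ K.restrictScalars k := htop ▸ Submodule.mem_top
      have h2 : g (f (basisVec q w hln _ 0)) = 0 := h1
      rw [hgf] at h2
      have h3 := congrArg (coord q w hln _ 0) h2
      simp [coord_basisVec] at h3
    have := Submodule.finrank_lt hlt.ne
    rwa [hr] at this
  have : FiniteDimensional k K :=
    inferInstanceAs (FiniteDimensional k (K.restrictScalars k))
  exact Dominated.add (e := f ∘ₗ g) (e' := LinearMap.id - f ∘ₗ g) (fun x => by simp)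
    g f (fun x => rfl)
    ((LinearMap.id - f ∘ₗ g).codRestrict K fun x => by simp [K, hgf]) K.subtype (fun x => rfl)
    (hP w l hwn hln) (ih _ hK rfl)

end Summand

end Taft

/-! ### More on `q`-binomial coefficients -/

section QBinomial

variable {k : Type u} [Field k]

theorem qBinom_ne_zero {q : k} {n : ℕ} (hq : IsPrimitiveRoot q n) {m : ℕ} (hm : m < n) :
    ∀ j ≤ m, qBinom q m j ≠ 0
  | 0, _ => by simp [qBinom_zero_right]
  | j + 1, hj => by
    have hq0 : q ≠ 0 := hq.ne_zero (by omega)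
    intro h0
    have h := qBinom_step q m j
    rw [h0, mul_zero, eq_comm] at h
    rcases mul_eq_zero.mp h with h | h
    · rw [sub_eq_zero] at h
      exact absurd (hq.pow_inj hm (by omega) h) (by omega)
    · exact qBinom_ne_zero hq hm j (by omega) h

/-- A `q`-analogue of the hockey-stick identity. -/
theorem sum_qBinom_diagonal (q : k) (l w : ℕ) :
    ∑ i ∈ Finset.range (w + 1), q ^ i * qBinom q (l + i) i = qBinom q (l + w + 1) w := by
  induction w with
  | zero => simp [qBinom_zero_right]
  | succ w ih => rw [Finset.sum_range_succ, ih, show l + (w + 1) = l + w + 1 by ring]; rfl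

end QBinomial

theorem choose_two_add (p i : ℕ) :
    (p + i).choose 2 = p.choose 2 + i * p + i.choose 2 := by
  induction i with
  | zero => simp
  | succ i ih =>
    rw [← add_assoc, Nat.choose_succ_succ' (p + i) 1, Nat.choose_succ_succ' i 1, ih]
    simp only [Nat.choose_one_right]
    ring

/-! ### Strings in tensor products of strings -/

namespace Taft

variable {k : Type u} [Field k] {n : ℕ} {q : k} [NeZero n] [hq : Fact (IsPrimitiveRoot q n)]

section

variable {w N : ℕ} {hN : N ≤ n} {w' N' : ℕ} {hN' : N' ≤ n}

variable (q w hN) in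
/-- The vector `κ_{i-1}`, with `κ_{-1} = 0`. -/
noncomputable def predVec :
    ℕ → (string q w hN).carrier
  | 0 => 0
  | i + 1 => basisVec q w hN _ i

theorem basisVec_smul_X {i : ℕ} (hi : i < N) :
    basisVec q w hN (fun _ => 1) i <• X n q = predVec q w hN i := by
  cases i with
  | zero => exact basisVec_zero_smul_X
  | succ i => rw [basisVec_succ_smul_X hi, one_smul]; rfl

variable (q w hN w' hN') in
/-- The basis vector `κ_i ⊗ κ_j` of a tensor product of two strings. -/
noncomputable abbrev basisTmul (i j : ℕ) : ((string q w hN).tensor (string q w' hN')).carrier :=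
  RightMod.tmul (string q w hN) (string q w' hN') (basisVec q w hN _ i) (basisVec q w' hN' _ j)

theorem basisTmul_smul_G (i j : ℕ) : basisTmul q w hN w' hN' i j <• G n q =
    q ^ (w + i + (w' + j)) • basisTmul q w hN w' hN' i j := by
  rw [RightMod.tmul_smul_of_grouplike comul_G, basisVec_smul_G, basisVec_smul_G, map_smul,
    LinearMap.map_smul₂, smul_smul, ← pow_add, add_comm (w' + j)]

theorem basisTmul_smul_X {i j : ℕ} (hi : i < N) (hj : j < N') :
    basisTmul q w hN w' hN' i j <• X n q =
      q ^ (w' + j) • RightMod.tmul _ _ (predVec q w hN i) (basisVec q w' hN' _ j) +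
        RightMod.tmul _ _ (basisVec q w hN _ i) (predVec q w' hN' j) := by
  rw [RightMod.tmul_smul_of_primitive comul_X, basisVec_smul_G, basisVec_smul_X hi,
    basisVec_smul_X hj, map_smul]

theorem basisTmul_smul_X_pow : ∀ (m i j : ℕ), i < N → j < N' → i + j < m →
    basisTmul q w hN w' hN' i j <• X n q ^ m = 0
  | 0, _, _, _, _, h => absurd h (by omega)
  | m + 1, i, j, hi, hj, h => by
    rw [pow_succ', RightMod.op_mul_smul, basisTmul_smul_X hi hj, smul_add, smul_comm]
    have h1 : RightMod.tmul _ _ (predVec q w hN i) (basisVec q w' hN' (fun _ => 1) j) <•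
        X n q ^ m = 0 := by
      cases i with
      | zero => simp [predVec]
      | succ i => exact basisTmul_smul_X_pow m i j (by omega) hj (by omega)
    have h2 : RightMod.tmul _ _ (basisVec q w hN (fun _ => 1) i) (predVec q w' hN' j) <•
        X n q ^ m = 0 := by
      cases j with
      | zero => simp [predVec]
      | succ j => exact basisTmul_smul_X_pow m i j hi (by omega) (by omega)
    rw [h1, h2, smul_zero, add_zero]

theorem basisTmul_hom_ext {P : Type u} [AddCommGroup P] [Module k P]
    {f g : ((string q w hN).tensor (string q w' hN')).carrier →ₗ[k] P}
    (h : ∀ i < N, ∀ j < N', f (basisTmul q w hN w' hN' i j) = g (basisTmul q w hN w' hN' i j)) :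
    f = g := by
  have h' : (RightMod.tmul _ _).compr₂ f = (RightMod.tmul _ _).compr₂ g :=
    weightedString_hom_ext fun i hi => weightedString_hom_ext fun j hj => h i hi j hj
  exact RightMod.tensor_ext fun v u => LinearMap.congr_fun₂ h' v u

variable (q w hN w' hN') in
/-- The linear map on a tensor product of two strings with prescribed values on the basis. -/
noncomputable def basisTmulLift {P : Type u} [AddCommGroup P] [Module k P] (F : ℕ → ℕ → P) :
    ((string q w hN).tensor (string q w' hN')).carrier →ₗ[k] P :=
  RightMod.tensorLift <| weightedStringLift q w hN _ fun i => weightedStringLift q w' hN' _ (F i)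

theorem basisTmulLift_apply {P : Type u} [AddCommGroup P] [Module k P] (F : ℕ → ℕ → P) {i j : ℕ}
    (hi : i < N) (hj : j < N') :
    basisTmulLift q w hN w' hN' F (basisTmul q w hN w' hN' i j) = F i j := by
  rw [basisTmulLift, RightMod.tensorLift_tmul, weightedStringLift_basisVec _ hi,
    weightedStringLift_basisVec _ hj]

/-- A family `F i j` transforming like `κ_i ⊗ κ_j` under the Taft algebra defines a map of right
modules. -/
theorem exists_hom_of_basisTmul {P : Type u} [AddCommGroup P] [Module k P]
    [Module (Taft k n q)ᵐᵒᵖ P] [IsScalarTower k (Taft k n q)ᵐᵒᵖ P] (F : ℕ → ℕ → P)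
    (hG : ∀ i j, F i j <• G n q = q ^ (w + i + (w' + j)) • F i j)
    (h00 : F 0 0 <• X n q = 0)
    (h0 : ∀ j, j + 1 < N' → F 0 (j + 1) <• X n q = F 0 j)
    (h0' : ∀ i, i + 1 < N → F (i + 1) 0 <• X n q = q ^ w' • F i 0)
    (h1 : ∀ i j, i + 1 < N → j + 1 < N' →
      F (i + 1) (j + 1) <• X n q = q ^ (w' + (j + 1)) • F i (j + 1) + F (i + 1) j) :
    ∃ g : ((string q w hN).tensor (string q w' hN')).carrier →ₗ[(Taft k n q)ᵐᵒᵖ] P,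
      ∀ i < N, ∀ j < N', g (basisTmul q w hN w' hN' i j) = F i j := by
  let g := basisTmulLift q w hN w' hN' F
  have hg : ∀ i j, i < N → j < N' → g (basisTmul q w hN w' hN' i j) = F i j :=
    fun i j => basisTmulLift_apply F
  have hgG : g ∘ₗ Algebra.lsmul k k _ (op (G n q)) = Algebra.lsmul k k _ (op (G n q)) ∘ₗ g :=
    basisTmul_hom_ext fun i hi j hj => by
      change g (_ <• G n q) = g _ <• G n q
      rw [basisTmul_smul_G, map_smul, hg i j hi hj, hG]
  have hgX : g ∘ₗ Algebra.lsmul k k _ (op (X n q)) = Algebra.lsmul k k _ (op (X n q)) ∘ₗ g :=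
    basisTmul_hom_ext fun i hi j hj => by
      change g (_ <• X n q) = g _ <• X n q
      rw [basisTmul_smul_X hi hj, map_add, map_smul, hg i j hi hj]
      rcases i with _ | i <;> rcases j with _ | j
      · simp [predVec, h00]
      · rw [h0 j hj, ← hg 0 j hi (by omega)]
        simp [predVec]
      · rw [h0' i hi, ← hg i 0 (by omega) hj]
        simp [predVec]
      · rw [h1 i j hi hj, ← hg i (j + 1) (by omega) hj, ← hg (i + 1) j hi (by omega)]
        rfl
  exact ⟨linearMap g (LinearMap.congr_fun hgG) (LinearMap.congr_fun hgX), fun i hi j hj =>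
    hg i j hi hj⟩

end

/-- A string `V(w, l + 1)` with `n ≤ w + l + 1` is the component of highest length of
`V(w, n - w) ⊗ V(0, w + l + 2 - n)`; it is generated by the tensor product of the top vectors. -/
theorem string_dominated_tensor_of_le {w l : ℕ} (hw : w < n) (hl : l + 1 ≤ n)
    (hwl : n ≤ w + l + 1) (h₁ : n - w ≤ n) (h₂ : w + l + 2 - n ≤ n) :
    Dominated (Taft k n q)ᵐᵒᵖ (string q w hl).carrier
      ((string q w h₁).tensor (string q 0 h₂)).carrier := by
  obtain ⟨g, hg⟩ := exists_hom_of_basisTmul (q := q) (w := w) (hN := h₁) (w' := 0) (hN' := h₂)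
    (fun i j => qBinom q (i + j) j • basisVec q w hl (fun _ => 1) (i + j))
    (fun i j => by
      rw [RightMod.smul_op_smul, basisVec_smul_G, smul_comm, zero_add, ← add_assoc])
    (by rw [RightMod.smul_op_smul, add_zero, basisVec_zero_smul_X, smul_zero])
    (fun j hj => by
      rw [RightMod.smul_op_smul, zero_add, zero_add, basisVec_succ_smul_X (by omega),
        qBinom_self, qBinom_self, one_smul])
    (fun i hi => by
      rw [RightMod.smul_op_smul, add_zero, add_zero, basisVec_succ_smul_X (by omega),
        qBinom_zero_right, qBinom_zero_right, one_smul, one_smul, pow_zero, one_smul])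
    (fun i j hi hj => by
      rw [RightMod.smul_op_smul, show i + 1 + (j + 1) = i + j + 1 + 1 by ring,
        basisVec_succ_smul_X (by omega), one_smul, smul_smul, show i + 1 + j = i + j + 1 by ring,
        show i + (j + 1) = i + j + 1 by ring, ← add_smul, qBinom, zero_add,
        add_comm (qBinom q (i + j + 1) j)])
  refine string_dominated_of_hom hl g
    (v := basisTmul q w h₁ 0 h₂ (n - w - 1) (w + l + 1 - n)) ?_ ?_ ?_
  · rw [basisTmul_smul_G, show w + (n - w - 1) + (0 + (w + l + 1 - n)) = w + l by omega]
  · exact basisTmul_smul_X_pow _ _ _ (by omega) (by omega) (by omega)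
  · rw [hg _ (by omega) _ (by omega), map_smul, show n - w - 1 + (w + l + 1 - n) = l by omega,
      coord_basisVec, if_pos ⟨rfl, by omega⟩, smul_eq_mul, mul_one]
    exact qBinom_ne_zero hq.out (by omega) _ (by omega)

/-- The coefficients of the embedding of `V(w, L)` into `V(0, w + 1) ⊗ V(0, w + L)`. -/
noncomputable def embCoeff (q : k) (i p e : ℕ) : k :=
  (-1) ^ i * q ^ p.choose 2 * qBinom q (p + e) e

/-- The coefficients of the projection of `V(0, w + 1) ⊗ V(0, w + l + 1)` onto `V(w, l + 1)`, where
`m = w + l`. -/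
noncomputable def projCoeff (q : k) (m i j : ℕ) : k :=
  (-1) ^ i * q ^ (i * j + (i + 1).choose 2) * qBinom q (m - j) i

theorem embCoeff_zero (i p : ℕ) :
    q ^ p * embCoeff q (i + 1) p 0 + embCoeff q i (p + 1) 0 = 0 := by
  simp only [embCoeff, qBinom_zero_right, choose_two_add p 1]
  simp
  ring

theorem embCoeff_succ (i p e : ℕ) :
    q ^ (p + e + 1) * embCoeff q (i + 1) p (e + 1) + embCoeff q i (p + 1) (e + 1) =
      embCoeff q i (p + 1) e := by
  have h : qBinom q (p + e + 2) (e + 1) =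
    qBinom q (p + e + 1) e + q ^ (e + 1) * qBinom q (p + e + 1) (e + 1) := rfl
  simp only [embCoeff, choose_two_add p 1, show p + 1 + (e + 1) = p + e + 2 by ring,
    show p + (e + 1) = p + e + 1 by ring, show p + 1 + e = p + e + 1 by ring, h]
  simp
  ring

theorem embCoeff_self (i e : ℕ) : embCoeff q i 0 e = (-1) ^ i := by
  simp [embCoeff, qBinom_self]

theorem projCoeff_succ {m j : ℕ} (hj : j + 1 ≤ m) (i : ℕ) :
    q ^ (j + 1) * projCoeff q m i (j + 1) + projCoeff q m (i + 1) j =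
      projCoeff q m (i + 1) (j + 1) := by
  obtain ⟨r, rfl⟩ := Nat.exists_eq_add_of_le hj
  simp only [projCoeff, show j + 1 + r - (j + 1) = r by omega,
    show j + 1 + r - j = r + 1 by omega, qBinom, choose_two_add (i + 1) 1]
  simp
  ring

theorem projCoeff_eq_zero {m i j : ℕ} (h : m < i + j) (hj : j ≤ m) : projCoeff q m i j = 0 := by
  rw [projCoeff, qBinom_of_lt _ _ _ (by omega), mul_zero]

/-- The scalar by which the projection composed with the embedding acts on the socle. -/
theorem sum_embCoeff_mul_projCoeff (w l : ℕ) :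
    ∑ p ∈ Finset.HasAntidiagonal.antidiagonal w,
      embCoeff q p.1 p.2 0 * projCoeff q (w + l) p.1 p.2 =
      q ^ w.choose 2 * qBinom q (l + w + 1) w := by
  rw [← sum_qBinom_diagonal, Finset.mul_sum, Finset.Nat.sum_antidiagonal_eq_sum_range_succ_mk]
  refine Finset.sum_congr rfl fun i hi => ?_
  obtain ⟨p, rfl⟩ := Nat.exists_eq_add_of_le (Nat.lt_succ_iff.mp (Finset.mem_range.mp hi))
  have h1 : ((-1 : k) ^ i) * (-1) ^ i = 1 := by rw [← mul_pow]; simp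
  rw [show i + p - i = p by omega]
  simp only [embCoeff, projCoeff, show i + p + l - p = l + i by omega, qBinom_zero_right]
  rw [add_comm i p, choose_two_add p i, choose_two_add i 1]
  simp only [mul_one, one_mul, Nat.choose_eq_zero_of_lt (show 1 < 2 by norm_num), add_zero]
  linear_combination q ^ (p.choose 2) * q ^ (i * p + (i.choose 2 + i)) * qBinom q (l + i) i * h1

/-- A string `V(w, l + 1)` with `0 < w` and `w + l + 1 < n` is the component of lowest length of
`V(0, w + 1) ⊗ V(0, w + l + 1)`. The embedding and the projection compose to a nonzero `q`-binomial
coefficient. -/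
theorem string_dominated_tensor_of_lt {w l : ℕ} (hw : 0 < w) (hl : l + 1 ≤ n)
    (hwl : w + l + 1 < n) (h₁ : w + 1 ≤ n) (h₂ : w + l + 1 ≤ n) :
    Dominated (Taft k n q)ᵐᵒᵖ (string q w hl).carrier
      ((string q 0 h₁).tensor (string q 0 h₂)).carrier := by
  have hq0 : q ≠ 0 := hq.out.ne_zero (NeZero.ne n)
  have hanti : ∀ {p : ℕ × ℕ} {m : ℕ}, p ∈ Finset.HasAntidiagonal.antidiagonal m → p.1 + p.2 = m :=
    fun h => Finset.HasAntidiagonal.mem_antidiagonal.mp h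
  obtain ⟨g, hg⟩ := exists_hom_of_basisTmul (q := q) (w := 0) (hN := h₁) (w' := 0) (hN' := h₂)
    (fun i j => if w ≤ i + j then
      projCoeff q (w + l) i j • basisVec q w hl (fun _ => 1) (i + j - w) else 0)
    (fun i j => by
      split_ifs with h
      · rw [RightMod.smul_op_smul, basisVec_smul_G, smul_comm, show w + (i + j - w) = 0 + i + (0 + j) by omega]
      · rw [smul_zero, smul_zero])
    (by rw [if_neg (by omega), smul_zero])
    (fun j hj => by
      have h1 : projCoeff q (w + l) 0 (j + 1) = projCoeff q (w + l) 0 j := by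
        simp [projCoeff, qBinom_zero_right]
      rcases lt_trichotomy (j + 1) w with h | h | h
      · rw [if_neg (by omega), if_neg (by omega), smul_zero]
      · rw [if_pos (by omega), if_neg (by omega), show 0 + (j + 1) - w = 0 by omega, RightMod.smul_op_smul,
          basisVec_zero_smul_X, smul_zero]
      · rw [if_pos (by omega), if_pos (by omega), show 0 + (j + 1) - w = (0 + j - w) + 1 by omega,
          RightMod.smul_op_smul, basisVec_succ_smul_X (by omega), one_smul, h1])
    (fun i hi => by
      rw [if_neg (show ¬w ≤ i + 0 by omega), smul_zero]
      split_ifs with h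
      · rw [show i + 1 + 0 - w = 0 by omega, RightMod.smul_op_smul, basisVec_zero_smul_X, smul_zero]
      · rw [smul_zero])
    (fun i j hi hj => by
      rcases lt_trichotomy (i + j + 2) w with h | h | h
      · rw [if_neg (by omega), if_neg (by omega), if_neg (by omega)]
        simp
      · rw [if_pos (by omega), if_neg (by omega), if_neg (by omega),
          show i + 1 + (j + 1) - w = 0 by omega, RightMod.smul_op_smul, basisVec_zero_smul_X]
        simp
      · rw [if_pos (by omega), if_pos (by omega), if_pos (by omega),
          show i + 1 + (j + 1) - w = (i + j + 1 - w) + 1 by omega,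
          show i + (j + 1) - w = i + j + 1 - w by omega,
          show i + 1 + j - w = i + j + 1 - w by omega, smul_smul, ← add_smul, zero_add,
          projCoeff_succ (by omega), RightMod.smul_op_smul]
        rcases Nat.lt_or_ge (i + j + 1 - w + 1) (l + 1) with h' | h'
        · rw [basisVec_succ_smul_X h', one_smul]
        · rw [projCoeff_eq_zero (by omega) (by omega), zero_smul, zero_smul])
  obtain ⟨w, rfl⟩ : ∃ w', w = w' + 1 := ⟨w - 1, by omega⟩
  have hfX : ∀ e < l + 1, (∑ p ∈ Finset.HasAntidiagonal.antidiagonal (w + 1),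
      embCoeff q p.1 p.2 e • basisTmul q 0 h₁ 0 h₂ p.1 (p.2 + e)) <• X n q =
      ∑ p ∈ Finset.HasAntidiagonal.antidiagonal w,
        (q ^ (p.2 + e) * embCoeff q (p.1 + 1) p.2 e + embCoeff q p.1 (p.2 + 1) e) •
          basisTmul q 0 h₁ 0 h₂ p.1 (p.2 + e) +
      embCoeff q (w + 1) 0 e • RightMod.tmul (string q 0 h₁) (string q 0 h₂)
        (basisVec q 0 h₁ _ (w + 1)) (predVec q 0 h₂ e) := by
    intro e he
    have h1 : ∀ p ∈ Finset.HasAntidiagonal.antidiagonal (w + 1),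
        (embCoeff q p.1 p.2 e • basisTmul q 0 h₁ 0 h₂ p.1 (p.2 + e)) <• X n q =
        (q ^ (p.2 + e) * embCoeff q p.1 p.2 e) • RightMod.tmul (string q 0 h₁) (string q 0 h₂)
          (predVec q 0 h₁ p.1) (basisVec q 0 h₂ _ (p.2 + e)) +
        embCoeff q p.1 p.2 e • RightMod.tmul (string q 0 h₁) (string q 0 h₂)
          (basisVec q 0 h₁ _ p.1) (predVec q 0 h₂ (p.2 + e)) := fun p hp => by
      have hp' := hanti hp
      rw [RightMod.smul_op_smul, basisTmul_smul_X (by omega) (by omega), smul_add, smul_smul,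
        zero_add, mul_comm]
    rw [Finset.smul_sum, Finset.sum_congr rfl h1, Finset.sum_add_distrib,
      Finset.Nat.sum_antidiagonal_succ, Finset.Nat.sum_antidiagonal_succ']
    simp only [predVec, map_zero, LinearMap.zero_apply, smul_zero, zero_add, add_smul,
      Finset.sum_add_distrib, show ∀ m, m + 1 + e = m + e + 1 from fun m => by ring]
    abel
  obtain ⟨f, hf⟩ := exists_hom_of_basisVec (q := q) (w := w + 1) (hN := hl) (α := fun _ => (1 : k))
    (fun e => ∑ p ∈ Finset.HasAntidiagonal.antidiagonal (w + 1),
      embCoeff q p.1 p.2 e • basisTmul q 0 h₁ 0 h₂ p.1 (p.2 + e))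
    (fun e he => by
      rw [Finset.smul_sum, Finset.smul_sum]
      refine Finset.sum_congr rfl fun p hp => ?_
      rw [RightMod.smul_op_smul, basisTmul_smul_G, smul_comm]
      have := hanti hp
      rw [show 0 + p.1 + (0 + (p.2 + e)) = w + 1 + e by omega])
    (by
      rw [hfX 0 (by omega), Finset.sum_eq_zero fun p _ => ?_]
      · simp [predVec]
      · rw [add_zero, embCoeff_zero, zero_smul])
    (fun e he => by
      rw [hfX (e + 1) he, one_smul]
      conv_rhs => rw [Finset.Nat.sum_antidiagonal_succ', add_comm]
      congr 1
      · refine Finset.sum_congr rfl fun p _ => ?_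
        rw [show p.2 + 1 + e = p.2 + (e + 1) by ring]
        exact congrArg (· • basisTmul q 0 h₁ 0 h₂ p.1 (p.2 + (e + 1))) (embCoeff_succ p.1 p.2 e)
      · rw [embCoeff_self, embCoeff_self, zero_add]; rfl)
  refine string_dominated_of_comp hl f g ?_
  rw [hf 0 (by omega), map_sum, map_sum]
  have : ∀ p ∈ Finset.HasAntidiagonal.antidiagonal (w + 1), coord q (w + 1) hl (fun _ => (1 : k)) 0
      (g (embCoeff q p.1 p.2 0 • basisTmul q 0 h₁ 0 h₂ p.1 (p.2 + 0))) =
      embCoeff q p.1 p.2 0 * projCoeff q (w + 1 + l) p.1 p.2 := fun p hp => by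
    have hp' := hanti hp
    rw [LinearMap.map_smul_of_tower, hg _ (by omega) _ (by omega), if_pos (by omega), map_smul,
      map_smul, coord_basisVec, if_pos ⟨by omega, by omega⟩, smul_eq_mul, smul_eq_mul, mul_one,
      add_zero]
  rw [Finset.sum_congr rfl this, sum_embCoeff_mul_projCoeff]
  exact mul_ne_zero (pow_ne_zero _ hq0) (qBinom_ne_zero hq.out (by omega) _ (by omega))

end Taft

/-! ### Restriction of right modules -/

namespace RightMod

variable {k R H : Type u} [Field k] [Ring R] [Algebra k R] [Ring H] [Algebra k H]
  (i : R →ₐ[k] H) {V W : RightMod k H}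

/-- The action of an element of `H`, as a `k`-linear map. -/
def actBy {M : Type u} [AddCommGroup M] [Module k M] [Module Hᵐᵒᵖ M] [IsScalarTower k Hᵐᵒᵖ M]
    (x : H) : M →ₗ[k] M where
  toFun v := v <• x
  map_add' := smul_add _
  map_smul' c v := smul_op_smul c v x

/-- A map of `H`-modules, as a map of the restricted modules. -/
def restrictMap (f : V.carrier →ₗ[Hᵐᵒᵖ] W.carrier) :
    (V.restrict i).carrier →ₗ[Rᵐᵒᵖ] (W.restrict i).carrier where
  toFun := f
  map_add' := f.map_add'
  map_smul' r v := f.map_smul' (AlgHom.op i r) v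

end RightMod

namespace Taft

variable {k : Type u} [Field k] {n : ℕ} {q : k} [NeZero n] [hq : Fact (IsPrimitiveRoot q n)]

/-! ### Segments of a weighted string -/

/-- A stretch of a weighted string bounded by vanishing weights is a direct summand. -/
theorem string_dominated_weightedString {α : ℕ → k} {s l N : ℕ} (hl : l + 1 ≤ n) (hN : N ≤ n)
    (hsl : s + l + 1 ≤ N) (h0 : s = 0 ∨ α s = 0) (h1 : s + l + 1 = N ∨ α (s + l + 1) = 0)
    (hα : ∀ i, s < i → i < s + l + 1 → α i ≠ 0) :
    Dominated (Taft k n q)ᵐᵒᵖ (string q s hl).carrier (weightedString q 0 hN α).carrier := by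
  obtain ⟨f, hf⟩ := exists_hom_of_basisVec (q := q) (w := s) (hN := hl) (α := fun _ => (1 : k))
    (fun j => (∏ i ∈ Finset.Ico s (s + j), α (i + 1))⁻¹ • basisVec q 0 hN α (s + j))
    (fun j hj => by rw [RightMod.smul_op_smul, basisVec_smul_G, smul_comm, zero_add])
    (by
      rw [RightMod.smul_op_smul]
      rcases Nat.eq_zero_or_pos s with h | h
      · subst h; rw [basisVec_zero_smul_X, smul_zero]
      · obtain ⟨t, rfl⟩ : ∃ t, s = t + 1 := ⟨s - 1, by omega⟩
        rw [show t + 1 + 0 = t + 1 from rfl, basisVec_succ_smul_X (by omega),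
          h0.resolve_left (by omega), zero_smul, smul_zero])
    (fun j hj => by
      have := hα (s + j + 1) (by omega) (by omega)
      rw [RightMod.smul_op_smul, ← add_assoc, basisVec_succ_smul_X (by omega),
        Finset.prod_Ico_succ_top (by omega), smul_smul, one_smul, mul_inv, mul_assoc,
        inv_mul_cancel₀ this, mul_one])
  obtain ⟨g, hg⟩ := exists_hom_of_basisVec (q := q) (w := 0) (hN := hN) (α := α)
    (fun j => if s ≤ j then
      (∏ i ∈ Finset.Ico s j, α (i + 1)) • basisVec q s hl (fun _ => 1) (j - s) else 0)
    (fun j hj => by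
      split_ifs with h
      · rw [RightMod.smul_op_smul, basisVec_smul_G, smul_comm, show s + (j - s) = 0 + j by omega]
      · rw [smul_zero, smul_zero])
    (by
      split_ifs with h
      · rw [RightMod.smul_op_smul, show 0 - s = 0 by omega, basisVec_zero_smul_X, smul_zero]
      · rw [smul_zero])
    (fun j hj => by
      rcases lt_trichotomy (j + 1) s with h | h | h
      · rw [if_neg (by omega), if_neg (by omega), smul_zero, smul_zero]
      · rw [if_pos (by omega), if_neg (by omega), smul_zero, RightMod.smul_op_smul,
          show j + 1 - s = 0 by omega, basisVec_zero_smul_X, smul_zero]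
      · rw [if_pos (by omega), if_pos (by omega), RightMod.smul_op_smul,
          show j + 1 - s = (j - s) + 1 by omega]
        rcases Nat.lt_or_ge (j - s + 1) (l + 1) with h' | h'
        · rw [basisVec_succ_smul_X h', one_smul, Finset.prod_Ico_succ_top (by omega), smul_smul,
            mul_comm]
        · rw [basisVec_of_le h', smul_zero, smul_zero]
          rcases Nat.eq_or_lt_of_le h' with h'' | h''
          · rw [show j + 1 = s + l + 1 by omega, h1.resolve_left (by omega), zero_smul]
          · rw [basisVec_of_le (by omega), smul_zero, smul_zero])
  refine string_dominated_of_comp hl f g ?_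
  rw [hf 0 (by omega), LinearMap.map_smul_of_tower, add_zero, hg s (by omega), if_pos le_rfl]
  simp [coord_basisVec]

end Taft

/-! ### The summands of the induced module -/

namespace TaftDouble

open Taft (coordFn coordFn_ext coordFn_ofCoords coordFn_of_le coordFn_scaleOp coordFn_lowerOp ofCoords
  scaleOp lowerOp scaleOp_pow lowerOp_pow lowerOp_scaleOp weightedString)

variable {k : Type u} [Field k] {n : ℕ} {q : k}

/-- The weights `α_j = (1 + q + ⋯ + q ^ (j - 1)) (1 - q ^ (j + s))` of the action of `a`; they are
forced by `da - q ad = 1 - bc`. The first factor vanishes for no `0 < j < n`, the second one only for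
`n ∣ j + s`, where the string breaks into two. -/
def lowerWeight (q : k) (s j : ℕ) : k := (∑ i ∈ Finset.range j, q ^ i) * (1 - q ^ (j + s))

theorem lowerWeight_zero (s : ℕ) : lowerWeight q s 0 = 0 := by simp [lowerWeight]

theorem lowerWeight_succ (s j : ℕ) :
    lowerWeight q s (j + 1) = q * lowerWeight q s j + (1 - q ^ j * q ^ (s + 1 + j)) := by
  have h := geom_sum_mul q j
  rw [lowerWeight, lowerWeight, Finset.sum_range_succ]
  linear_combination -h

theorem lowerWeight_ne_zero (hq : IsPrimitiveRoot q n) {s j : ℕ} (h0 : 0 < j) (hj : j < n)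
    (h : ¬ n ∣ j + s) : lowerWeight q s j ≠ 0 := by
  refine mul_ne_zero (fun h' => ?_) (sub_ne_zero.mpr fun h' => h (hq.dvd_of_pow_eq_one _ h'.symm))
  have := geom_sum_mul q j
  rw [h', zero_mul] at this
  exact hq.pow_ne_one_of_pos_of_lt h0.ne' hj (sub_eq_zero.mp this.symm)

theorem lowerWeight_eq_zero (hq : IsPrimitiveRoot q n) {s j : ℕ} (h : n ∣ j + s) :
    lowerWeight q s j = 0 := by
  rw [lowerWeight, (hq.pow_eq_one_iff_dvd _).mpr h, sub_self, mul_zero]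

/-- The shift `κ_j ↦ κ_{j+1}` of `k ^ N`. -/
def raiseOp (N : ℕ) : (Fin N → k) →ₗ[k] (Fin N → k) :=
  ofCoords fun j => match j with
    | 0 => 0
    | j + 1 => coordFn j

theorem coordFn_raiseOp_zero {N : ℕ} (v : Fin N → k) : coordFn 0 (raiseOp N v) = 0 := by
  rcases Nat.eq_zero_or_pos N with h | h
  · exact coordFn_of_le h.le _
  · rw [raiseOp, coordFn_ofCoords _ h]; rfl

theorem coordFn_raiseOp_succ {N j : ℕ} (h : j + 1 < N) (v : Fin N → k) :
    coordFn (j + 1) (raiseOp N v) = coordFn j v := by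
  rw [raiseOp, coordFn_ofCoords _ h]

theorem raiseOp_pow {N : ℕ} (hN : N ≤ n) : raiseOp (k := k) N ^ n = 0 := by
  have h : ∀ m j (v : Fin N → k), j < m → coordFn j ((raiseOp N ^ m) v) = 0 := by
    intro m
    induction m with
    | zero => intro j v hj; omega
    | succ m ih =>
      intro j v hj
      rw [pow_succ', Module.End.mul_apply]
      rcases j with _ | j
      · exact coordFn_raiseOp_zero _
      · rcases Nat.lt_or_ge (j + 1) N with h | h
        · rw [coordFn_raiseOp_succ h, ih _ _ (by omega)]
        · exact coordFn_of_le h _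
  exact LinearMap.ext fun v => coordFn_ext fun j hj => (h n j v (by omega)).trans (map_zero _).symm

theorem scaleOp_raiseOp {N : ℕ} (w : ℕ) :
    scaleOp N q w * raiseOp N = q • (raiseOp N * scaleOp N q w) := by
  refine LinearMap.ext fun v => coordFn_ext fun j hj => ?_
  rw [Module.End.mul_apply, coordFn_scaleOp, LinearMap.smul_apply, map_smul, Module.End.mul_apply]
  rcases j with _ | j
  · rw [coordFn_raiseOp_zero, coordFn_raiseOp_zero, mul_zero, smul_zero]
  · rw [coordFn_raiseOp_succ hj, coordFn_raiseOp_succ hj, coordFn_scaleOp, smul_eq_mul]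
    ring

variable [NeZero n] [hq : Fact (IsPrimitiveRoot q n)]

theorem lowerOp_raiseOp (hn : 2 ≤ n) (s : ℕ) :
    lowerOp n (lowerWeight q s) * raiseOp n - q • (raiseOp n * lowerOp n (lowerWeight q s)) =
      1 - scaleOp n q (s + 1) * scaleOp n q 0 := by
  refine LinearMap.ext fun v => coordFn_ext fun j hj => ?_
  simp only [LinearMap.sub_apply, map_sub, Module.End.mul_apply, LinearMap.smul_apply, map_smul,
    coordFn_lowerOp, coordFn_scaleOp, Module.End.one_apply, smul_eq_mul]
  have h1 : lowerWeight q s (j + 1) * coordFn (j + 1) (raiseOp n v) =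
      lowerWeight q s (j + 1) * coordFn j v := by
    rcases Nat.lt_or_ge (j + 1) n with h | h
    · rw [coordFn_raiseOp_succ h]
    · have hj : j + 1 = n := by omega
      rw [hj, lowerWeight, hq.out.geom_sum_eq_zero hn, zero_mul, zero_mul, zero_mul]
  have h2 : coordFn j (raiseOp n (lowerOp n (lowerWeight q s) v)) =
      lowerWeight q s j * coordFn j v := by
    rcases j with _ | j
    · rw [coordFn_raiseOp_zero, lowerWeight_zero, zero_mul]
    · rw [coordFn_raiseOp_succ hj, coordFn_lowerOp]
  rw [h1, h2, lowerWeight_succ, zero_add]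
  ring

theorem relations_ops (hn : 2 ≤ n) (s : ℕ) : Relations n q
    (op (lowerOp n (lowerWeight q s))) (op (scaleOp n q 0)) (op (scaleOp n q (s + 1)))
    (op (raiseOp n)) where
  a_pow := by rw [← MulOpposite.op_pow, lowerOp_pow le_rfl, MulOpposite.op_zero]
  d_pow := by rw [← MulOpposite.op_pow, raiseOp_pow le_rfl, MulOpposite.op_zero]
  b_pow := by rw [← MulOpposite.op_pow, scaleOp_pow hq.out.pow_eq_one, MulOpposite.op_one]
  c_pow := by rw [← MulOpposite.op_pow, scaleOp_pow hq.out.pow_eq_one, MulOpposite.op_one]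
  b_a := by rw [← MulOpposite.op_mul, ← MulOpposite.op_mul, lowerOp_scaleOp, MulOpposite.op_smul]
  c_a := by rw [← MulOpposite.op_mul, ← MulOpposite.op_mul, lowerOp_scaleOp, MulOpposite.op_smul]
  d_b := by rw [← MulOpposite.op_mul, ← MulOpposite.op_mul, scaleOp_raiseOp, MulOpposite.op_smul]
  d_c := by rw [← MulOpposite.op_mul, ← MulOpposite.op_mul, scaleOp_raiseOp, MulOpposite.op_smul]
  b_c := by
    rw [← MulOpposite.op_mul, ← MulOpposite.op_mul]
    refine congrArg op (LinearMap.ext fun v => coordFn_ext fun j _ => ?_)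
    simp only [Module.End.mul_apply, coordFn_scaleOp]
    ring
  d_a := by
    rw [← MulOpposite.op_mul, ← MulOpposite.op_mul, ← MulOpposite.op_mul, ← MulOpposite.op_smul,
      ← MulOpposite.op_sub, lowerOp_raiseOp hn, MulOpposite.op_sub, MulOpposite.op_one]

variable (q) in
/-- The right module over the double with basis `κ_0, …, κ_{n-1}`, on which `κ_j b = q ^ j κ_j`,
`κ_j c = q ^ (s + 1 + j) κ_j`, `κ_j d = κ_{j+1}` and `κ_j a = α_j κ_{j-1}`. It is the eigenspace
of the induced module `Q` on which left multiplication by `c` is `q ^ (s + 1)`. -/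
noncomputable def doubleString (hn : 2 ≤ n) (s : ℕ) : RightMod k (TaftDouble k n q) :=
  .ofAlgHom (lift (relations_ops hn s))

variable {hn : 2 ≤ n} {s : ℕ}

instance : FiniteDimensional k (doubleString q hn s).carrier :=
  inferInstanceAs (FiniteDimensional k (Fin n → k))

variable (hn s) in
theorem lift_comp_incl : (lift (relations_ops (q := q) hn s)).comp (incl n q) =
    Taft.lift (op (scaleOp n q 0)) (op (lowerOp n (lowerWeight q s))) (relations_ops hn s).b_pow
      (relations_ops hn s).a_pow (relations_ops hn s).b_a :=
  Taft.algHom_ext (by rw [AlgHom.comp_apply, incl_G, lift_b, Taft.lift_G])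
    (by rw [AlgHom.comp_apply, incl_X, lift_a, Taft.lift_X])

variable (q hn s) in
/-- The underlying module over the Taft algebra is a weighted string. -/
noncomputable def doubleStringEquiv :
    ((doubleString q hn s).restrict (incl n q)).carrier ≃ₗ[(Taft k n q)ᵐᵒᵖ]
      (weightedString q 0 (le_refl n) (lowerWeight q s)).carrier where
  toFun v := v
  map_add' _ _ := rfl
  map_smul' r v := congrArg (fun e => (MulOpposite.unop e : Module.End k (Fin n → k)) v)
    (DFunLike.congr_fun (lift_comp_incl hn s) (MulOpposite.unop r))
  invFun v := v
  left_inv _ := rfl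
  right_inv _ := rfl

variable (q hn s) in
/-- The basis vector `κ_j`, and `0` for `j ≥ n`. -/
noncomputable def kappa (j : ℕ) : (doubleString q hn s).carrier :=
  (doubleStringEquiv q hn s).symm (Taft.basisVec q 0 (le_refl n) _ j)

theorem doubleString_hom_ext {P : Type u} [AddCommGroup P] [Module k P]
    {f g : (doubleString q hn s).carrier →ₗ[k] P}
    (h : ∀ j < n, f (kappa q hn s j) = g (kappa q hn s j)) : f = g :=
  Taft.weightedString_hom_ext (q := q) (w := 0) (hN := le_refl n) (α := lowerWeight q s) h

theorem kappa_smul_b (j : ℕ) : kappa q hn s j <• b n q = q ^ j • kappa q hn s j := by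
  have h := Taft.basisVec_smul_G (q := q) (w := 0) (hN := le_refl n) (α := lowerWeight q s) j
  rw [zero_add] at h
  rw [← incl_G]
  exact ((doubleStringEquiv q hn s).symm.map_smul (op (Taft.G n q)) _).symm.trans
    (congrArg (doubleStringEquiv q hn s).symm h)

theorem kappa_zero_smul_a : kappa q hn s 0 <• a n q = 0 := by
  rw [← incl_X]
  exact ((doubleStringEquiv q hn s).symm.map_smul (op (Taft.X n q)) _).symm.trans
    (congrArg (doubleStringEquiv q hn s).symm Taft.basisVec_zero_smul_X)

theorem kappa_succ_smul_a {j : ℕ} (hj : j + 1 < n) :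
    kappa q hn s (j + 1) <• a n q = lowerWeight q s (j + 1) • kappa q hn s j := by
  rw [← incl_X]
  exact ((doubleStringEquiv q hn s).symm.map_smul (op (Taft.X n q)) _).symm.trans
    (congrArg (doubleStringEquiv q hn s).symm (Taft.basisVec_succ_smul_X hj))

theorem coordFn_kappa (i j : ℕ) :
    coordFn (N := n) i (kappa q hn s j) = if i = j ∧ i < n then (1 : k) else 0 :=
  Taft.coord_basisVec (q := q) (w := 0) (hN := le_refl n) (α := lowerWeight q s) i j

theorem kappa_smul_c (j : ℕ) : kappa q hn s j <• c n q = q ^ (s + 1 + j) • kappa q hn s j := by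
  have h : kappa q hn s j <• c n q = scaleOp n q (s + 1) (kappa q hn s j) :=
    (RightMod.ofAlgHom_smul _ _ _).trans (by rw [lift_c]; rfl)
  refine h.trans (coordFn_ext fun i hi => (coordFn_scaleOp _ _ _).trans <|
    Eq.trans ?_ ((coordFn (N := n) i).map_smul (q ^ (s + 1 + j)) (kappa q hn s j)).symm)
  rw [coordFn_kappa, smul_eq_mul]
  split_ifs with h
  · rw [h.1]
  · rw [mul_zero, mul_zero]

theorem kappa_smul_d (j : ℕ) : kappa q hn s j <• d n q = kappa q hn s (j + 1) := by
  have h : kappa q hn s j <• d n q = raiseOp n (kappa q hn s j) :=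
    (RightMod.ofAlgHom_smul _ _ _).trans (by rw [lift_d]; rfl)
  refine h.trans (coordFn_ext fun i hi => ?_)
  rcases i with _ | i
  · refine (coordFn_raiseOp_zero _).trans (Eq.symm ?_)
    rw [coordFn_kappa, if_neg (by omega)]
  · refine (coordFn_raiseOp_succ hi _).trans ?_
    rw [coordFn_kappa, coordFn_kappa]
    exact if_congr (by omega) rfl rfl

theorem kappa_of_le {j : ℕ} (h : n ≤ j) : kappa q hn s j = 0 :=
  Taft.basisVec_of_le (q := q) (w := 0) (hN := le_refl n) (α := lowerWeight q s) h

theorem kappa_zero_smul_d_pow (j : ℕ) : kappa q hn s 0 <• d n q ^ j = kappa q hn s j := by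
  induction j with
  | zero => rw [pow_zero, MulOpposite.op_one, one_smul]
  | succ j ih => rw [pow_succ, RightMod.op_mul_smul, ih, kappa_smul_d]

/-- `doubleString` is the universal module generated by a vector killed by `a`, fixed by `b`, and
on which `c` is `q ^ (s + 1)`. -/
theorem exists_hom_of_kappa_zero {P : Type u} [AddCommGroup P] [Module k P]
    [Module (TaftDouble k n q)ᵐᵒᵖ P] [IsScalarTower k (TaftDouble k n q)ᵐᵒᵖ P] (hn : 2 ≤ n) (s : ℕ)
    {v : P} (ha : v <• a n q = 0) (hb : v <• b n q = v) (hc : v <• c n q = q ^ (s + 1) • v) :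
    ∃ f : (doubleString q hn s).carrier →ₗ[(TaftDouble k n q)ᵐᵒᵖ] P, f (kappa q hn s 0) = v := by
  obtain ⟨F, hF⟩ : ∃ F : (doubleString q hn s).carrier →ₗ[k] P,
      ∀ j, F (kappa q hn s j) = v <• d n q ^ j := by
    refine ⟨Taft.weightedStringLift q 0 (le_refl n) (lowerWeight q s) fun j => v <• d n q ^ j,
      fun j => ?_⟩
    rcases Nat.lt_or_ge j n with h | h
    · exact Taft.weightedStringLift_basisVec _ h
    · obtain ⟨e, rfl⟩ := Nat.exists_eq_add_of_le h
      rw [kappa_of_le h, pow_add, d_pow, zero_mul, MulOpposite.op_zero, zero_smul]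
      exact (Taft.weightedStringLift q 0 (le_refl n) (lowerWeight q s) fun j => v <• d n q ^ j).map_zero
  have hvb : ∀ j, v <• d n q ^ j <• b n q = q ^ j • (v <• d n q ^ j) := fun j => by
    induction j with
    | zero => simpa using hb
    | succ j ih =>
      rw [pow_succ, RightMod.op_mul_smul, ← RightMod.op_mul_smul _ (d n q), d_b, MulOpposite.op_smul,
        smul_assoc, RightMod.op_mul_smul, ih, RightMod.smul_op_smul, smul_smul, pow_succ']
  have hvc : ∀ j, v <• d n q ^ j <• c n q = q ^ (s + 1 + j) • (v <• d n q ^ j) := fun j => by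
    induction j with
    | zero => simpa using hc
    | succ j ih =>
      rw [pow_succ, RightMod.op_mul_smul, ← RightMod.op_mul_smul _ (d n q), d_c, MulOpposite.op_smul,
        smul_assoc, RightMod.op_mul_smul, ih, RightMod.smul_op_smul, smul_smul, ← pow_succ',
        add_assoc (s + 1)]
  have hva : ∀ j, v <• d n q ^ (j + 1) <• a n q = lowerWeight q s (j + 1) • (v <• d n q ^ j) ∧
      v <• d n q ^ j <• a n q <• d n q = lowerWeight q s j • (v <• d n q ^ j) := fun j => by
    have step : ∀ j, v <• d n q ^ j <• a n q <• d n q = lowerWeight q s j • (v <• d n q ^ j) →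
        v <• d n q ^ (j + 1) <• a n q = lowerWeight q s (j + 1) • (v <• d n q ^ j) := fun j h => by
      rw [pow_succ, RightMod.op_mul_smul, ← RightMod.op_mul_smul _ (d n q), d_a, MulOpposite.op_add,
        add_smul, MulOpposite.op_smul, smul_assoc, RightMod.op_mul_smul, h, MulOpposite.op_sub,
        sub_smul, RightMod.op_mul_smul, hvb, RightMod.smul_op_smul, hvc, MulOpposite.op_one,
        one_smul, lowerWeight_succ, add_smul, sub_smul, one_smul, smul_smul, smul_smul]
    have second : v <• d n q ^ j <• a n q <• d n q = lowerWeight q s j • (v <• d n q ^ j) := by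
      induction j with
      | zero => simp [ha, lowerWeight_zero]
      | succ j ih =>
        rw [step j ih, RightMod.smul_op_smul, ← RightMod.op_mul_smul, ← pow_succ]
    exact ⟨step j second, second⟩
  have hcomm : ∀ x : TaftDouble k n q, (∀ j < n, F (kappa q hn s j <• x) = F (kappa q hn s j) <• x) →
      ∀ w, F (w <• x) = F w <• x := fun x hx w => by
    have h : F ∘ₗ RightMod.actBy x = RightMod.actBy x ∘ₗ F := doubleString_hom_ext hx
    exact LinearMap.congr_fun h w
  refine ⟨{ F with map_smul' := fun x w => ?_ }, (hF 0).trans (by simp)⟩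
  obtain ⟨x, rfl⟩ := MulOpposite.op_surjective x
  refine map_smul_of_generators (n := n) (q := q) F.toAddMonoidHom F.map_smul
    (hcomm _ ?_) (hcomm _ ?_) (hcomm _ ?_)
    (hcomm _ ?_) x w
  all_goals intro j hj
  · rcases j with _ | j
    · rw [kappa_zero_smul_a, map_zero, hF]
      simp [ha]
    · rw [kappa_succ_smul_a hj, map_smul, hF, hF, (hva j).1]
  · rw [kappa_smul_b, map_smul, hF, hvb]
  · rw [kappa_smul_c, map_smul, hF, hvc]
  · rw [kappa_smul_d, hF, hF, pow_succ, RightMod.op_mul_smul]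

theorem doubleString_end_ext {f g : (doubleString q hn s).carrier →ₗ[(TaftDouble k n q)ᵐᵒᵖ]
    (doubleString q hn s).carrier} (h : f (kappa q hn s 0) = g (kappa q hn s 0)) : f = g := by
  have : f.restrictScalars k = g.restrictScalars k := doubleString_hom_ext fun j _ => by
    change f _ = g _
    rw [← kappa_zero_smul_d_pow, map_smul, map_smul, h]
  exact LinearMap.ext fun v => LinearMap.congr_fun this v

end TaftDouble

theorem RightMod.dominated_restrict {k R H : Type u} [Field k] [Ring R] [Algebra k R] [Ring H]
    [Algebra k H] (i : R →ₐ[k] H) {V W : RightMod k H} (h : Dominated Hᵐᵒᵖ V.carrier W.carrier) :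
    Dominated Rᵐᵒᵖ (V.restrict i).carrier (W.restrict i).carrier := by
  obtain ⟨ι, _, f, g, hfg⟩ := h
  exact ⟨ι, inferInstance, fun j => restrictMap i (f j), fun j => restrictMap i (g j), hfg⟩

namespace TaftDouble

variable {k : Type u} [Field k] {n : ℕ} {q : k} [NeZero n] [hq : Fact (IsPrimitiveRoot q n)]

/-! ### The induced module `Q` and its decomposition -/

variable (n q) in
/-- The module `Q`, with its action of the whole double. It is the module induced from the trivial
module of the Taft algebra. -/
noncomputable abbrev inducedModule : RightMod k (TaftDouble k n q) := quotientModule (incl n q)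

/-- The class of an element of the double in `Q`. -/
noncomputable def toInduced (x : TaftDouble k n q) : (inducedModule n q).carrier :=
  Submodule.Quotient.mk x

theorem toInduced_smul (x y : TaftDouble k n q) : toInduced x <• y = toInduced (x * y) := rfl

theorem smul_toInduced (r : k) (x : TaftDouble k n q) :
    r • toInduced x = toInduced (r • x) := rfl

theorem toInduced_surjective : Function.Surjective (toInduced (n := n) (q := q)) :=
  Submodule.Quotient.mk_surjective _

theorem toInduced_incl_mul (r : Taft k n q) (x : TaftDouble k n q) :
    toInduced (incl n q r * x) = Coalgebra.counit (R := k) r • toInduced x := by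
  have h : incl n q (r - algebraMap k _ (Coalgebra.counit (R := k) r)) ∈
      augmentationIdeal (incl n q) :=
    Submodule.subset_span ⟨_, by
      change Coalgebra.counit (R := k) _ = 0
      rw [map_sub, Bialgebra.counit_algebraMap, sub_self], rfl⟩
  refine (Submodule.Quotient.eq _).mpr ?_
  have := Submodule.smul_mem _ (op x) h
  rwa [map_sub, AlgHom.commutes, MulOpposite.smul_eq_mul_unop, MulOpposite.unop_op, sub_mul,
    ← Algebra.smul_def] at this

theorem toInduced_a_mul (x : TaftDouble k n q) : toInduced (a n q * x) = 0 := by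
  rw [← incl_X, toInduced_incl_mul, Taft.counit_X, zero_smul]

theorem toInduced_b_mul (x : TaftDouble k n q) : toInduced (b n q * x) = toInduced x := by
  rw [← incl_G, toInduced_incl_mul, Taft.counit_G, one_smul]

section UniversalProperty

variable {P : Type u} [AddCommGroup P] [Module k P] [Module (TaftDouble k n q)ᵐᵒᵖ P]
  [IsScalarTower k (TaftDouble k n q)ᵐᵒᵖ P]

/-- A vector killed by `a` and fixed by `b` spans a copy of the trivial module of the Taft algebra. -/
theorem smul_incl {v : P} (ha : v <• a n q = 0) (hb : v <• b n q = v) (r : Taft k n q) :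
    v <• incl n q r = Coalgebra.counit (R := k) r • v := by
  induction r using Taft.induction with
  | algebraMap c =>
    rw [AlgHom.commutes, RightMod.algebraMap_op_smul, Bialgebra.counit_algebraMap]
  | G => rw [incl_G, hb, Taft.counit_G, one_smul]
  | X => rw [incl_X, ha, Taft.counit_X, zero_smul]
  | mul x y hx hy =>
    rw [map_mul, RightMod.op_mul_smul, hx, RightMod.smul_op_smul, hy, Bialgebra.counit_mul,
      mul_smul]
  | add x y hx hy => rw [map_add, MulOpposite.op_add, add_smul, hx, hy, map_add, add_smul]

/-- `Q` is induced from the trivial module: it is generated by `[1]` subject to the relations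
`[1] a = 0` and `[1] b = [1]`. -/
theorem exists_hom_of_toInduced_one {v : P} (ha : v <• a n q = 0) (hb : v <• b n q = v) :
    ∃ f : (inducedModule n q).carrier →ₗ[(TaftDouble k n q)ᵐᵒᵖ] P, f (toInduced 1) = v := by
  let F : TaftDouble k n q →ₗ[(TaftDouble k n q)ᵐᵒᵖ] P :=
    { toFun := fun x => v <• x
      map_add' := fun x y => by rw [MulOpposite.op_add, add_smul]
      map_smul' := fun x y => by
        rw [MulOpposite.smul_eq_mul_unop, RightMod.op_mul_smul]; rfl }
  refine ⟨Submodule.liftQ _ F (Submodule.span_le.mpr ?_), ?_⟩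
  · rintro _ ⟨r, hr, rfl⟩
    change v <• incl n q r = 0
    rw [smul_incl ha hb, hr, zero_smul]
  · refine (Submodule.liftQ_apply _ F 1).trans ?_
    change v <• (1 : TaftDouble k n q) = v
    rw [MulOpposite.op_one, one_smul]

theorem inducedModule_hom_ext
    {f g : (inducedModule n q).carrier →ₗ[(TaftDouble k n q)ᵐᵒᵖ] P}
    (h : f (toInduced 1) = g (toInduced 1)) : f = g := by
  refine LinearMap.ext fun v => ?_
  obtain ⟨x, rfl⟩ := toInduced_surjective v
  rw [← one_mul x, ← toInduced_smul, map_smul, map_smul, h]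

end UniversalProperty

theorem weightSum_c_mul_a (w : ℕ) :
    toInduced (weightSum n q (c n q) w * a n q) = 0 := by
  have h : ∀ m, c n q ^ m * a n q = q ^ m • (a n q * c n q ^ m) := fun m => by
    induction m with
    | zero => simp
    | succ m ih =>
      rw [pow_succ', mul_assoc, ih, mul_smul_comm, ← mul_assoc, c_a, smul_mul_assoc, smul_smul,
        mul_assoc, ← pow_succ]
  have h' : weightSum n q (c n q) w * a n q =
      a n q * ∑ m ∈ Finset.range n, (((q⁻¹) ^ (w * m)) * q ^ m) • c n q ^ m := by
    rw [weightSum, Finset.sum_mul, Finset.mul_sum]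
    exact Finset.sum_congr rfl fun m _ => by
      rw [smul_mul_assoc, h, smul_smul, mul_smul_comm]
  rw [h', toInduced_a_mul]

theorem weightSum_c_mul_b (w : ℕ) :
    toInduced (weightSum n q (c n q) w * b n q) = toInduced (weightSum n q (c n q) w) := by
  have h : weightSum n q (c n q) w * b n q = b n q * weightSum n q (c n q) w := by
    rw [weightSum, Finset.sum_mul, Finset.mul_sum]
    exact Finset.sum_congr rfl fun m _ => by
      rw [smul_mul_assoc, mul_smul_comm, ((show Commute (b n q) (c n q) from b_c).pow_right m).eq]
  rw [h, toInduced_b_mul]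

theorem natCast_ne_zero (hq : IsPrimitiveRoot q n) : (n : k) ≠ 0 := hq.neZero'.out

/-- `Q` is the direct sum of the modules `doubleString`, over the eigenvalues of the left
multiplication by `c`. -/
theorem exists_decomposition (hn : 2 ≤ n) :
    ∃ (f : ∀ s, (doubleString q hn s).carrier →ₗ[(TaftDouble k n q)ᵐᵒᵖ] (inducedModule n q).carrier)
      (g : ∀ s, (inducedModule n q).carrier →ₗ[(TaftDouble k n q)ᵐᵒᵖ] (doubleString q hn s).carrier),
      (∀ s v, g s (f s v) = (n : k) • v) ∧
        ∀ v, ∑ s ∈ Finset.range n, f s (g s v) = (n : k) • v := by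
  have hf := fun s => exists_hom_of_kappa_zero hn s
    (v := toInduced (weightSum n q (c n q) (s + 1)))
    (by rw [toInduced_smul, weightSum_c_mul_a]) (by rw [toInduced_smul, weightSum_c_mul_b])
    (by rw [toInduced_smul, weightSum_mul, mul_weightSum hq.out c_pow, smul_toInduced])
  choose f hf using hf
  have hg := fun s => exists_hom_of_toInduced_one (v := kappa q hn s 0) kappa_zero_smul_a
    (by rw [kappa_smul_b, pow_zero, one_smul])
  choose g hg using hg
  refine ⟨f, g, fun s => ?_, ?_⟩
  · have h : g s ∘ₗ f s = (n : k) • LinearMap.id := doubleString_end_ext (by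
      have h1 : toInduced (weightSum n q (c n q) (s + 1)) =
          toInduced 1 <• weightSum n q (c n q) (s + 1) := by rw [toInduced_smul, one_mul]
      have h2 : op (weightSum n q (c n q) (s + 1)) = weightSum n q (op (c n q)) (s + 1) := by
        simp [weightSum]
      rw [LinearMap.comp_apply, hf, h1, map_smul, hg, h2]
      exact weightSum_smul_of_smul_eq hq.out (by rw [kappa_smul_c, add_zero]))
    exact fun v => LinearMap.congr_fun h v
  · have h : ∑ s ∈ Finset.range n, f s ∘ₗ g s = (n : k) • LinearMap.id :=
      inducedModule_hom_ext (by
        have h1 : weightSum n q (c n q) n = weightSum n q (c n q) 0 := by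
          simp only [weightSum, pow_mul, inv_pow, hq.out.pow_eq_one]
          simp
        have h2 := Finset.sum_range_succ' (fun w => weightSum n q (c n q) w) n
        rw [Finset.sum_range_succ, h1, add_left_inj, sum_weightSum hq.out] at h2
        rw [LinearMap.sum_apply, LinearMap.smul_apply, LinearMap.id_apply, smul_toInduced, h2]
        simp only [LinearMap.comp_apply, hg, hf]
        exact (map_sum (Submodule.mkQ (augmentationIdeal (incl n q))) _ _).symm)
    intro v
    simpa using LinearMap.congr_fun h v

theorem doubleString_dominated (hn : 2 ≤ n) (s : ℕ) :
    Dominated (TaftDouble k n q)ᵐᵒᵖ (doubleString q hn s).carrier (inducedModule n q).carrier := by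
  obtain ⟨f, g, h, -⟩ := exists_decomposition (q := q) hn
  refine .of_comp (f s) ((n : k)⁻¹ • g s) fun v => ?_
  rw [LinearMap.smul_apply, h, smul_smul, inv_mul_cancel₀ (natCast_ne_zero hq.out), one_smul]

theorem finiteDimensional_inducedModule (hn : 2 ≤ n) :
    FiniteDimensional k (inducedModule n q).carrier := by
  obtain ⟨f, g, -, h⟩ := exists_decomposition (q := q) hn
  refine FiniteDimensional.of_injective
    (LinearMap.pi fun s : Fin n => (g s).restrictScalars k)
    ((injective_iff_map_eq_zero _).mpr fun v hv => ?_)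
  have h0 : (n : k) • v = 0 := by
    rw [← h, Finset.sum_eq_zero fun s hs => ?_]
    have : g s v = 0 := congrFun hv ⟨s, Finset.mem_range.mp hs⟩
    rw [this, map_zero]
  exact (smul_eq_zero.mp h0).resolve_left (natCast_ne_zero hq.out)

end TaftDouble

/-! ### Modules on which the fixed vectors of `G` are killed by `X` -/

namespace Taft

variable {k : Type u} [Field k] {n : ℕ} {q : k} [NeZero n] [hq : Fact (IsPrimitiveRoot q n)]
  {V W : RightMod k (Taft k n q)}

/-- The property that the fixed vectors of `G` are killed by `X` passes to direct summands of powers.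
It separates `Q` from `Q ⊗ Q`. -/
theorem killed_of_dominated {M N : Type u} [AddCommGroup M] [Module (Taft k n q)ᵐᵒᵖ M]
    [AddCommGroup N] [Module (Taft k n q)ᵐᵒᵖ N] (h : Dominated (Taft k n q)ᵐᵒᵖ M N)
    (hN : ∀ v : N, v <• G n q = v → v <• X n q = 0) (v : M) (hv : v <• G n q = v) :
    v <• X n q = 0 := by
  obtain ⟨ι, _, f, g, hfg⟩ := h
  rw [← hfg v, Finset.smul_sum]
  refine Finset.sum_eq_zero fun i _ => ?_
  rw [← map_smul, hN _ (by rw [← map_smul, hv]), map_zero]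

/-- The weights `1, q, …, q ^ (N - 1)` are distinct, so only multiples of the socle `κ_0` are fixed by
`G`. -/
theorem killed_weightedString {α : ℕ → k} {N : ℕ} {hN : N ≤ n}
    (v : (weightedString q 0 hN α).carrier) (hv : v <• G n q = v) : v <• X n q = 0 := by
  refine coord_ext fun j hj => ?_
  rw [coord_smul_X, map_zero]
  rcases Nat.lt_or_ge (j + 1) N with h | h
  · have h1 := congrArg (coord q 0 hN α (j + 1)) hv
    rw [coord_smul_G, zero_add] at h1
    have h2 : q ^ (j + 1) ≠ 1 := hq.out.pow_ne_one_of_pos_of_lt (by omega) (by omega)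
    have h3 : (q ^ (j + 1) - 1) * coord q 0 hN α (j + 1) v = 0 := by linear_combination h1
    rw [(mul_eq_zero.mp h3).resolve_left (sub_ne_zero.mpr h2), mul_zero]
  · rw [coord_of_le h, mul_zero]

theorem killed_trivial (v : (RightMod.trivial k (Taft k n q)).carrier) : v <• X n q = 0 := by
  rw [RightMod.trivial_smul, counit_X, zero_smul]

theorem basisVec_smul_X_ne_zero {w j N : ℕ} {hN : N ≤ n} (hj : j + 1 < N) :
    basisVec q w hN (fun _ => 1) (j + 1) <• X n q ≠ 0 := by
  rw [basisVec_succ_smul_X hj, one_smul]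
  intro h
  have := congrArg (coord q w hN (fun _ => (1 : k)) j) h
  rw [coord_basisVec, if_pos ⟨rfl, by omega⟩, map_zero] at this
  exact one_ne_zero this

/-! ### The unit object -/

theorem trivial_dominated_string (h : 1 ≤ n) :
    Dominated (Taft k n q)ᵐᵒᵖ (RightMod.trivial k (Taft k n q)).carrier (string q 0 h).carrier := by
  let T := RightMod.trivial k (Taft k n q)
  let o : T.carrier := (1 : k)
  obtain ⟨g, hg⟩ := exists_hom_of_basisVec (q := q) (w := 0) (hN := h) (α := fun _ => (1 : k))
    (P := T.carrier) (fun _ => o)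
    (fun j hj => by
      obtain rfl : j = 0 := by omega
      rw [RightMod.trivial_smul, counit_G, add_zero, pow_zero])
    (killed_trivial _) (fun j hj => by omega)
  let φ : T.carrier →ₗ[k] (string q 0 h).carrier :=
    LinearMap.toSpanSingleton k _ (basisVec q 0 h _ 0)
  have hφ : ∀ c : T.carrier, φ c = (show k from c) • basisVec q 0 h _ 0 := fun _ => rfl
  refine .of_comp (linearMap φ (fun v => ?_) (fun v => ?_)) g (fun v => ?_)
  · rw [RightMod.trivial_smul, counit_G, one_smul, hφ, RightMod.smul_op_smul, basisVec_smul_G,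
      add_zero, pow_zero, one_smul]
  · rw [killed_trivial, map_zero, hφ, RightMod.smul_op_smul, basisVec_zero_smul_X, smul_zero]
  · change g (φ v) = v
    rw [hφ, LinearMap.map_smul_of_tower, hg 0 (by omega)]
    exact mul_one (show k from v)

theorem dominated_trivial_tensor (V : RightMod k (Taft k n q)) :
    Dominated (Taft k n q)ᵐᵒᵖ V.carrier ((RightMod.trivial k (Taft k n q)).tensor V).carrier ∧
    Dominated (Taft k n q)ᵐᵒᵖ ((RightMod.trivial k (Taft k n q)).tensor V).carrier V.carrier := by
  let T := RightMod.trivial k (Taft k n q)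
  let o : T.carrier := (1 : k)
  have hoG : o <• G n q = o := by
    rw [RightMod.trivial_smul, counit_G, one_smul]
  let f := linearMap (n := n) (q := q) (M := V.carrier) (N := (T.tensor V).carrier) (T.tmul V o)
    (fun v => by rw [RightMod.tmul_smul_of_grouplike comul_G, hoG])
    (fun v => by
      rw [RightMod.tmul_smul_of_primitive comul_X, killed_trivial, map_zero, LinearMap.zero_apply,
        zero_add])
  have hf : ∀ v, f v = T.tmul V o v := fun _ => rfl
  have hs : Function.Surjective f := fun t => by
    induction t using RightMod.tensor_induction with
    | zero => exact ⟨0, map_zero f⟩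
    | tmul c v =>
      refine ⟨(show k from c) • v, ?_⟩
      rw [hf, map_smul, ← LinearMap.smul_apply, ← map_smul]
      exact congrArg (fun x => T.tmul V x v) (mul_one (show k from c))
    | add s t hs ht =>
      obtain ⟨s, rfl⟩ := hs
      obtain ⟨t, rfl⟩ := ht
      exact ⟨s + t, map_add f s t⟩
  have hi : Function.Injective f := by
    refine Function.LeftInverse.injective
      (g := RightMod.tensorLift (V := T) (LinearMap.lsmul k V.carrier)) fun v => ?_
    rw [hf]
    exact (RightMod.tensorLift_tmul _ _ _).trans (one_smul k v)
  let e := LinearEquiv.ofBijective f ⟨hi, hs⟩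
  exact ⟨.of_equiv e, .of_equiv e.symm⟩

end Taft

/-! ### The tensor powers of `Q` -/

namespace TaftDouble

open Taft (string weightedString basisVec)

variable {k : Type u} [Field k] {n : ℕ} {q : k} [NeZero n] [hq : Fact (IsPrimitiveRoot q n)]

theorem weightedString_dominated_Q (hn : 2 ≤ n) (s : ℕ) :
    Dominated (Taft k n q)ᵐᵒᵖ (weightedString q 0 (le_refl n) (lowerWeight q s)).carrier
      (Q n q).carrier :=
  (Dominated.of_equiv (doubleStringEquiv q hn s).symm).trans
    (RightMod.dominated_restrict (incl n q) (doubleString_dominated hn s))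

theorem finiteDimensional_Q (hn : 2 ≤ n) : FiniteDimensional k (Q n q).carrier :=
  finiteDimensional_inducedModule hn

theorem killed_Q (hn : 2 ≤ n) (v : (Q n q).carrier) (hv : v <• Taft.G n q = v) :
    v <• Taft.X n q = 0 := by
  obtain ⟨f, g, -, h⟩ := exists_decomposition (q := q) hn
  have hg : ∀ s, g s (v <• Taft.X n q) = 0 := fun s => by
    let g' : (Q n q).carrier →ₗ[(Taft k n q)ᵐᵒᵖ] _ :=
      (doubleStringEquiv q hn s).toLinearMap ∘ₗ RightMod.restrictMap (incl n q) (g s)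
    have h1 : g' (v <• Taft.X n q) = 0 := by
      rw [map_smul]
      exact Taft.killed_weightedString _ (by rw [← map_smul, hv])
    exact (doubleStringEquiv q hn s).map_eq_zero_iff.mp h1
  have h0 : (n : k) • (v <• Taft.X n q) = 0 := by
    refine (h (v <• Taft.X n q)).symm.trans (Finset.sum_eq_zero fun s _ => ?_)
    rw [hg, map_zero]
  exact (smul_eq_zero.mp h0).resolve_left (natCast_ne_zero hq.out)

/-- `V(0, N)` is the lower stretch of the summand of `Q` whose weights vanish at `N`. -/
theorem string_zero_dominated_Q {N : ℕ} (hn : 2 ≤ n) (h0 : 0 < N) (hl : N ≤ n) :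
    Dominated (Taft k n q)ᵐᵒᵖ (string q 0 hl).carrier (Q n q).carrier := by
  obtain ⟨l, rfl⟩ : ∃ l, N = l + 1 := ⟨N - 1, by omega⟩
  refine (Taft.string_dominated_weightedString (α := lowerWeight q (n - (l + 1))) hl le_rfl
    (by omega) (.inl rfl) (.inr (lowerWeight_eq_zero hq.out ?_)) fun i h0 hi =>
      lowerWeight_ne_zero hq.out h0 (by omega) fun hd => ?_).trans (weightedString_dominated_Q hn _)
  · rw [show 0 + l + 1 + (n - (l + 1)) = n by omega]
  · exact absurd (Nat.le_of_dvd (by omega) hd) (by omega)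

/-- `V(w, n - w)` is the upper stretch of the summand of `Q` whose weights vanish at `w`. -/
theorem string_top_dominated_Q {w N : ℕ} (hn : 2 ≤ n) (hw : 0 < w) (h0 : 0 < N)
    (hwl : w + N = n) (hl : N ≤ n) :
    Dominated (Taft k n q)ᵐᵒᵖ (string q w hl).carrier (Q n q).carrier := by
  obtain ⟨l, rfl⟩ : ∃ l, N = l + 1 := ⟨N - 1, by omega⟩
  refine (Taft.string_dominated_weightedString (α := lowerWeight q (n - w)) hl le_rfl
    (by omega) (.inr (lowerWeight_eq_zero hq.out ?_)) (.inl hwl) fun i h0 hi =>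
      lowerWeight_ne_zero hq.out (by omega) (by omega) fun hd => ?_).trans
        (weightedString_dominated_Q hn _)
  · rw [show w + (n - w) = n by omega]
  · obtain ⟨m, hm⟩ := hd
    have h1 : 1 < m := by by_contra h; have := Nat.mul_le_mul_left n (not_lt.mp h); omega
    have := Nat.mul_le_mul_left n h1
    omega

theorem trivial_dominated_Q (hn : 2 ≤ n) :
    Dominated (Taft k n q)ᵐᵒᵖ (RightMod.trivial k (Taft k n q)).carrier (Q n q).carrier :=
  (Taft.trivial_dominated_string (by omega)).trans (string_zero_dominated_Q hn one_pos (by omega))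

theorem Q_dominated_tensor (hn : 2 ≤ n) :
    Dominated (Taft k n q)ᵐᵒᵖ (Q n q).carrier ((Q n q).tensor (Q n q)).carrier :=
  (Taft.dominated_trivial_tensor _).1.trans
    (RightMod.dominated_tensor (trivial_dominated_Q hn) .refl)

theorem string_dominated_tensor {w l : ℕ} (hn : 2 ≤ n) (hw : w < n) (hl : l + 1 ≤ n) :
    Dominated (Taft k n q)ᵐᵒᵖ (string q w hl).carrier ((Q n q).tensor (Q n q)).carrier := by
  rcases Nat.eq_zero_or_pos w with rfl | hw0
  · exact (string_zero_dominated_Q hn l.succ_pos hl).trans (Q_dominated_tensor hn)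
  · rcases Nat.lt_or_ge (w + l + 1) n with h | h
    · exact (Taft.string_dominated_tensor_of_lt hw0 hl h (by omega) (by omega)).trans
        (RightMod.dominated_tensor (string_zero_dominated_Q hn (by omega) _)
          (string_zero_dominated_Q hn (by omega) _))
    · exact (Taft.string_dominated_tensor_of_le hw hl h (by omega) (by omega)).trans
        (RightMod.dominated_tensor (string_top_dominated_Q hn hw0 (by omega) (by omega) _)
          (string_zero_dominated_Q hn (by omega) _))

/-- Every finite-dimensional module is a direct summand of a power of `Q ⊗ Q`. -/
theorem dominated_Q_tensor_Q (hn : 2 ≤ n) (V : RightMod k (Taft k n q))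
    [FiniteDimensional k V.carrier] :
    Dominated (Taft k n q)ᵐᵒᵖ V.carrier ((Q n q).tensor (Q n q)).carrier :=
  Taft.dominated_of_string fun _ _ hw hl => string_dominated_tensor hn hw hl

/-- `Q ⊗ Q` contains the string `V(1, n)`, whose top is fixed by `G` and not killed by `X`. -/
theorem not_dominated_Q (hn : 2 ≤ n) :
    ¬ Dominated (Taft k n q)ᵐᵒᵖ ((Q n q).tensor (Q n q)).carrier (Q n q).carrier := fun h => by
  obtain ⟨m, rfl⟩ : ∃ m, n = m + 2 := ⟨n - 2, by omega⟩
  refine Taft.basisVec_smul_X_ne_zero (q := q) (n := m + 2) (w := 1) (hN := le_refl _) (j := m)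
    (by omega)
    (Taft.killed_of_dominated ((string_dominated_tensor hn (by omega) _).trans h) (killed_Q hn) _ ?_)
  rw [Taft.basisVec_smul_G, show 1 + (m + 1) = m + 2 by omega, hq.out.pow_eq_one, one_smul]

/-- `X` acts as zero on the trivial module, and not on `V(0, 2)`. -/
theorem not_dominated_trivial (hn : 2 ≤ n) :
    ¬ Dominated (Taft k n q)ᵐᵒᵖ (Q n q).carrier (RightMod.trivial k (Taft k n q)).carrier :=
  fun h => by
    obtain ⟨ι, _, f, g, hfg⟩ := (string_zero_dominated_Q (q := q) hn two_pos hn).trans h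
    refine Taft.basisVec_smul_X_ne_zero (q := q) (w := 0) (hN := hn) (j := 0) (by omega) ?_
    rw [← hfg (basisVec q 0 hn _ (0 + 1)), Finset.smul_sum]
    refine Finset.sum_eq_zero fun i _ => ?_
    rw [← map_smul, Taft.killed_trivial, map_zero]

theorem finiteDimensional_tensorPow (hn : 2 ≤ n) (m : ℕ) :
    FiniteDimensional k ((Q n q).tensorPow m).carrier := by
  have := finiteDimensional_Q (q := q) hn
  induction m with
  | zero => exact inferInstanceAs (FiniteDimensional k (RightMod.trivial k (Taft k n q)).carrier)
  | succ m ih =>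
    exact inferInstanceAs (FiniteDimensional k (((Q n q).tensorPow m).tensor (Q n q)).carrier)

theorem tensorPow_dominated (hn : 2 ≤ n) (m : ℕ) :
    Dominated (Taft k n q)ᵐᵒᵖ ((Q n q).tensorPow m).carrier ((Q n q).tensor (Q n q)).carrier :=
  have := finiteDimensional_tensorPow (q := q) hn m
  dominated_Q_tensor_Q hn _

theorem tensorPow_one_dominated :
    Dominated (Taft k n q)ᵐᵒᵖ ((Q n q).tensorPow 1).carrier (Q n q).carrier :=
  (Taft.dominated_trivial_tensor _).2

theorem dominated_tensorPow_one :
    Dominated (Taft k n q)ᵐᵒᵖ (Q n q).carrier ((Q n q).tensorPow 1).carrier :=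
  (Taft.dominated_trivial_tensor _).1

theorem dominated_tensorPow (hn : 2 ≤ n) (m : ℕ) : Dominated (Taft k n q)ᵐᵒᵖ
    ((Q n q).tensor (Q n q)).carrier ((Q n q).tensorPow (m + 2)).carrier := by
  refine RightMod.dominated_tensor ?_ .refl
  induction m with
  | zero => exact dominated_tensorPow_one
  | succ m ih => exact (Q_dominated_tensor hn).trans (RightMod.dominated_tensor ih .refl)

theorem powerSum_dominated (hn : 2 ≤ n) (m : ℕ) : Dominated (Taft k n q)ᵐᵒᵖ
    ((Q n q).powerSum (m + 1)).carrier ((Q n q).tensor (Q n q)).carrier :=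
  Dominated.pi fun _ => tensorPow_dominated hn _

theorem dominated_powerSum (hn : 2 ≤ n) (m : ℕ) : Dominated (Taft k n q)ᵐᵒᵖ
    ((Q n q).tensor (Q n q)).carrier ((Q n q).powerSum (m + 2)).carrier :=
  (dominated_tensorPow hn 0).trans (Dominated.apply
    (M := fun i : Fin (m + 2) => ((Q n q).tensorPow (i + 1)).carrier) 1)

theorem hasDepth_two (hn : 2 ≤ n) : (Q n q).HasDepth 2 := by
  refine ⟨RightMod.similar_iff.mpr ⟨(powerSum_dominated hn _).trans (dominated_powerSum hn _),
    (powerSum_dominated hn _).trans (dominated_powerSum hn _)⟩, fun m hm => ?_⟩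
  obtain ⟨-, h⟩ := RightMod.similar_iff.mp hm
  by_contra! hlt
  interval_cases m
  · exact not_dominated_trivial hn ((dominated_tensorPow_one.trans (Dominated.apply
      (M := fun i : Fin 1 => ((Q n q).tensorPow (i + 1)).carrier) 0)).trans h)
  · refine not_dominated_Q hn (((dominated_powerSum hn 0).trans h).trans (Dominated.pi fun i => ?_))
    obtain rfl : i = 0 := Fin.fin_one_eq_zero i
    exact tensorPow_one_dominated

end TaftDouble

/-! ### The double is finite-dimensional -/

namespace TaftDouble

variable {k : Type u} [Field k] {n : ℕ} {q : k}

/-- The monomials `a ^ i b ^ j c ^ l d ^ m`, which span the double. -/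
noncomputable def monomial (n : ℕ) (q : k) (i j l m : ℕ) : TaftDouble k n q :=
  a n q ^ i * b n q ^ j * c n q ^ l * d n q ^ m

theorem monomial_mul_d (i j l m : ℕ) :
    monomial n q i j l m * d n q = monomial n q i j l (m + 1) := by
  rw [monomial, monomial, pow_succ (d n q), mul_assoc]

theorem pow_mul_of_qcomm {x y : TaftDouble k n q} (h : x * y = q • (y * x)) (i : ℕ) :
    x ^ i * y = q ^ i • (y * x ^ i) := by
  induction i with
  | zero => simp
  | succ i ih =>
    rw [pow_succ', mul_assoc, ih, mul_smul_comm, ← mul_assoc, h, smul_mul_assoc, smul_smul,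
      mul_assoc, ← pow_succ]

theorem monomial_mul_c (i j l m : ℕ) :
    monomial n q i j l m * c n q = q ^ m • monomial n q i j (l + 1) m := by
  rw [monomial, monomial, mul_assoc, pow_mul_of_qcomm d_c, mul_smul_comm, pow_succ (c n q)]
  simp only [mul_assoc]

theorem monomial_mul_b (i j l m : ℕ) :
    monomial n q i j l m * b n q = q ^ m • monomial n q i (j + 1) l m := by
  rw [monomial, monomial, mul_assoc, pow_mul_of_qcomm d_b, mul_smul_comm, pow_succ (b n q),
    ← mul_assoc, mul_assoc _ (c n q ^ l),
    ((show Commute (b n q) (c n q) from b_c).pow_right l).eq.symm]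
  simp only [mul_assoc]

theorem monomial_zero_mul_a (i j l : ℕ) :
    monomial n q i j l 0 * a n q = q ^ (l + j) • monomial n q (i + 1) j l 0 := by
  rw [monomial, monomial, pow_zero, mul_one, mul_one, mul_assoc, pow_mul_of_qcomm c_a,
    mul_smul_comm, mul_assoc, ← mul_assoc (b n q ^ j), pow_mul_of_qcomm b_a, smul_mul_assoc,
    mul_smul_comm, smul_smul, pow_succ (a n q), pow_add]
  simp only [mul_assoc]

theorem monomial_succ_mul_a (i j l m : ℕ) :
    monomial n q i j l (m + 1) * a n q = q • (monomial n q i j l m * a n q * d n q) +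
      (monomial n q i j l m - monomial n q i j l m * b n q * c n q) := by
  rw [← monomial_mul_d, mul_assoc, d_a, mul_add, mul_smul_comm, mul_sub, mul_one, mul_assoc,
    mul_assoc]

variable (n q) in
theorem finiteDimensional [NeZero n] : FiniteDimensional k (TaftDouble k n q) := by
  let W : Submodule k (TaftDouble k n q) := Submodule.span k (Set.range
    fun p : Fin n × Fin n × Fin n × Fin n => monomial n q p.1 p.2.1 p.2.2.1 p.2.2.2)
  have hmem : ∀ i j l m, monomial n q i j l m ∈ W := fun i j l m => by
    rcases Nat.lt_or_ge i n with hi | hi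
    · rcases Nat.lt_or_ge m n with hm | hm
      · have hp : ∀ (x : TaftDouble k n q) (_ : x ^ n = 1) e, x ^ e = x ^ (e % n) := fun x hx e => by
          conv_lhs => rw [← Nat.mod_add_div e n, pow_add, pow_mul, hx, one_pow, mul_one]
        rw [monomial, hp _ b_pow j, hp _ c_pow l]
        exact Submodule.subset_span ⟨⟨⟨i, hi⟩, ⟨_, Nat.mod_lt _ (NeZero.pos n)⟩,
          ⟨_, Nat.mod_lt _ (NeZero.pos n)⟩, ⟨m, hm⟩⟩, rfl⟩
      · obtain ⟨e, rfl⟩ := Nat.exists_eq_add_of_le hm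
        rw [monomial, pow_add, d_pow, zero_mul, mul_zero]
        exact W.zero_mem
    · obtain ⟨e, rfl⟩ := Nat.exists_eq_add_of_le hi
      rw [monomial, pow_add, a_pow, zero_mul, zero_mul, zero_mul, zero_mul]
      exact W.zero_mem
  have hspan : ∀ x, (∀ i j l m, monomial n q i j l m * x ∈ W) → ∀ w ∈ W, w * x ∈ W := by
    intro x hx w hw
    induction hw using Submodule.span_induction with
    | mem w h =>
      obtain ⟨p, rfl⟩ := h
      exact hx _ _ _ _
    | zero => rw [zero_mul]; exact W.zero_mem
    | add y z _ _ hy hz => rw [add_mul]; exact W.add_mem hy hz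
    | smul r y _ hy => rw [smul_mul_assoc]; exact W.smul_mem r hy
  have hb := hspan (b n q) fun i j l m => by
    rw [monomial_mul_b]; exact W.smul_mem _ (hmem _ _ _ _)
  have hc := hspan (c n q) fun i j l m => by
    rw [monomial_mul_c]; exact W.smul_mem _ (hmem _ _ _ _)
  have hd := hspan (d n q) fun i j l m => by
    rw [monomial_mul_d]; exact hmem _ _ _ _
  have ha := hspan (a n q) fun i j l m => by
    induction m with
    | zero => rw [monomial_zero_mul_a]; exact W.smul_mem _ (hmem _ _ _ _)
    | succ m ih =>
      rw [monomial_succ_mul_a]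
      exact W.add_mem (W.smul_mem _ (hd _ ih)) (W.sub_mem (hmem _ _ _ _)
        (hc _ (hb _ (hmem _ _ _ _))))
  have hall : ∀ x w, w ∈ W → w * x ∈ W := fun x => by
    induction x using induction with
    | algebraMap r =>
      intro w hw
      rw [← Algebra.commutes, ← Algebra.smul_def]
      exact W.smul_mem _ hw
    | a => exact ha
    | b => exact hb
    | c => exact hc
    | d => exact hd
    | mul x y hx hy => intro w hw; rw [← mul_assoc]; exact hy _ (hx _ hw)
    | add x y hx hy => intro w hw; rw [mul_add]; exact W.add_mem (hx _ hw) (hy _ hw)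
  have hone : (1 : TaftDouble k n q) ∈ W := by simpa [monomial] using hmem 0 0 0 0
  have htop : W = ⊤ := eq_top_iff.mpr fun x _ => by simpa using hall x 1 hone
  have hfg : W.FG := Submodule.fg_span (Set.finite_range _)
  exact ⟨htop ▸ hfg⟩

end TaftDouble

/-! ### The bimodule `H ⊗ V` attached to a right module `V` -/

namespace RightMod

variable {k H : Type u} [Field k] [Ring H]

/-- The right regular module. -/
def regular (k H : Type u) [Field k] [Ring H] [Algebra k H] : RightMod k H where
  carrier := H

variable [Bialgebra k H] (V W : RightMod k H)

noncomputable instance : Module H ((regular k H).tensor V).carrier :=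
  inferInstanceAs (Module H (H ⊗[k] V.carrier))

/-- The element `x ⊗ v` of `H ⊗ V`. -/
noncomputable abbrev freeTmul (x : H) (v : V.carrier) : ((regular k H).tensor V).carrier :=
  (regular k H).tmul V x v

variable {V W}

theorem smul_freeTmul (y x : H) (v : V.carrier) : y • V.freeTmul x v = V.freeTmul (y * x) v :=
  rfl

theorem free_induction {p : ((regular k H).tensor V).carrier → Prop} (zero : p 0)
    (tmul : ∀ (x : H) (v : V.carrier), p (V.freeTmul x v)) (add : ∀ s t, p s → p t → p (s + t))
    (t) : p t :=
  tensor_induction zero tmul add t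

theorem algebraMap_smul_free (r : k) (t : ((regular k H).tensor V).carrier) :
    algebraMap k H r • t = r • t := by
  induction t using free_induction with
  | zero => rw [smul_zero, smul_zero]
  | add s t hs ht => rw [smul_add, smul_add, hs, ht]
  | tmul x v =>
    rw [smul_freeTmul, ← Algebra.smul_def]
    exact LinearMap.map_smul₂ ((regular k H).tmul V) r (show (regular k H).carrier from x) v

theorem tensorAct₂_freeTmul (x y z : H) (v : V.carrier) :
    tensorAct₂ (regular k H) V (y ⊗ₜ z) (V.freeTmul x v) = V.freeTmul (x * y) (v <• z) :=
  tensorAct₂_tmul (V := regular k H) y z x v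

theorem smul_free_op_smul (y : H) (t : ((regular k H).tensor V).carrier) (h : H) :
    (y • t) <• h = y • (t <• h) := by
  have key : ∀ (s : H ⊗[k] H), tensorAct₂ (regular k H) V s (y • t) =
      y • tensorAct₂ (regular k H) V s t := by
    intro s
    induction s with
    | zero => simp
    | add s s' hs hs' => rw [map_add, LinearMap.add_apply, LinearMap.add_apply, hs, hs', smul_add]
    | tmul x z =>
      induction t using free_induction with
      | zero => simp
      | add t t' ht ht' => rw [smul_add, map_add, map_add, smul_add, ht, ht']
      | tmul u v =>
        rw [smul_freeTmul, tensorAct₂_freeTmul, tensorAct₂_freeTmul, smul_freeTmul, mul_assoc]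
  rw [tensor_smul, tensor_smul, key]

variable (V) in
/-- The `H`-bimodule `H ⊗ V`: `H` acts on the left by multiplication on the first factor and on the
right diagonally. -/
noncomputable def biMod : BiMod H H :=
  letI : SMulCommClass H Hᵐᵒᵖ ((regular k H).tensor V).carrier :=
    ⟨fun y h t => (smul_free_op_smul y t (MulOpposite.unop h)).symm⟩
  { carrier := ((regular k H).tensor V).carrier }

end RightMod

/-! ### Free modules and diagonal actions -/

namespace RightMod

variable {k H : Type u} [Field k] [Ring H]

section Algebra

variable [Algebra k H]

/-- The bilinear map `(v, y) ↦ f v · y` for a linear map `f` into a right module. -/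
noncomputable def orbit {V : Type u} [AddCommGroup V] [Module k V] {P : Type u} [AddCommGroup P]
    [Module k P] [Module Hᵐᵒᵖ P] [IsScalarTower k Hᵐᵒᵖ P] (f : V →ₗ[k] P) :
    V →ₗ[k] (regular k H).carrier →ₗ[k] P :=
  LinearMap.mk₂ k (fun v (y : H) => f v <• y)
    (fun v w y => by rw [map_add, smul_add])
    (fun c v y => by rw [map_smul]; exact smul_op_smul (H := H) c (f v) (id y))
    (fun v y z => by rw [← add_smul]; rfl)
    (fun c v y => by rw [← smul_assoc]; rfl)

end Algebra

variable [Bialgebra k H] {V W : RightMod k H}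

/-- The map `v ⊗ y ↦ (v ⊗ 1) · y`, which identifies `V ⊗ H` with a free right module. -/
noncomputable def rightFree (V : RightMod k H) :
    (V.tensor (regular k H)).carrier →ₗ[k] (V.tensor (regular k H)).carrier :=
  tensorLift (orbit ((V.tmul (regular k H)).flip (1 : H)))

/-- The map `y ⊗ v ↦ (1 ⊗ v) · y`, which identifies `H ⊗ V` with a free right module. -/
noncomputable def leftFree (V : RightMod k H) :
    ((regular k H).tensor V).carrier →ₗ[k] ((regular k H).tensor V).carrier :=
  tensorLift (orbit ((regular k H).tmul V (1 : H))).flip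

theorem rightFree_tmul (v : V.carrier) (y : H) :
    rightFree V (V.tmul (regular k H) v y) = V.tmul (regular k H) v (1 : H) <• y :=
  tensorLift_tmul _ _ _

theorem leftFree_tmul (y : H) (v : V.carrier) :
    leftFree V (V.freeTmul y v) = V.freeTmul 1 v <• y :=
  tensorLift_tmul _ _ _

section Generators

variable {g g' x : H}

theorem tmul_smul_right_of_grouplike (hg : Coalgebra.comul (R := k) g = g ⊗ₜ g) (h : g' * g = 1)
    (v : V.carrier) (w : W.carrier) : V.tmul W v (w <• g) = V.tmul W (v <• g') w <• g := by
  rw [tmul_smul_of_grouplike hg, ← op_mul_smul, h, MulOpposite.op_one, one_smul]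

theorem tmul_smul_left_of_grouplike (hg : Coalgebra.comul (R := k) g = g ⊗ₜ g) (h : g' * g = 1)
    (v : V.carrier) (w : W.carrier) : V.tmul W (v <• g) w = V.tmul W v (w <• g') <• g := by
  rw [tmul_smul_of_grouplike hg, ← op_mul_smul, h, MulOpposite.op_one, one_smul]

theorem tmul_smul_right_of_primitive (hx : Coalgebra.comul (R := k) x = x ⊗ₜ g + 1 ⊗ₜ x)
    (v : V.carrier) (w : W.carrier) :
    V.tmul W v (w <• x) = V.tmul W v w <• x - V.tmul W (v <• x) (w <• g) := by
  rw [tmul_smul_of_primitive hx, add_sub_cancel_left]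

theorem tmul_smul_left_of_primitive (hx : Coalgebra.comul (R := k) x = x ⊗ₜ g + 1 ⊗ₜ x)
    (h : g' * g = 1) (v : V.carrier) (w : W.carrier) :
    V.tmul W (v <• x) w = V.tmul W v (w <• g') <• x - V.tmul W v (w <• g' <• x) := by
  rw [tmul_smul_of_primitive hx, add_sub_cancel_right, ← op_mul_smul w, h, MulOpposite.op_one,
    one_smul]

end Generators

end RightMod

namespace TaftDouble

open RightMod

variable {k : Type u} [Field k] {n : ℕ} {q : k} [NeZero n] [hq : Fact (IsPrimitiveRoot q n)]

variable (n q) in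
/-- The inverse of `b`. -/
noncomputable def bInv : TaftDouble k n q := b n q ^ (n - 1)

variable (n q) in
/-- The inverse of `c`. -/
noncomputable def cInv : TaftDouble k n q := c n q ^ (n - 1)

theorem bInv_mul_b : bInv n q * b n q = 1 := by
  rw [bInv, ← pow_succ, Nat.sub_add_cancel (NeZero.pos n), b_pow]

theorem b_mul_bInv : b n q * bInv n q = 1 := by
  rw [bInv, ← pow_succ', Nat.sub_add_cancel (NeZero.pos n), b_pow]

theorem cInv_mul_c : cInv n q * c n q = 1 := by
  rw [cInv, ← pow_succ, Nat.sub_add_cancel (NeZero.pos n), c_pow]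

section Stable

variable {V W : RightMod k (TaftDouble k n q)} {S : AddSubgroup (V.tensor W).carrier}
  (hS : ∀ (x : TaftDouble k n q), ∀ t ∈ S, t <• x ∈ S)
include hS

/-- The vectors `w` with `V ⊗ w ⊆ S` form a submodule of `W`, for a submodule `S` of `V ⊗ W`. -/
theorem tmul_smul_mem_right (x : TaftDouble k n q) : ∀ {w : W.carrier},
    (∀ v, V.tmul W v w ∈ S) → ∀ v, V.tmul W v (w <• x) ∈ S := by
  have hb : ∀ {w : W.carrier}, (∀ v, V.tmul W v w ∈ S) → ∀ v, V.tmul W v (w <• b n q) ∈ S :=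
    fun hw v => by
      rw [tmul_smul_right_of_grouplike comul_b bInv_mul_b]
      exact hS _ _ (hw _)
  have hc : ∀ {w : W.carrier}, (∀ v, V.tmul W v w ∈ S) → ∀ v, V.tmul W v (w <• c n q) ∈ S :=
    fun hw v => by
      rw [tmul_smul_right_of_grouplike comul_c cInv_mul_c]
      exact hS _ _ (hw _)
  induction x using induction with
  | algebraMap r =>
    intro w hw v
    rw [algebraMap_op_smul, map_smul, ← algebraMap_op_smul (H := TaftDouble k n q)]
    exact hS _ _ (hw _)
  | a =>
    intro w hw v
    rw [tmul_smul_right_of_primitive comul_a]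
    exact S.sub_mem (hS _ _ (hw _)) (hb hw _)
  | b => exact hb
  | c => exact hc
  | d =>
    intro w hw v
    rw [tmul_smul_right_of_primitive comul_d]
    exact S.sub_mem (hS _ _ (hw _)) (hc hw _)
  | mul x y hx hy => intro w hw v; rw [op_mul_smul]; exact hy (hx hw) v
  | add x y hx hy =>
    intro w hw v
    rw [MulOpposite.op_add, add_smul, map_add]
    exact S.add_mem (hx hw v) (hy hw v)

/-- The vectors `v` with `v ⊗ W ⊆ S` form a submodule of `V`, for a submodule `S` of `V ⊗ W`. -/
theorem tmul_smul_mem_left (x : TaftDouble k n q) : ∀ {v : V.carrier},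
    (∀ w, V.tmul W v w ∈ S) → ∀ w, V.tmul W (v <• x) w ∈ S := by
  induction x using induction with
  | algebraMap r =>
    intro v hv w
    rw [algebraMap_op_smul, map_smul, LinearMap.smul_apply,
      ← algebraMap_op_smul (H := TaftDouble k n q)]
    exact hS _ _ (hv _)
  | a =>
    intro v hv w
    rw [tmul_smul_left_of_primitive comul_a bInv_mul_b]
    exact S.sub_mem (hS _ _ (hv _)) (hv _)
  | b =>
    intro v hv w
    rw [tmul_smul_left_of_grouplike comul_b bInv_mul_b]
    exact hS _ _ (hv _)
  | c =>
    intro v hv w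
    rw [tmul_smul_left_of_grouplike comul_c cInv_mul_c]
    exact hS _ _ (hv _)
  | d =>
    intro v hv w
    rw [tmul_smul_left_of_primitive comul_d cInv_mul_c]
    exact S.sub_mem (hS _ _ (hv _)) (hv _)
  | mul x y hx hy => intro v hv w; rw [op_mul_smul]; exact hy (hx hv) w
  | add x y hx hy =>
    intro v hv w
    rw [MulOpposite.op_add, add_smul, map_add, LinearMap.add_apply]
    exact S.add_mem (hx hv w) (hy hv w)

end Stable

instance : FiniteDimensional k (regular k (TaftDouble k n q)).carrier := finiteDimensional n q

variable (V : RightMod k (TaftDouble k n q))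

theorem rightFree_smul (x : TaftDouble k n q) (v : V.carrier) (y : TaftDouble k n q) :
    rightFree V (V.tmul (regular k _) v y) <• x = rightFree V (V.tmul (regular k _) v (y * x)) := by
  rw [rightFree_tmul, rightFree_tmul, op_mul_smul]

theorem leftFree_smul (x : TaftDouble k n q) (v : V.carrier) (y : TaftDouble k n q) :
    leftFree V (V.freeTmul y v) <• x = leftFree V (V.freeTmul (y * x) v) := by
  rw [leftFree_tmul, leftFree_tmul, op_mul_smul]

/-- Surjectivity amounts to `V ⊗ 1` generating `V ⊗ H`, which holds because the grouplike elements
`b` and `c` are invertible; injectivity follows as the two sides have the same finite dimension. -/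
theorem rightFree_bijective [FiniteDimensional k V.carrier] :
    Function.Bijective (rightFree V) := by
  have hs : Function.Surjective (rightFree V) := by
    let S : AddSubgroup (V.tensor (regular k (TaftDouble k n q))).carrier :=
      (LinearMap.range (rightFree V)).toAddSubgroup
    have hS : ∀ (x : TaftDouble k n q), ∀ t ∈ S, t <• x ∈ S := by
      rintro x _ ⟨t, rfl⟩
      induction t using tensor_induction with
      | zero => rw [map_zero, smul_zero]; exact S.zero_mem
      | tmul v y => exact ⟨_, (rightFree_smul V x v y).symm⟩
      | add s t hs ht => rw [map_add, smul_add]; exact S.add_mem hs ht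
    have h1 : ∀ v, V.tmul (regular k (TaftDouble k n q)) v (1 : TaftDouble k n q) ∈ S := fun v =>
      ⟨V.tmul (regular k (TaftDouble k n q)) v (1 : TaftDouble k n q), by
        refine (rightFree_tmul v _).trans ?_
        rw [MulOpposite.op_one, one_smul]⟩
    intro t
    change t ∈ S
    induction t using tensor_induction with
    | zero => exact S.zero_mem
    | add s t hs ht => exact S.add_mem hs ht
    | tmul v y =>
      have h := congrArg (V.tmul (regular k (TaftDouble k n q)) v)
        (one_mul (show TaftDouble k n q from y))
      exact (congrArg (· ∈ S) h).mp (tmul_smul_mem_right hS (show TaftDouble k n q from y) h1 v)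
  exact ⟨LinearMap.injective_iff_surjective.mpr hs, hs⟩

/-- As for `rightFree`, with the factors exchanged. -/
theorem leftFree_bijective [FiniteDimensional k V.carrier] :
    Function.Bijective (leftFree V) := by
  have hs : Function.Surjective (leftFree V) := by
    let S : AddSubgroup ((regular k (TaftDouble k n q)).tensor V).carrier :=
      (LinearMap.range (leftFree V)).toAddSubgroup
    have hS : ∀ (x : TaftDouble k n q), ∀ t ∈ S, t <• x ∈ S := by
      rintro x _ ⟨t, rfl⟩
      induction t using free_induction with
      | zero => rw [map_zero, smul_zero]; exact S.zero_mem
      | tmul y v => exact ⟨_, (leftFree_smul V x v y).symm⟩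
      | add s t hs ht => rw [map_add, smul_add]; exact S.add_mem hs ht
    have h1 : ∀ v, V.freeTmul (1 : TaftDouble k n q) v ∈ S := fun v =>
      ⟨V.freeTmul (1 : TaftDouble k n q) v, by
        refine (leftFree_tmul _ v).trans ?_
        rw [MulOpposite.op_one, one_smul]⟩
    intro t
    change t ∈ S
    induction t using free_induction with
    | zero => exact S.zero_mem
    | add s t hs ht => exact S.add_mem hs ht
    | tmul y v =>
      have h := congrArg (fun x => V.freeTmul x v) (one_mul y)
      exact (congrArg (· ∈ S) h).mp (tmul_smul_mem_left hS y h1 v)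
  exact ⟨LinearMap.injective_iff_surjective.mpr hs, hs⟩

end TaftDouble

/-! ### The tensor product of bimodules -/

namespace BiMod

variable {A B C : Type u} [Ring A] [Ring B] [Ring C] {X X' : BiMod A B} {Y : BiMod B C}

variable (X Y) in
/-- The elementary tensor `x ⊗ y` in `X ⊗_B Y`. -/
def tmul (x : X.carrier) (y : Y.carrier) : (X.tensor Y).carrier :=
  QuotientAddGroup.mk (x ⊗ₜ[ℤ] y)

theorem smul_tmul (a : A) (x : X.carrier) (y : Y.carrier) :
    a • X.tmul Y x y = X.tmul Y (a • x) y := rfl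

theorem tmul_op_smul (c : C) (x : X.carrier) (y : Y.carrier) :
    op c • X.tmul Y x y = X.tmul Y x (op c • y) := rfl

theorem tmul_balanced (b : B) (x : X.carrier) (y : Y.carrier) :
    X.tmul Y (op b • x) y = X.tmul Y x (b • y) :=
  (QuotientAddGroup.eq_iff_sub_mem).mpr (AddSubgroup.subset_closure ⟨x, b, y, rfl⟩)

theorem tmul_add (x : X.carrier) (y y' : Y.carrier) :
    X.tmul Y x (y + y') = X.tmul Y x y + X.tmul Y x y' :=
  congrArg QuotientAddGroup.mk (TensorProduct.tmul_add x y y')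

theorem add_tmul (x x' : X.carrier) (y : Y.carrier) :
    X.tmul Y (x + x') y = X.tmul Y x y + X.tmul Y x' y :=
  congrArg QuotientAddGroup.mk (TensorProduct.add_tmul x x' y)

theorem tensor_induction {p : (X.tensor Y).carrier → Prop} (zero : p 0)
    (tmul : ∀ x y, p (X.tmul Y x y)) (add : ∀ s t, p s → p t → p (s + t)) (t) : p t := by
  obtain ⟨t, rfl⟩ := QuotientAddGroup.mk_surjective t
  induction t using TensorProduct.induction_on with
  | zero => exact zero
  | tmul x y => exact tmul x y
  | add s t hs ht => exact add _ _ hs ht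

section Lift

variable {P : Type u} [AddCommGroup P] (f : X.carrier →+ Y.carrier →+ P)
  (hf : ∀ (b : B) x y, f (op b • x) y = f x (b • y))

/-- The map out of `X ⊗_B Y` given by a balanced biadditive map. -/
def tensorLift : (X.tensor Y).carrier →+ P :=
  QuotientAddGroup.lift (balancing X Y)
    (TensorProduct.liftAddHom f fun r x y => by
      rw [map_zsmul, map_zsmul, AddMonoidHom.zsmul_apply]) (by
    rw [balancing, AddSubgroup.closure_le]
    rintro _ ⟨x, b, y, rfl⟩
    exact (map_sub _ _ _).trans (sub_eq_zero.mpr (hf b x y)))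

end Lift

theorem Isom.tensor (h : Isom X X') (Y : BiMod B C) : Isom (X.tensor Y) (X'.tensor Y) := by
  have map : ∀ {X X' : BiMod A B} (e : X.carrier ≃+ X'.carrier), IsHom e.toAddMonoidHom →
      ∃ f : (X.tensor Y).carrier →+ (X'.tensor Y).carrier,
        ∀ x y, f (X.tmul Y x y) = X'.tmul Y (e x) y := fun {X X'} e he =>
    ⟨tensorLift
      (AddMonoidHom.mk' (fun x => AddMonoidHom.mk' (fun y => X'.tmul Y (e x) y) (tmul_add _))
        fun x x' => AddMonoidHom.ext fun y => by
          simp only [AddMonoidHom.mk'_apply, AddMonoidHom.add_apply, map_add, add_tmul])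
      (fun b x y => by
        have := he.right b x
        simp only [AddMonoidHom.mk'_apply]
        rw [← tmul_balanced]
        exact congrArg (fun z => X'.tmul Y z y) this), fun x y => rfl⟩
  obtain ⟨e, he⟩ := h
  obtain ⟨f, hf⟩ := map e he
  obtain ⟨g, hg⟩ := map e.symm he.symm
  have hgf : ∀ t, g (f t) = t := fun t => by
    induction t using tensor_induction with
    | zero => rw [map_zero, map_zero]
    | tmul x y => rw [hf, hg, e.symm_apply_apply]
    | add s t hs ht => rw [map_add, map_add, hs, ht]
  have hfg : ∀ t, f (g t) = t := fun t => by
    induction t using tensor_induction with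
    | zero => rw [map_zero, map_zero]
    | tmul x y => rw [hg, hf, e.apply_symm_apply]
    | add s t hs ht => rw [map_add, map_add, hs, ht]
  refine ⟨{ f with invFun := g, left_inv := hgf, right_inv := hfg }, fun a t => ?_, fun c t => ?_⟩
  · change f (a • t) = a • f t
    induction t using tensor_induction with
    | zero => simp
    | tmul x y =>
      rw [smul_tmul, hf, hf, smul_tmul]
      exact congrArg (fun z => X'.tmul Y z y) (he.left a x)
    | add s t hs ht => rw [smul_add, map_add, map_add, smul_add, hs, ht]
  · change f (op c • t) = op c • f t
    induction t using tensor_induction with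
    | zero => simp
    | tmul x y => rw [tmul_op_smul, hf, hf, tmul_op_smul]
    | add s t hs ht => rw [smul_add, map_add, map_add, smul_add, hs, ht]

end BiMod

/-! ### Associativity of the tensor product -/

namespace RightMod

variable {k H : Type u} [Field k] [Ring H] [Bialgebra k H]

/-- The associativity isomorphism. -/
noncomputable def assoc (V W U : RightMod k H) :
    ((V.tensor W).tensor U).carrier ≃ₗ[k] (V.tensor (W.tensor U)).carrier :=
  TensorProduct.assoc k V.carrier W.carrier U.carrier

variable {V W U : RightMod k H}

theorem assoc_tmul (v : V.carrier) (w : W.carrier) (z : U.carrier) :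
    assoc V W U ((V.tensor W).tmul U (V.tmul W v w) z) = V.tmul (W.tensor U) v (W.tmul U w z) := rfl

theorem tensor₃_ext {P : Type u} [AddCommGroup P] [Module k P]
    {f g : ((V.tensor W).tensor U).carrier →ₗ[k] P}
    (h : ∀ v w z, f ((V.tensor W).tmul U (V.tmul W v w) z) =
      g ((V.tensor W).tmul U (V.tmul W v w) z)) : f = g :=
  TensorProduct.ext_threefold h

theorem assoc_smul_of_grouplike {g : H} (hg : Coalgebra.comul (R := k) g = g ⊗ₜ g)
    (t : ((V.tensor W).tensor U).carrier) : assoc V W U (t <• g) = assoc V W U t <• g := by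
  have h : (assoc V W U).toLinearMap ∘ₗ actBy g = actBy g ∘ₗ (assoc V W U).toLinearMap :=
    tensor₃_ext fun v w z => by
      change assoc V W U (_ <• g) = assoc V W U _ <• g
      rw [tmul_smul_of_grouplike hg, tmul_smul_of_grouplike hg, assoc_tmul, assoc_tmul,
        tmul_smul_of_grouplike hg, tmul_smul_of_grouplike hg]
  exact LinearMap.congr_fun h t

theorem assoc_smul_of_primitive {g x : H} (hg : Coalgebra.comul (R := k) g = g ⊗ₜ g)
    (hx : Coalgebra.comul (R := k) x = x ⊗ₜ g + 1 ⊗ₜ x)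
    (t : ((V.tensor W).tensor U).carrier) : assoc V W U (t <• x) = assoc V W U t <• x := by
  have h : (assoc V W U).toLinearMap ∘ₗ actBy x = actBy x ∘ₗ (assoc V W U).toLinearMap :=
    tensor₃_ext fun v w z => by
      change assoc V W U (_ <• x) = assoc V W U _ <• x
      rw [tmul_smul_of_primitive hx, tmul_smul_of_primitive hx, assoc_tmul,
        tmul_smul_of_primitive hx, tmul_smul_of_primitive hx, tmul_smul_of_grouplike hg,
        map_add (assoc V W U), map_add ((V.tensor W).tmul U), LinearMap.add_apply,
        map_add (assoc V W U), assoc_tmul, assoc_tmul, assoc_tmul, map_add (V.tmul _ v), add_assoc]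
  exact LinearMap.congr_fun h t

end RightMod

/-- The associativity isomorphism is a map of right modules. -/
theorem TaftDouble.assoc_smul {k : Type u} [Field k] {n : ℕ} {q : k} [NeZero n]
    [hq : Fact (IsPrimitiveRoot q n)] {V W U : RightMod k (TaftDouble k n q)}
    (x : TaftDouble k n q) (t : ((V.tensor W).tensor U).carrier) :
    RightMod.assoc V W U (t <• x) = RightMod.assoc V W U t <• x :=
  map_smul_of_generators (RightMod.assoc V W U).toLinearMap.toAddMonoidHom
    (RightMod.assoc V W U).map_smul
    (RightMod.assoc_smul_of_primitive comul_b comul_a) (RightMod.assoc_smul_of_grouplike comul_b)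
    (RightMod.assoc_smul_of_grouplike comul_c) (RightMod.assoc_smul_of_primitive comul_c comul_d) x t

/-! ### Relative tensor powers of the double -/

namespace TaftDouble

open RightMod

variable {k : Type u} [Field k] {n : ℕ} {q : k} [NeZero n] [hq : Fact (IsPrimitiveRoot q n)]

/-- The Taft algebra acts on `[1]` through the counit, so `m ↦ m ⊗ [1]` commutes with its action. -/
theorem tmul_toInduced_one_smul_incl (M : RightMod k (TaftDouble k n q)) (r : Taft k n q) :
    ∀ m : M.carrier, M.tmul (inducedModule n q) m (toInduced 1) <• incl n q r =
      M.tmul (inducedModule n q) (m <• incl n q r) (toInduced 1) := by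
  have hb : toInduced 1 <• b n q = toInduced (n := n) (q := q) 1 := by
    rw [toInduced_smul, one_mul, ← mul_one (b n q), toInduced_b_mul]
  have ha : toInduced 1 <• a n q = (0 : (inducedModule n q).carrier) := by
    rw [toInduced_smul, one_mul, ← mul_one (a n q), toInduced_a_mul]
  induction r using Taft.induction with
  | algebraMap c =>
    intro m
    rw [AlgHom.commutes, algebraMap_op_smul, algebraMap_op_smul, map_smul, LinearMap.smul_apply]
  | G => intro m; rw [incl_G, tmul_smul_of_grouplike comul_b, hb]
  | X => intro m; rw [incl_X, tmul_smul_of_primitive comul_a, hb, ha, map_zero, add_zero]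
  | mul x y hx hy => intro m; rw [map_mul, op_mul_smul, op_mul_smul, hx, hy]
  | add x y hx hy =>
    intro m
    rw [map_add, MulOpposite.op_add, add_smul, add_smul, hx, hy, map_add, LinearMap.add_apply]

variable (V : RightMod k (TaftDouble k n q))

/-- The bimodule `(H ⊗ V) ⊗_R H`, for the double `H` of the Taft algebra `R`. -/
noncomputable abbrev relTensor : BiMod (TaftDouble k n q) (TaftDouble k n q) :=
  ((biMod V).restrictRight (incl n q).toRingHom).tensor
    ((BiMod.regular (TaftDouble k n q)).restrictLeft (incl n q).toRingHom)

/-- The elementary tensor `m ⊗ y` in `(H ⊗ V) ⊗_R H`. -/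
noncomputable def relTmul (m : ((regular k _).tensor V).carrier) (y : TaftDouble k n q) :
    (relTensor V).carrier :=
  BiMod.tmul ((biMod V).restrictRight (incl n q).toRingHom)
    ((BiMod.regular (TaftDouble k n q)).restrictLeft (incl n q).toRingHom) m y

variable {V}

theorem relTmul_incl_mul (m : ((regular k _).tensor V).carrier) (r : Taft k n q)
    (y : TaftDouble k n q) : relTmul V m (incl n q r * y) = relTmul V (m <• incl n q r) y :=
  (BiMod.tmul_balanced (X := (biMod V).restrictRight (incl n q).toRingHom)
    (Y := (BiMod.regular (TaftDouble k n q)).restrictLeft (incl n q).toRingHom) r m y).symm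

theorem relTmul_smul (m : ((regular k _).tensor V).carrier) (x y : TaftDouble k n q) :
    relTmul V m y <• x = relTmul V m (y * x) := rfl

theorem smul_relTmul (m : ((regular k _).tensor V).carrier) (x y : TaftDouble k n q) :
    x • relTmul V m y = relTmul V (x • m) y := rfl

theorem relTmul_add_left (m m' : ((regular k _).tensor V).carrier) (y : TaftDouble k n q) :
    relTmul V (m + m') y = relTmul V m y + relTmul V m' y := BiMod.add_tmul ..

theorem relTmul_add_right (m : ((regular k _).tensor V).carrier) (y y' : TaftDouble k n q) :
    relTmul V m (y + y') = relTmul V m y + relTmul V m y' := BiMod.tmul_add ..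

theorem relTensor_induction {p : (relTensor V).carrier → Prop} (zero : p 0)
    (tmul : ∀ m y, p (relTmul V m y)) (add : ∀ s t, p s → p t → p (s + t)) (t) : p t :=
  BiMod.tensor_induction zero tmul add t

variable (V)

/-- The biadditive map `(m, y) ↦ (m ⊗ [1]) · y`. -/
noncomputable def inducedPairing : ((regular k _).tensor V).carrier →+ TaftDouble k n q →+
    (((regular k _).tensor V).tensor (inducedModule n q)).carrier :=
  AddMonoidHom.mk' (fun m => AddMonoidHom.mk' (fun y =>
      RightMod.tmul _ (inducedModule n q) m (toInduced 1) <• y)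
      fun y y' => by rw [MulOpposite.op_add, add_smul])
    fun m m' => AddMonoidHom.ext fun y => by
      rw [AddMonoidHom.add_apply, AddMonoidHom.mk'_apply, AddMonoidHom.mk'_apply,
        AddMonoidHom.mk'_apply, map_add, LinearMap.add_apply, smul_add]

theorem inducedPairing_incl (r : Taft k n q) (m : ((regular k _).tensor V).carrier)
    (y : TaftDouble k n q) :
    inducedPairing V (m <• incl n q r) y = inducedPairing V m (incl n q r * y) := by
  change RightMod.tmul _ _ (m <• incl n q r) (toInduced 1) <• y =
    RightMod.tmul _ _ m (toInduced 1) <• (incl n q r * y)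
  rw [op_mul_smul, tmul_toInduced_one_smul_incl]

/-- The map `m ⊗ y ↦ (m ⊗ [1]) · y` from `(H ⊗ V) ⊗_R H` to `(H ⊗ V) ⊗ Q`. -/
noncomputable def relToInduced :
    (relTensor V).carrier →+ (((regular k _).tensor V).tensor (inducedModule n q)).carrier :=
  BiMod.tensorLift (X := (biMod V).restrictRight (incl n q).toRingHom)
    (Y := (BiMod.regular (TaftDouble k n q)).restrictLeft (incl n q).toRingHom)
    (inducedPairing V) (inducedPairing_incl V)

variable {V}

theorem relToInduced_relTmul (m : ((regular k _).tensor V).carrier) (y : TaftDouble k n q) :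
    relToInduced V (relTmul V m y) =
      RightMod.tmul _ (inducedModule n q) m (toInduced 1) <• y := rfl

theorem relToInduced_smul (t : (relTensor V).carrier) (x : TaftDouble k n q) :
    relToInduced V (t <• x) = relToInduced V t <• x := by
  induction t using relTensor_induction with
  | zero => rw [smul_zero, map_zero, smul_zero]
  | tmul m y => rw [relTmul_smul, relToInduced_relTmul, relToInduced_relTmul, op_mul_smul]
  | add s t hs ht => rw [smul_add, map_add, map_add, hs, ht, smul_add]

theorem relToInduced_surjective : Function.Surjective (relToInduced V) := by
  let S := (relToInduced V).range
  have hS : ∀ (x : TaftDouble k n q), ∀ t ∈ S, t <• x ∈ S := by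
    rintro x _ ⟨t, rfl⟩
    exact ⟨t <• x, relToInduced_smul t x⟩
  have h1 : ∀ m, RightMod.tmul _ (inducedModule n q) m (toInduced 1) ∈ S := fun m =>
    ⟨relTmul V m 1, by rw [relToInduced_relTmul, MulOpposite.op_one, one_smul]⟩
  intro t
  change t ∈ S
  induction t using tensor_induction with
  | zero => exact S.zero_mem
  | add s t hs ht => exact S.add_mem hs ht
  | tmul m w =>
    obtain ⟨x, rfl⟩ := toInduced_surjective w
    have := tmul_smul_mem_right hS x h1 m
    rwa [toInduced_smul, one_mul] at this

variable (V) in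
/-- The biadditive map `(m, y) ↦ m ⊗ y`. -/
noncomputable def relPairing : ((regular k _).tensor V).carrier →+ TaftDouble k n q →+
    (relTensor V).carrier :=
  AddMonoidHom.mk' (fun m => AddMonoidHom.mk' (fun y => relTmul V m y) (relTmul_add_right m))
    fun m m' => AddMonoidHom.ext fun y => relTmul_add_left m m' y

theorem relPairing_smul (r : k) (m : ((regular k _).tensor V).carrier) (y : TaftDouble k n q) :
    relPairing V (r • m) y = relPairing V m (r • y) := by
  change relTmul V (r • m) y = relTmul V m (r • y)
  rw [Algebra.smul_def, ← AlgHom.commutes (incl n q), relTmul_incl_mul, AlgHom.commutes,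
    algebraMap_op_smul]

variable (V) in
/-- The projection from `(H ⊗ V) ⊗ H` to `(H ⊗ V) ⊗_R H`. -/
noncomputable def relProj :
    (((regular k _).tensor V).tensor (regular k (TaftDouble k n q))).carrier →+
      (relTensor V).carrier :=
  TensorProduct.liftAddHom (M := ((regular k (TaftDouble k n q)).tensor V).carrier)
    (N := (regular k (TaftDouble k n q)).carrier) (relPairing V) relPairing_smul

theorem relProj_tmul (m : ((regular k _).tensor V).carrier) (y : TaftDouble k n q) :
    relProj V (RightMod.tmul _ (regular k (TaftDouble k n q)) m y) = relTmul V m y := rfl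

theorem relProj_surjective : Function.Surjective (relProj V) := fun t => by
  induction t using relTensor_induction with
  | zero => exact ⟨0, map_zero _⟩
  | tmul m y => exact ⟨RightMod.tmul _ (regular k (TaftDouble k n q)) m y, relProj_tmul m y⟩
  | add s t hs ht =>
    obtain ⟨s, rfl⟩ := hs
    obtain ⟨t, rfl⟩ := ht
    exact ⟨s + t, map_add _ s t⟩

end TaftDouble

namespace RightMod

variable {k H : Type u} [Field k] [Ring H] [Bialgebra k H] {V : RightMod k H}

/-- The element `v ⊗ y` of `V ⊗ H`. -/
noncomputable abbrev tmulReg (V : RightMod k H) (v : V.carrier) (y : H) :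
    (V.tensor (regular k H)).carrier :=
  V.tmul (regular k H) v y

theorem tensorReg_induction {p : (V.tensor (regular k H)).carrier → Prop} (zero : p 0)
    (tmul : ∀ v (y : H), p (V.tmulReg v y)) (add : ∀ s t, p s → p t → p (s + t)) (t) : p t :=
  tensor_induction zero tmul add t

theorem tmulReg_add (v : V.carrier) (y z : H) :
    V.tmulReg v (y + z) = V.tmulReg v y + V.tmulReg v z :=
  map_add (V.tmul (regular k H) v) _ _

theorem tmulReg_zero (v : V.carrier) : V.tmulReg v (0 : H) = 0 :=
  map_zero (V.tmul (regular k H) v)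

theorem tmulReg_sub (v : V.carrier) (y z : H) :
    V.tmulReg v (y - z) = V.tmulReg v y - V.tmulReg v z :=
  map_sub (V.tmul (regular k H) v) _ _

theorem tmulReg_smul (r : k) (v : V.carrier) (y : H) :
    V.tmulReg v (r • y) = r • V.tmulReg v y :=
  map_smul (V.tmul (regular k H) v) _ _

theorem tmulReg_mul_of_grouplike {g g' : H} (hg : Coalgebra.comul (R := k) g = g ⊗ₜ g)
    (h : g' * g = 1) (v : V.carrier) (y : H) :
    V.tmulReg v (y * g) = V.tmulReg (v <• g') y <• g :=
  tmul_smul_right_of_grouplike (W := regular k H) hg h v y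

theorem tmulReg_mul_of_primitive {g x : H}
    (hx : Coalgebra.comul (R := k) x = x ⊗ₜ g + 1 ⊗ₜ x) (v : V.carrier) (y : H) :
    V.tmulReg v (y * x) = V.tmulReg v y <• x - V.tmulReg (v <• x) (y * g) :=
  tmul_smul_right_of_primitive (W := regular k H) hx v y

theorem rightFree_tmulReg (v : V.carrier) (y : H) :
    rightFree V (V.tmulReg v y) = V.tmulReg v 1 <• y :=
  rightFree_tmul v y

end RightMod

namespace TaftDouble

open RightMod

variable {k : Type u} [Field k] {n : ℕ} {q : k} [NeZero n] [hq : Fact (IsPrimitiveRoot q n)]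

variable (n q) in
/-- The projection of the double onto `Q`. -/
noncomputable def inducedProj :
    (regular k (TaftDouble k n q)).carrier →ₗ[(TaftDouble k n q)ᵐᵒᵖ] (inducedModule n q).carrier :=
  Submodule.mkQ (augmentationIdeal (incl n q))

/-- The kernel of `M ⊗ H → M ⊗ Q` is generated by the tensors `m ⊗ j` with `j ∈ R⁺H`. -/
theorem mem_of_tensorMap_inducedProj_eq_zero {M : RightMod k (TaftDouble k n q)}
    {S : AddSubgroup (M.tensor (regular k (TaftDouble k n q))).carrier}
    (hS : ∀ m, ∀ j ∈ augmentationIdeal (incl n q), M.tmul (regular k (TaftDouble k n q)) m j ∈ S)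
    {t : (M.tensor (regular k (TaftDouble k n q))).carrier}
    (ht : tensorMap LinearMap.id (inducedProj n q) t = 0) : t ∈ S := by
  let I := augmentationIdeal (incl n q)
  have hex := lTensor_exact M.carrier
    (f := (I.subtype).restrictScalars k) (g := (I.mkQ).restrictScalars k)
    (LinearMap.exact_subtype_mkQ I) (Submodule.mkQ_surjective I)
  obtain ⟨s, rfl⟩ := (hex t).mp ht
  clear ht
  induction s using TensorProduct.induction_on with
  | zero => rw [map_zero]; exact S.zero_mem
  | tmul m j => exact hS m j j.2
  | add s s' hs hs' => rw [map_add]; exact S.add_mem hs hs'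

variable {V : RightMod k (TaftDouble k n q)}

theorem relToInduced_relProj (u) : relToInduced V (relProj V u) =
    tensorMap LinearMap.id (inducedProj n q) (rightFree ((regular k _).tensor V) u) := by
  induction u using tensorReg_induction with
  | zero => simp only [map_zero]
  | add s t hs ht => simp only [map_add, hs, ht]
  | tmul m y =>
    refine (relToInduced_relTmul m y).trans ?_
    rw [rightFree_tmulReg, map_smul]
    exact congrArg (· <• y) (tensorMap_tmul LinearMap.id (inducedProj n q) m
      (id (1 : TaftDouble k n q) : (regular k (TaftDouble k n q)).carrier)).symm

theorem relProj_tmulReg (m : ((regular k _).tensor V).carrier) (y : TaftDouble k n q) :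
    relProj V (tmulReg _ m y) = relTmul V m y := rfl

theorem exists_rightFree_smul (x : TaftDouble k n q) (u) :
    ∃ u', rightFree ((regular k _).tensor V) u' = rightFree ((regular k _).tensor V) u <• x ∧
      relProj V u' = relProj V u <• x := by
  induction u using tensorReg_induction with
  | zero => exact ⟨0, by simp only [map_zero, smul_zero], by simp only [map_zero, smul_zero]⟩
  | add s t hs ht =>
    obtain ⟨s', hs, hs'⟩ := hs
    obtain ⟨t', ht, ht'⟩ := ht
    exact ⟨s' + t', by simp only [map_add, hs, ht, smul_add],
      by simp only [map_add, hs', ht', smul_add]⟩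
  | tmul m y =>
    exact ⟨tmulReg _ m (y * x), by
      rw [rightFree_tmulReg, rightFree_tmulReg, op_mul_smul], rfl⟩

variable (V) in
/-- The image under `rightFree` of the kernel of the projection from `(H ⊗ V) ⊗ H` to
`(H ⊗ V) ⊗_R H`. It is stable under the diagonal action of `H`. -/
noncomputable def relKer :
    AddSubgroup (((regular k _).tensor V).tensor (regular k (TaftDouble k n q))).carrier :=
  (relProj V).ker.map (rightFree ((regular k _).tensor V)).toAddMonoidHom

theorem mem_relKer {t} : t ∈ relKer V ↔
    ∃ u, relProj V u = 0 ∧ rightFree ((regular k _).tensor V) u = t := Iff.rfl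

theorem relKer_smul (x : TaftDouble k n q) : ∀ t ∈ relKer V, t <• x ∈ relKer V := by
  intro t ht
  obtain ⟨u, hu, rfl⟩ := mem_relKer.mp ht
  obtain ⟨u', h, h'⟩ := exists_rightFree_smul x u
  exact mem_relKer.mpr ⟨u', by rw [h', hu, smul_zero], h⟩

theorem tmulReg_incl_sub_mem_relKer (r : Taft k n q) : ∀ m : ((regular k _).tensor V).carrier,
    tmulReg _ m (incl n q r - Coalgebra.counit (R := k) r • 1) ∈ relKer V := by
  have hF : ∀ m : ((regular k (TaftDouble k n q)).tensor V).carrier,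
      rightFree _ (tmulReg _ (m <• bInv n q) (b n q)) = tmulReg _ m (b n q) := fun m => by
    rw [rightFree_tmulReg, ← tmulReg_mul_of_grouplike comul_b bInv_mul_b, one_mul]
  have hp : ∀ m : ((regular k (TaftDouble k n q)).tensor V).carrier,
      relProj V (tmulReg _ (m <• bInv n q) (b n q)) = relTmul V m 1 := fun m => by
    rw [relProj_tmulReg, ← mul_one (b n q), ← incl_G, relTmul_incl_mul, incl_G, ← op_mul_smul,
      bInv_mul_b, MulOpposite.op_one, one_smul]
  induction r using Taft.induction with
  | algebraMap c =>
    intro m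
    rw [AlgHom.commutes, Bialgebra.counit_algebraMap, ← Algebra.algebraMap_eq_smul_one, sub_self]
    rw [tmulReg_zero]; exact (relKer V).zero_mem
  | G =>
    intro m
    refine mem_relKer.mpr ⟨tmulReg _ (m <• bInv n q) (b n q) - tmulReg _ m 1, ?_, ?_⟩
    · rw [map_sub, hp, relProj_tmulReg, sub_self]
    · rw [map_sub, hF, rightFree_tmulReg, MulOpposite.op_one, one_smul, incl_G, Taft.counit_G,
        one_smul, tmulReg_sub]
  | X =>
    intro m
    refine mem_relKer.mpr
      ⟨tmulReg _ m (a n q) - tmulReg _ (m <• a n q <• bInv n q) (b n q), ?_, ?_⟩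
    · rw [map_sub, hp, relProj_tmulReg, ← mul_one (a n q), ← incl_X, relTmul_incl_mul, mul_one,
        sub_self]
    · rw [map_sub, hF, rightFree_tmulReg, incl_X, Taft.counit_X, zero_smul, sub_zero]
      have := tmulReg_mul_of_primitive comul_a m 1
      rw [one_mul, one_mul] at this
      exact this.symm
  | mul x y hx hy =>
    intro m
    have h : incl n q (x * y) - Coalgebra.counit (R := k) (x * y) • 1 =
        (incl n q x - Coalgebra.counit (R := k) x • 1) * incl n q y +
          Coalgebra.counit (R := k) x • (incl n q y - Coalgebra.counit (R := k) y • 1) := by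
      rw [map_mul, Bialgebra.counit_mul, sub_mul, smul_sub, smul_mul_assoc, one_mul, smul_smul,
        sub_add_sub_cancel]
    rw [h, tmulReg_add, tmulReg_smul, ← algebraMap_op_smul (H := TaftDouble k n q)]
    exact (relKer V).add_mem (tmul_smul_mem_right relKer_smul (incl n q y) hx m)
      (relKer_smul _ _ (hy m))
  | add x y hx hy =>
    intro m
    rw [map_add, map_add, add_smul, add_sub_add_comm, tmulReg_add]
    exact (relKer V).add_mem (hx m) (hy m)

/-- The kernel of the projection to `(H ⊗ V) ⊗ Q` is contained in `relKer`. -/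
theorem tmulReg_mem_relKer (m : ((regular k _).tensor V).carrier) (j : TaftDouble k n q)
    (hj : j ∈ augmentationIdeal (incl n q)) : tmulReg _ m j ∈ relKer V := by
  induction hj using Submodule.span_induction generalizing m with
  | mem x h =>
    obtain ⟨r, hr, rfl⟩ := h
    have := tmulReg_incl_sub_mem_relKer r m
    rwa [show Coalgebra.counit (R := k) r = 0 from hr, zero_smul, sub_zero] at this
  | zero => rw [tmulReg_zero]; exact (relKer V).zero_mem
  | add x y _ _ hx hy => rw [tmulReg_add]; exact (relKer V).add_mem (hx m) (hy m)
  | smul x y _ hy =>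
    exact tmul_smul_mem_right relKer_smul (MulOpposite.unop x) hy m

theorem relToInduced_injective [FiniteDimensional k V.carrier] :
    Function.Injective (relToInduced V) := by
  refine (injective_iff_map_eq_zero _).mpr fun t ht => ?_
  obtain ⟨u, rfl⟩ := relProj_surjective t
  rw [relToInduced_relProj] at ht
  obtain ⟨u', hu', h⟩ := mem_relKer.mp
    (mem_of_tensorMap_inducedProj_eq_zero (S := relKer V) tmulReg_mem_relKer ht)
  rw [← (rightFree_bijective _).1 h, hu']

/-- `(H ⊗ V) ⊗_R H` is isomorphic to `H ⊗ (V ⊗ Q)`. -/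
theorem relTensor_isom [FiniteDimensional k V.carrier] :
    BiMod.Isom (relTensor V) (biMod (V.tensor (inducedModule n q))) := by
  let e : (relTensor V).carrier ≃+
      (((regular k _).tensor V).tensor (inducedModule n q)).carrier :=
    AddEquiv.ofBijective (relToInduced V) ⟨relToInduced_injective, relToInduced_surjective⟩
  let α := RightMod.assoc (regular k (TaftDouble k n q)) V (inducedModule n q)
  refine ⟨e.trans α.toAddEquiv, fun x t => ?_, fun x t => ?_⟩
  · change α (relToInduced V (x • t)) =
      (x • α (relToInduced V t) : ((regular k _).tensor (V.tensor (inducedModule n q))).carrier)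
    induction t using relTensor_induction with
    | zero => simp only [smul_zero, map_zero]
    | add s t hs ht => simp only [smul_add, map_add, hs, ht]
    | tmul m y =>
      have h : ∀ (m : ((regular k _).tensor V).carrier) z,
          α (RightMod.tmul _ (inducedModule n q) (x • m) z) =
          (x • α (RightMod.tmul _ (inducedModule n q) m z) :
            ((regular k _).tensor (V.tensor (inducedModule n q))).carrier) := fun m z => by
        induction m using free_induction with
        | zero => simp only [smul_zero, map_zero, LinearMap.zero_apply]
        | add s t hs ht => simp only [smul_add, map_add, LinearMap.add_apply, hs, ht]
        | tmul y v => rfl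
      rw [smul_relTmul, relToInduced_relTmul, relToInduced_relTmul, assoc_smul, assoc_smul, h,
        smul_free_op_smul]
  · exact (congrArg α (relToInduced_smul t x)).trans (assoc_smul x _)

end TaftDouble

namespace TaftDouble

open RightMod

variable {k : Type u} [Field k] {n : ℕ} {q : k} [NeZero n] [hq : Fact (IsPrimitiveRoot q n)]
  {V W U : RightMod k (TaftDouble k n q)}

theorem regular_isom : BiMod.Isom (BiMod.regular (TaftDouble k n q))
    (biMod (RightMod.trivial k (TaftDouble k n q))) := by
  let T := RightMod.trivial k (TaftDouble k n q)
  let o : T.carrier := (1 : k)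
  have ho : ∀ x : TaftDouble k n q, Coalgebra.counit (R := k) x = 1 → o <• x = o := fun x hx => by
    rw [trivial_smul, hx, one_smul]
  have ho' : ∀ x : TaftDouble k n q, Coalgebra.counit (R := k) x = 0 → o <• x = 0 := fun x hx => by
    rw [trivial_smul, hx, zero_smul]
  let e : TaftDouble k n q ≃ₗ[k] ((regular k (TaftDouble k n q)).tensor T).carrier :=
    (TensorProduct.rid k (TaftDouble k n q)).symm
  have he : ∀ x, e x = T.freeTmul x o := fun x => rfl
  refine ⟨e.toAddEquiv, fun x y => rfl, fun x y => ?_⟩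
  refine map_smul_of_generators (M := (regular k (TaftDouble k n q)).carrier)
    (N := ((regular k (TaftDouble k n q)).tensor T).carrier) e.toAddEquiv.toAddMonoidHom
    e.map_smul (fun x => ?_) (fun x => ?_) (fun x => ?_) (fun x => ?_) x y
  · refine Eq.trans ?_ (tmul_smul_of_primitive comul_a x o).symm
    rw [ho _ counit_b, ho' _ counit_a, map_zero, add_zero]
    rfl
  · refine Eq.trans ?_ (tmul_smul_of_grouplike comul_b x o).symm
    rw [ho _ counit_b]
    rfl
  · refine Eq.trans ?_ (tmul_smul_of_grouplike comul_c x o).symm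
    rw [ho _ counit_c]
    rfl
  · refine Eq.trans ?_ (tmul_smul_of_primitive comul_d x o).symm
    rw [ho _ counit_c, ho' _ counit_d, map_zero, add_zero]
    rfl

theorem finiteDimensional_inducedPow (hn : 2 ≤ n) (m : ℕ) :
    FiniteDimensional k ((inducedModule n q).tensorPow m).carrier := by
  have := finiteDimensional_inducedModule (q := q) hn
  induction m with
  | zero =>
    exact inferInstanceAs (FiniteDimensional k (RightMod.trivial k (TaftDouble k n q)).carrier)
  | succ m ih =>
    exact inferInstanceAs (FiniteDimensional k
      (((inducedModule n q).tensorPow m).tensor (inducedModule n q)).carrier)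

/-- The relative tensor powers of the double `H` over the Taft algebra are `H ⊗ Q^{⊗ m}`. -/
theorem relTensorPow_isom (hn : 2 ≤ n) (m : ℕ) :
    BiMod.Isom (BiMod.relTensorPow (incl n q).toRingHom m)
      (biMod ((inducedModule n q).tensorPow m)) := by
  induction m with
  | zero => exact regular_isom
  | succ m ih =>
    have := finiteDimensional_inducedPow (q := q) hn m
    exact ((ih.restrictRight (incl n q).toRingHom).tensor _).trans relTensor_isom

/-! ### Maps of modules over the Taft algebra and maps of bimodules -/

/-- A linear map between modules over the double commutes with the action of the Taft algebra. -/
structure IsTaftHom (f : V.carrier →ₗ[k] W.carrier) : Prop where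
  a : ∀ v, f (v <• a n q) = f v <• a n q
  b : ∀ v, f (v <• b n q) = f v <• b n q

theorem IsTaftHom.bInv {f : V.carrier →ₗ[k] W.carrier} (hf : IsTaftHom f) (v : V.carrier) :
    f (v <• bInv n q) = f v <• bInv n q := by
  have h := hf.b (v <• TaftDouble.bInv n q)
  rw [← op_mul_smul, bInv_mul_b, MulOpposite.op_one, one_smul] at h
  rw [h, ← op_mul_smul, b_mul_bInv, MulOpposite.op_one, one_smul]

theorem IsTaftHom.incl {f : V.carrier →ₗ[k] W.carrier} (hf : IsTaftHom f) (r : Taft k n q) :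
    ∀ v, f (v <• incl n q r) = f v <• incl n q r := by
  induction r using Taft.induction with
  | algebraMap c =>
    intro v
    rw [AlgHom.commutes, algebraMap_op_smul, algebraMap_op_smul, map_smul]
  | G => rw [incl_G]; exact hf.b
  | X => rw [incl_X]; exact hf.a
  | mul x y hx hy => intro v; rw [map_mul, op_mul_smul, op_mul_smul, hy, hx]
  | add x y hx hy => intro v; rw [map_add, MulOpposite.op_add, add_smul, add_smul, map_add, hx, hy]

/-- Domination over the Taft algebra, spelled out with linear maps between the modules over the
double. -/
theorem dominated_restrict_iff :
    Dominated (Taft k n q)ᵐᵒᵖ (V.restrict (incl n q)).carrier (W.restrict (incl n q)).carrier ↔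
      ∃ (ι : Type) (_ : Fintype ι) (f : ι → V.carrier →ₗ[k] W.carrier)
        (g : ι → W.carrier →ₗ[k] V.carrier),
        (∀ i, IsTaftHom (f i)) ∧ (∀ i, IsTaftHom (g i)) ∧ ∀ v, ∑ i, g i (f i v) = v := by
  have hto : ∀ {V W : RightMod k (TaftDouble k n q)}
      (f : (V.restrict (incl n q)).carrier →ₗ[(Taft k n q)ᵐᵒᵖ] (W.restrict (incl n q)).carrier),
      ∃ g : V.carrier →ₗ[k] W.carrier, IsTaftHom g ∧ ∀ v, g v = f v := fun {V W} f => by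
    refine ⟨f.restrictScalars k, ⟨fun v => ?_, fun v => ?_⟩, fun v => rfl⟩
    · rw [← incl_X]; exact f.map_smul (op (Taft.X n q)) v
    · rw [← incl_G]; exact f.map_smul (op (Taft.G n q)) v
  have hback : ∀ {V W : RightMod k (TaftDouble k n q)} (g : V.carrier →ₗ[k] W.carrier),
      IsTaftHom g → ∃ f : (V.restrict (incl n q)).carrier →ₗ[(Taft k n q)ᵐᵒᵖ]
        (W.restrict (incl n q)).carrier, ∀ v, f v = g v := fun {V W} g hg =>
    ⟨{ toFun := g
       map_add' := g.map_add
       map_smul' := fun r v => hg.incl (MulOpposite.unop r) v }, fun v => rfl⟩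
  constructor
  · rintro ⟨ι, _, f, g, h⟩
    choose f' hf hf' using fun i => hto (f i)
    choose g' hg hg' using fun i => hto (g i)
    refine ⟨ι, inferInstance, f', g', hf, hg, fun v => ?_⟩
    refine Eq.trans (Finset.sum_congr rfl fun i _ => ?_) (h v)
    exact (hg' i _).trans (congrArg (g i) (hf' i v))
  · rintro ⟨ι, _, f, g, hf, hg, h⟩
    choose f' hf' using fun i => hback (f i) (hf i)
    choose g' hg' using fun i => hback (g i) (hg i)
    refine ⟨ι, inferInstance, f', g', fun v => ?_⟩
    refine Eq.trans (Finset.sum_congr rfl fun i _ => ?_) (h v)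
    exact (hg' i _).trans (congrArg (g i) (hf' i v))

/-- The map `id ⊗ f` on `H ⊗ V`. -/
noncomputable def freeMap (f : V.carrier →ₗ[k] W.carrier) :
    ((regular k (TaftDouble k n q)).tensor V).carrier →ₗ[k]
      ((regular k (TaftDouble k n q)).tensor W).carrier :=
  tensorLift (((regular k (TaftDouble k n q)).tmul W).compl₂ f)

theorem freeMap_freeTmul (f : V.carrier →ₗ[k] W.carrier) (x : TaftDouble k n q) (v : V.carrier) :
    freeMap f (V.freeTmul x v) = W.freeTmul x (f v) :=
  tensorLift_tmul _ _ _

theorem freeMap_smul (f : V.carrier →ₗ[k] W.carrier) (y : TaftDouble k n q)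
    (t : ((regular k (TaftDouble k n q)).tensor V).carrier) :
    freeMap f (y • t) = y • freeMap f t := by
  induction t using free_induction with
  | zero => simp only [smul_zero, map_zero]
  | add s t hs ht => simp only [smul_add, map_add, hs, ht]
  | tmul x v => rw [smul_freeTmul, freeMap_freeTmul, freeMap_freeTmul, smul_freeTmul]

theorem freeTmul_smul_a (x : TaftDouble k n q) (v : V.carrier) :
    V.freeTmul x v <• a n q = V.freeTmul (x * a n q) (v <• b n q) + V.freeTmul x (v <• a n q) :=
  tmul_smul_of_primitive comul_a (id x : (regular k (TaftDouble k n q)).carrier) v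

theorem freeTmul_smul_b (x : TaftDouble k n q) (v : V.carrier) :
    V.freeTmul x v <• b n q = V.freeTmul (x * b n q) (v <• b n q) :=
  tmul_smul_of_grouplike comul_b (id x : (regular k (TaftDouble k n q)).carrier) v

theorem IsTaftHom.freeMap {f : V.carrier →ₗ[k] W.carrier} (hf : IsTaftHom f) :
    IsTaftHom (freeMap f) where
  a t := by
    induction t using free_induction with
    | zero => simp only [smul_zero, map_zero]
    | add s t hs ht => simp only [smul_add, map_add, hs, ht]
    | tmul x v => simp only [freeTmul_smul_a, map_add, freeMap_freeTmul, hf.a, hf.b]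
  b t := by
    induction t using free_induction with
    | zero => simp only [smul_zero, map_zero]
    | add s t hs ht => simp only [smul_add, map_add, hs, ht]
    | tmul x v => simp only [freeTmul_smul_b, freeMap_freeTmul, hf.b]

variable (V) in
/-- The map `x ⊗ v ↦ ε(x) v`. -/
noncomputable def counitMap : ((regular k (TaftDouble k n q)).tensor V).carrier →ₗ[k] V.carrier :=
  tensorLift ((LinearMap.lsmul k V.carrier).comp
    (show (regular k (TaftDouble k n q)).carrier →ₗ[k] k from
      (Coalgebra.counit : TaftDouble k n q →ₗ[k] k)))

theorem counitMap_freeTmul (x : TaftDouble k n q) (v : V.carrier) :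
    counitMap V (V.freeTmul x v) = Coalgebra.counit (R := k) x • v :=
  tensorLift_tmul _ _ _

theorem counitMap_smul (y : TaftDouble k n q)
    (t : ((regular k (TaftDouble k n q)).tensor V).carrier) :
    counitMap V (y • t) = Coalgebra.counit (R := k) y • counitMap V t := by
  induction t using free_induction with
  | zero => simp only [smul_zero, map_zero]
  | add s t hs ht => simp only [smul_add, map_add, hs, ht]
  | tmul x v =>
    rw [smul_freeTmul, counitMap_freeTmul, counitMap_freeTmul, Bialgebra.counit_mul, mul_smul]

theorem isTaftHom_counitMap : IsTaftHom (counitMap V) where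
  a t := by
    induction t using free_induction with
    | zero => simp only [smul_zero, map_zero]
    | add s t hs ht => simp only [smul_add, map_add, hs, ht]
    | tmul x v =>
      rw [freeTmul_smul_a, map_add, counitMap_freeTmul, counitMap_freeTmul, counitMap_freeTmul,
        Bialgebra.counit_mul, counit_a, mul_zero, zero_smul, zero_add, smul_op_smul]
  b t := by
    induction t using free_induction with
    | zero => simp only [smul_zero, map_zero]
    | add s t hs ht => simp only [smul_add, map_add, hs, ht]
    | tmul x v =>
      rw [freeTmul_smul_b, counitMap_freeTmul, counitMap_freeTmul, Bialgebra.counit_mul, counit_b,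
        mul_one, smul_op_smul]

/-- The left action of `b` on `1 ⊗ V`, expressed through the diagonal right action. -/
theorem freeTmul_one_smul_b (v : V.carrier) :
    b n q • V.freeTmul 1 v = V.freeTmul 1 (v <• bInv n q) <• b n q := by
  rw [freeTmul_smul_b, ← op_mul_smul, bInv_mul_b, MulOpposite.op_one, one_smul, smul_freeTmul,
    mul_one, one_mul]

/-- The left action of `a` on `1 ⊗ V`, expressed through the diagonal right action. -/
theorem freeTmul_one_smul_a (v : V.carrier) :
    a n q • V.freeTmul 1 v =
      V.freeTmul 1 (v <• bInv n q) <• a n q - V.freeTmul 1 (v <• bInv n q <• a n q) := by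
  rw [freeTmul_smul_a, ← op_mul_smul _ (bInv n q) (b n q), bInv_mul_b, MulOpposite.op_one,
    one_smul, smul_freeTmul, mul_one, one_mul, add_sub_cancel_right]

/-! ### Bimodule maps over the double and the Taft algebra -/

section Right

theorem isHom_freeMap_right {f : V.carrier →ₗ[k] W.carrier} (hf : IsTaftHom f) :
    BiMod.IsHom (X := (biMod V).restrictRight (incl n q).toRingHom)
      (Y := (biMod W).restrictRight (incl n q).toRingHom) (freeMap f).toAddMonoidHom :=
  ⟨freeMap_smul f, fun r => hf.freeMap.incl r⟩

/-- A map `H ⊗ V → H ⊗ W` linear over the double on the left and over the Taft algebra on the right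
induces a map `V → W` on the quotients by the left action of the augmentation ideal of `H`. -/
theorem exists_hom_of_isHom_right
    {φ : ((regular k (TaftDouble k n q)).tensor V).carrier →+
      ((regular k (TaftDouble k n q)).tensor W).carrier}
    (hφ : BiMod.IsHom (X := (biMod V).restrictRight (incl n q).toRingHom)
      (Y := (biMod W).restrictRight (incl n q).toRingHom) φ) :
    ∃ f : V.carrier →ₗ[k] W.carrier, IsTaftHom f ∧ ∀ t, counitMap W (φ t) = f (counitMap V t) := by
  have hl : ∀ (x : TaftDouble k n q) t, φ (x • t) = x • φ t := hφ.left
  have hr : ∀ (r : Taft k n q) t, φ (t <• incl n q r) = φ t <• incl n q r := hφ.right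
  let f : V.carrier →ₗ[k] W.carrier :=
    { toFun := fun v => counitMap W (φ (V.freeTmul 1 v))
      map_add' := fun v w => by
        rw [show V.freeTmul 1 (v + w) = V.freeTmul 1 v + V.freeTmul (1 : TaftDouble k n q) w from
          map_add _ _ _, map_add, map_add]
      map_smul' := fun r v => by
        rw [show V.freeTmul 1 (r • v) = r • V.freeTmul (1 : TaftDouble k n q) v from
          map_smul _ _ _, ← algebraMap_smul_free, hl, algebraMap_smul_free, map_smul,
          RingHom.id_apply] }
  have hf : ∀ v, f v = counitMap W (φ (V.freeTmul 1 v)) := fun v => rfl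
  have hfb : ∀ v, f (v <• bInv n q) <• b n q = f v := fun v => by
    rw [hf, ← isTaftHom_counitMap.b, ← incl_G, ← hr, incl_G, ← freeTmul_one_smul_b, hl,
      counitMap_smul, counit_b, one_smul, hf]
  have hb : ∀ v, f (v <• b n q) = f v <• b n q := fun v => by
    rw [← hfb (v <• b n q), ← op_mul_smul v, b_mul_bInv, MulOpposite.op_one, one_smul]
  refine ⟨f, ⟨fun v => ?_, hb⟩, fun t => ?_⟩
  · have h := congrArg (fun t => counitMap W (φ t)) (freeTmul_one_smul_a (v <• b n q))
    simp only [hl, map_sub, counitMap_smul, counit_a, zero_smul] at h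
    rw [← op_mul_smul v, b_mul_bInv, MulOpposite.op_one, one_smul, eq_comm, sub_eq_zero, ← incl_X,
      hr, incl_X, isTaftHom_counitMap.a, eq_comm] at h
    exact h
  · induction t using free_induction with
    | zero => simp only [map_zero]
    | add s t hs ht => simp only [map_add, hs, ht]
    | tmul x v =>
      rw [counitMap_freeTmul, map_smul, hf, ← counitMap_smul, ← hl, smul_freeTmul, mul_one]

/-- Over the double on the left and the Taft algebra on the right, `H ⊗ V` and `H ⊗ W` are compared
by comparing `V` and `W` over the Taft algebra. -/
theorem dominated_restrictRight_iff :
    BiMod.Dominated ((biMod V).restrictRight (incl n q).toRingHom)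
      ((biMod W).restrictRight (incl n q).toRingHom) ↔
    Dominated (Taft k n q)ᵐᵒᵖ (V.restrict (incl n q)).carrier (W.restrict (incl n q)).carrier := by
  rw [dominated_restrict_iff]
  constructor
  · rintro ⟨ι, _, φ, ψ, hφ, hψ, h⟩
    choose f hf hf' using fun i => exists_hom_of_isHom_right (hφ i)
    choose g hg hg' using fun i => exists_hom_of_isHom_right (hψ i)
    refine ⟨ι, inferInstance, f, g, hf, hg, fun v => ?_⟩
    have hv : counitMap V (V.freeTmul 1 v) = v := by
      rw [counitMap_freeTmul, Bialgebra.counit_one, one_smul]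
    have h1 := congrArg (counitMap V) (h (V.freeTmul 1 v))
    rw [hv] at h1
    refine Eq.trans ?_ h1
    refine Eq.trans ?_ (map_sum (counitMap V) _ _).symm
    refine Finset.sum_congr rfl fun i _ => ?_
    exact Eq.symm ((hg' i _).trans (congrArg (g i) ((hf' i _).trans (congrArg (f i) hv))))
  · rintro ⟨ι, _, f, g, hf, hg, h⟩
    refine ⟨ι, inferInstance, fun i => (freeMap (f i)).toAddMonoidHom,
      fun i => (freeMap (g i)).toAddMonoidHom, fun i => isHom_freeMap_right (hf i),
      fun i => isHom_freeMap_right (hg i), fun t => ?_⟩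
    change ∑ i, freeMap (g i) (freeMap (f i) t) = t
    induction t using free_induction with
    | zero => simp only [map_zero, Finset.sum_const_zero]
    | add s t hs ht => simp only [map_add, Finset.sum_add_distrib, hs, ht]
    | tmul x v =>
      simp only [freeMap_freeTmul]
      exact (map_sum ((regular k (TaftDouble k n q)).tmul V x) _ _).symm.trans
        (congrArg (V.freeTmul x) (h v))

end Right

section Left

/-- Under `leftFree`, the diagonal right action of `x` becomes the right multiplication on the first
factor; this multiplication `t ↦ s` is compatible with the counit and with the maps `id ⊗ f`. -/
theorem leftFree_op_smul (x : TaftDouble k n q)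
    (t : ((regular k (TaftDouble k n q)).tensor V).carrier) :
    ∃ s, leftFree V s = leftFree V t <• x ∧
      counitMap V s = Coalgebra.counit (R := k) x • counitMap V t ∧
      ∀ {W : RightMod k (TaftDouble k n q)} (f : V.carrier →ₗ[k] W.carrier),
        leftFree W (freeMap f s) = leftFree W (freeMap f t) <• x := by
  induction t using free_induction with
  | zero => exact ⟨0, by simp only [map_zero, smul_zero], by simp only [map_zero, smul_zero],
      fun f => by simp only [map_zero, smul_zero]⟩
  | add t t' ht ht' =>
    obtain ⟨s, h1, h2, h3⟩ := ht
    obtain ⟨s', h1', h2', h3'⟩ := ht'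
    exact ⟨s + s', by simp only [map_add, smul_add, h1, h1'],
      by simp only [map_add, smul_add, h2, h2'], fun f => by
        simp only [map_add, smul_add, h3, h3']⟩
  | tmul y v =>
    refine ⟨V.freeTmul (y * x) v, (leftFree_smul V x v y).symm, ?_, fun {W} f => ?_⟩
    · rw [counitMap_freeTmul, counitMap_freeTmul, Bialgebra.counit_mul, mul_comm, mul_smul]
    · rw [freeMap_freeTmul, freeMap_freeTmul, leftFree_smul]

theorem leftFree_b_smul (x : TaftDouble k n q) (v : V.carrier) :
    b n q • leftFree V (V.freeTmul x v) = leftFree V (V.freeTmul (b n q * x) (v <• bInv n q)) := by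
  rw [leftFree_tmul, leftFree_tmul, ← smul_free_op_smul, freeTmul_one_smul_b, op_mul_smul]

theorem leftFree_a_smul (x : TaftDouble k n q) (v : V.carrier) :
    a n q • leftFree V (V.freeTmul x v) = leftFree V (V.freeTmul (a n q * x) (v <• bInv n q) -
      V.freeTmul x (v <• bInv n q <• a n q)) := by
  rw [map_sub, leftFree_tmul, leftFree_tmul, leftFree_tmul, ← smul_free_op_smul,
    freeTmul_one_smul_a, op_mul_smul, smul_sub]

variable [FiniteDimensional k V.carrier] [FiniteDimensional k W.carrier]

variable (V) in
/-- `leftFree` as an isomorphism. -/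
noncomputable def leftFreeEquiv : ((regular k (TaftDouble k n q)).tensor V).carrier ≃ₗ[k]
    ((regular k (TaftDouble k n q)).tensor V).carrier :=
  LinearEquiv.ofBijective (leftFree V) (leftFree_bijective V)

/-- The map `(1 ⊗ v) · y ↦ (1 ⊗ f v) · y`. -/
noncomputable def leftMap (f : V.carrier →ₗ[k] W.carrier) :
    ((regular k (TaftDouble k n q)).tensor V).carrier →ₗ[k]
      ((regular k (TaftDouble k n q)).tensor W).carrier :=
  leftFree W ∘ₗ freeMap f ∘ₗ (leftFreeEquiv V).symm.toLinearMap

theorem leftMap_leftFree (f : V.carrier →ₗ[k] W.carrier) (t) :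
    leftMap f (leftFree V t) = leftFree W (freeMap f t) :=
  congrArg (fun s => leftFree W (freeMap f s)) ((leftFreeEquiv V).symm_apply_apply t)

theorem exists_leftFree (t : ((regular k (TaftDouble k n q)).tensor V).carrier) :
    ∃ s, leftFree V s = t := (leftFree_bijective V).2 t

theorem isHom_leftMap {f : V.carrier →ₗ[k] W.carrier} (hf : IsTaftHom f) :
    BiMod.IsHom (X := (biMod V).restrictLeft (incl n q).toRingHom)
      (Y := (biMod W).restrictLeft (incl n q).toRingHom) (leftMap f).toAddMonoidHom := by
  have hr : ∀ (x : TaftDouble k n q) t, leftMap f (t <• x) = leftMap f t <• x := fun x t => by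
    obtain ⟨t, rfl⟩ := exists_leftFree t
    obtain ⟨s, h1, -, h3⟩ := leftFree_op_smul x t
    rw [← h1, leftMap_leftFree, leftMap_leftFree, h3]
  have hl : ∀ (r : Taft k n q) t, leftMap f (incl n q r • t) = incl n q r • leftMap f t := by
    intro r
    induction r using Taft.induction with
    | algebraMap c =>
      intro t
      rw [AlgHom.commutes, algebraMap_smul_free, algebraMap_smul_free, map_smul]
    | G =>
      intro t
      rw [incl_G]
      obtain ⟨t, rfl⟩ := exists_leftFree t
      induction t using free_induction with
      | zero => simp only [map_zero, smul_zero]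
      | add s t hs ht => simp only [map_add, smul_add, hs, ht]
      | tmul x v =>
        rw [leftFree_b_smul, leftMap_leftFree, leftMap_leftFree, freeMap_freeTmul, freeMap_freeTmul,
          hf.bInv, leftFree_b_smul]
    | X =>
      intro t
      rw [incl_X]
      obtain ⟨t, rfl⟩ := exists_leftFree t
      induction t using free_induction with
      | zero => simp only [map_zero, smul_zero]
      | add s t hs ht => simp only [map_add, smul_add, hs, ht]
      | tmul x v =>
        rw [leftFree_a_smul, leftMap_leftFree, leftMap_leftFree, map_sub, freeMap_freeTmul,
          freeMap_freeTmul, freeMap_freeTmul, hf.a, hf.bInv, leftFree_a_smul]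
    | mul x y hx hy => intro t; rw [map_mul, mul_smul, mul_smul, hx, hy]
    | add x y hx hy => intro t; rw [map_add, add_smul, add_smul, map_add, hx, hy]
  exact ⟨hl, hr⟩

variable (V) in
/-- The map `(1 ⊗ v) · y ↦ ε(y) v`. -/
noncomputable def leftCounit :
    ((regular k (TaftDouble k n q)).tensor V).carrier →ₗ[k] V.carrier :=
  counitMap V ∘ₗ (leftFreeEquiv V).symm.toLinearMap

theorem leftCounit_leftFree (t) : leftCounit V (leftFree V t) = counitMap V t :=
  congrArg (counitMap V) ((leftFreeEquiv V).symm_apply_apply t)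

theorem leftCounit_op_smul (x : TaftDouble k n q) (t) :
    leftCounit V (t <• x) = Coalgebra.counit (R := k) x • leftCounit V t := by
  obtain ⟨t, rfl⟩ := exists_leftFree t
  obtain ⟨s, h1, h2, -⟩ := leftFree_op_smul x t
  rw [← h1, leftCounit_leftFree, leftCounit_leftFree, h2]

theorem leftCounit_freeTmul_one (v : V.carrier) : leftCounit V (V.freeTmul 1 v) = v := by
  have h : leftFree V (V.freeTmul 1 v) = V.freeTmul 1 v := by
    rw [leftFree_tmul, MulOpposite.op_one, one_smul]
  rw [← h, leftCounit_leftFree, counitMap_freeTmul, Bialgebra.counit_one, one_smul]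

theorem leftCounit_b_smul (t) : leftCounit V (b n q • t) = leftCounit V t <• bInv n q := by
  obtain ⟨t, rfl⟩ := exists_leftFree t
  induction t using free_induction with
  | zero => simp only [map_zero, smul_zero]
  | add s t hs ht => simp only [map_add, smul_add, hs, ht]
  | tmul x v =>
    rw [leftFree_b_smul, leftCounit_leftFree, leftCounit_leftFree, counitMap_freeTmul,
      counitMap_freeTmul, Bialgebra.counit_mul, counit_b, one_mul, smul_op_smul]

theorem leftCounit_a_smul (t) :
    leftCounit V (a n q • t) = - (leftCounit V t <• bInv n q <• a n q) := by
  obtain ⟨t, rfl⟩ := exists_leftFree t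
  induction t using free_induction with
  | zero => simp only [map_zero, smul_zero, neg_zero]
  | add s t hs ht => simp only [map_add, smul_add, hs, ht, neg_add]
  | tmul x v =>
    rw [leftFree_a_smul, leftCounit_leftFree, leftCounit_leftFree, map_sub, counitMap_freeTmul,
      counitMap_freeTmul, counitMap_freeTmul, Bialgebra.counit_mul, counit_a, zero_mul, zero_smul,
      zero_sub, smul_op_smul, smul_op_smul]

/-- A map `H ⊗ V → H ⊗ W` linear over the Taft algebra on the left and over the double on the right
induces a map `V → W` on the quotients by the right action of the augmentation ideal of `H`. -/
theorem exists_hom_of_isHom_left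
    {φ : ((regular k (TaftDouble k n q)).tensor V).carrier →+
      ((regular k (TaftDouble k n q)).tensor W).carrier}
    (hφ : BiMod.IsHom (X := (biMod V).restrictLeft (incl n q).toRingHom)
      (Y := (biMod W).restrictLeft (incl n q).toRingHom) φ) :
    ∃ f : V.carrier →ₗ[k] W.carrier, IsTaftHom f ∧
      ∀ t, leftCounit W (φ t) = f (leftCounit V t) := by
  have hl : ∀ (r : Taft k n q) t, φ (incl n q r • t) = incl n q r • φ t := hφ.left
  have hr : ∀ (x : TaftDouble k n q) t, φ (t <• x) = φ t <• x := hφ.right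
  let f : V.carrier →ₗ[k] W.carrier :=
    { toFun := fun v => leftCounit W (φ (V.freeTmul 1 v))
      map_add' := fun v w => by
        rw [show V.freeTmul 1 (v + w) = V.freeTmul 1 v + V.freeTmul (1 : TaftDouble k n q) w from
          map_add _ _ _, map_add, map_add]
      map_smul' := fun r v => by
        rw [show V.freeTmul 1 (r • v) = r • V.freeTmul (1 : TaftDouble k n q) v from
          map_smul _ _ _, ← algebraMap_op_smul (H := TaftDouble k n q), hr, algebraMap_op_smul,
          map_smul, RingHom.id_apply] }
  have hf : ∀ v, f v = leftCounit W (φ (V.freeTmul 1 v)) := fun v => rfl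
  have hbInv : ∀ v, f (v <• bInv n q) = f v <• bInv n q := fun v => by
    have h := congrArg (fun t => leftCounit W (φ t)) (freeTmul_one_smul_b v)
    simp only [hr] at h
    rw [← incl_G, hl, incl_G, leftCounit_b_smul, leftCounit_op_smul, counit_b, one_smul] at h
    exact h.symm
  have hb : ∀ v, f (v <• b n q) = f v <• b n q := fun v => by
    have h := congrArg (fun w => w <• b n q) (hbInv (v <• b n q))
    simp only [← op_mul_smul, bInv_mul_b, b_mul_bInv, MulOpposite.op_one, one_smul] at h
    exact h.symm
  refine ⟨f, ⟨fun v => ?_, hb⟩, fun t => ?_⟩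
  · have h := congrArg (fun t => leftCounit W (φ t)) (freeTmul_one_smul_a (v <• b n q))
    simp only [hr, map_sub, leftCounit_op_smul, counit_a, zero_smul, zero_sub] at h
    rw [← incl_X, hl, incl_X, leftCounit_a_smul, neg_inj, ← hf, ← hf, hb, ← op_mul_smul v,
      ← op_mul_smul (f v), b_mul_bInv, MulOpposite.op_one, one_smul, one_smul] at h
    exact h.symm
  · obtain ⟨t, rfl⟩ := exists_leftFree t
    induction t using free_induction with
    | zero => simp only [map_zero]
    | add s t hs ht => simp only [map_add, hs, ht]
    | tmul x v =>
      rw [leftCounit_leftFree, counitMap_freeTmul, map_smul, leftFree_tmul, hr, leftCounit_op_smul,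
        hf]

/-- Over the Taft algebra on the left and the double on the right, `H ⊗ V` and `H ⊗ W` are compared
by comparing `V` and `W` over the Taft algebra. -/
theorem dominated_restrictLeft_iff :
    BiMod.Dominated ((biMod V).restrictLeft (incl n q).toRingHom)
      ((biMod W).restrictLeft (incl n q).toRingHom) ↔
    Dominated (Taft k n q)ᵐᵒᵖ (V.restrict (incl n q)).carrier (W.restrict (incl n q)).carrier := by
  rw [dominated_restrict_iff]
  constructor
  · rintro ⟨ι, _, φ, ψ, hφ, hψ, h⟩
    choose f hf hf' using fun i => exists_hom_of_isHom_left (hφ i)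
    choose g hg hg' using fun i => exists_hom_of_isHom_left (hψ i)
    refine ⟨ι, inferInstance, f, g, hf, hg, fun v => ?_⟩
    have hv := leftCounit_freeTmul_one v
    have h1 := congrArg (leftCounit V) (h (V.freeTmul 1 v))
    rw [hv] at h1
    refine Eq.trans ?_ h1
    refine Eq.trans ?_ (map_sum (leftCounit V) _ _).symm
    refine Finset.sum_congr rfl fun i _ => ?_
    exact Eq.symm ((hg' i _).trans (congrArg (g i) ((hf' i _).trans (congrArg (f i) hv))))
  · rintro ⟨ι, _, f, g, hf, hg, h⟩
    refine ⟨ι, inferInstance, fun i => (leftMap (f i)).toAddMonoidHom,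
      fun i => (leftMap (g i)).toAddMonoidHom, fun i => isHom_leftMap (hf i),
      fun i => isHom_leftMap (hg i), fun t => ?_⟩
    change ∑ i, leftMap (g i) (leftMap (f i) t) = t
    obtain ⟨t, rfl⟩ := exists_leftFree t
    simp only [leftMap_leftFree, ← map_sum]
    refine congrArg (leftFree V) ?_
    induction t using free_induction with
    | zero => simp only [map_zero, Finset.sum_const_zero]
    | add s t hs ht => simp only [map_add, Finset.sum_add_distrib, hs, ht]
    | tmul x v =>
      simp only [freeMap_freeTmul]
      exact (map_sum ((regular k (TaftDouble k n q)).tmul V x) _ _).symm.trans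
        (congrArg (V.freeTmul x) (h v))

end Left

end TaftDouble

namespace TaftDouble

open RightMod

variable {k : Type u} [Field k] {n : ℕ} {q : k} [NeZero n] [hq : Fact (IsPrimitiveRoot q n)]

/-! ### The minimum even depth -/

theorem restrict_trivial_equiv :
    Nonempty (((RightMod.trivial k (TaftDouble k n q)).restrict (incl n q)).carrier
      ≃ₗ[(Taft k n q)ᵐᵒᵖ] (RightMod.trivial k (Taft k n q)).carrier) := by
  let f : ((RightMod.trivial k (TaftDouble k n q)).restrict (incl n q)).carrier →ₗ[k]
    (RightMod.trivial k (Taft k n q)).carrier := LinearMap.id (R := k) (M := k)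
  refine ⟨LinearEquiv.ofBijective (Taft.linearMap f (fun v => ?_) fun v => ?_)
    Function.bijective_id⟩
  · refine Eq.trans ?_ (trivial_smul (k := k) (H := Taft k n q) (f v) (Taft.G n q)).symm
    refine (trivial_smul (k := k) (H := TaftDouble k n q) v (incl n q (Taft.G n q))).trans ?_
    rw [incl_G, counit_b, Taft.counit_G]
    rfl
  · refine Eq.trans ?_ (trivial_smul (k := k) (H := Taft k n q) (f v) (Taft.X n q)).symm
    refine (trivial_smul (k := k) (H := TaftDouble k n q) v (incl n q (Taft.X n q))).trans ?_
    rw [incl_X, counit_a, Taft.counit_X]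
    rfl

/-- The Taft algebra is a sub-bialgebra of the double, so restriction is monoidal. -/
theorem restrict_tensor_equiv (V W : RightMod k (TaftDouble k n q)) :
    Nonempty (((V.tensor W).restrict (incl n q)).carrier ≃ₗ[(Taft k n q)ᵐᵒᵖ]
      ((V.restrict (incl n q)).tensor (W.restrict (incl n q))).carrier) := by
  let V' := V.restrict (incl n q)
  let W' := W.restrict (incl n q)
  let f : ((V.tensor W).restrict (incl n q)).carrier →ₗ[k] (V'.tensor W').carrier :=
    LinearMap.id (R := k) (M := V.carrier ⊗[k] W.carrier)
  refine ⟨LinearEquiv.ofBijective (Taft.linearMap f (fun t => ?_) fun t => ?_)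
    Function.bijective_id⟩
  · refine LinearMap.congr_fun (f := f ∘ₗ actBy (Taft.G n q)) (g := actBy (Taft.G n q) ∘ₗ f)
      (tensor_ext (V := V) (W := W) fun v w => ?_) t
    refine Eq.trans ?_ (tmul_smul_of_grouplike (V := V') (W := W') Taft.comul_G v w).symm
    change V.tmul W v w <• incl n q (Taft.G n q) =
      V.tmul W (v <• incl n q (Taft.G n q)) (w <• incl n q (Taft.G n q))
    rw [incl_G, tmul_smul_of_grouplike comul_b]
  · refine LinearMap.congr_fun (f := f ∘ₗ actBy (Taft.X n q)) (g := actBy (Taft.X n q) ∘ₗ f)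
      (tensor_ext (V := V) (W := W) fun v w => ?_) t
    refine Eq.trans ?_ (tmul_smul_of_primitive (V := V') (W := W') Taft.comul_X v w).symm
    change V.tmul W v w <• incl n q (Taft.X n q) =
      V.tmul W (v <• incl n q (Taft.X n q)) (w <• incl n q (Taft.G n q)) +
        V.tmul W v (w <• incl n q (Taft.X n q))
    rw [incl_G, incl_X, tmul_smul_of_primitive comul_a]

/-- The restriction of `Q^{⊗ m}` from the double is the tensor power of `Q` over the Taft algebra, up
to domination in both directions. -/
theorem restrict_tensorPow (m : ℕ) :
    Dominated (Taft k n q)ᵐᵒᵖ (((inducedModule n q).tensorPow m).restrict (incl n q)).carrier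
      ((Q n q).tensorPow m).carrier ∧
    Dominated (Taft k n q)ᵐᵒᵖ ((Q n q).tensorPow m).carrier
      (((inducedModule n q).tensorPow m).restrict (incl n q)).carrier := by
  induction m with
  | zero =>
    obtain ⟨e⟩ := restrict_trivial_equiv (n := n) (q := q)
    exact ⟨.of_equiv e, .of_equiv e.symm⟩
  | succ m ih =>
    obtain ⟨e⟩ := restrict_tensor_equiv ((inducedModule n q).tensorPow m) (inducedModule n q)
    exact ⟨(Dominated.of_equiv e).trans (dominated_tensor ih.1 .refl),
      (dominated_tensor ih.2 .refl).trans (.of_equiv e.symm)⟩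

theorem dominated_restrict_tensorPow_iff (i j : ℕ) :
    Dominated (Taft k n q)ᵐᵒᵖ (((inducedModule n q).tensorPow i).restrict (incl n q)).carrier
      (((inducedModule n q).tensorPow j).restrict (incl n q)).carrier ↔
    Dominated (Taft k n q)ᵐᵒᵖ ((Q n q).tensorPow i).carrier ((Q n q).tensorPow j).carrier :=
  ⟨fun h => ((restrict_tensorPow i).2.trans h).trans (restrict_tensorPow j).1,
    fun h => ((restrict_tensorPow i).1.trans h).trans (restrict_tensorPow j).2⟩

/-- Right depth is decided by the tensor powers of `Q`. -/
theorem similar_restrictRight_iff (hn : 2 ≤ n) (i j : ℕ) :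
    ((BiMod.relTensorPow (incl n q).toRingHom i).restrictRight (incl n q).toRingHom).Similar
      ((BiMod.relTensorPow (incl n q).toRingHom j).restrictRight (incl n q).toRingHom) ↔
    ((Q n q).tensorPow i).Similar ((Q n q).tensorPow j) := by
  rw [BiMod.similar_congr ((relTensorPow_isom hn i).restrictRight _)
    ((relTensorPow_isom hn j).restrictRight _), BiMod.similar_iff, dominated_restrictRight_iff,
    dominated_restrictRight_iff, dominated_restrict_tensorPow_iff,
    dominated_restrict_tensorPow_iff, RightMod.similar_iff]

/-- Left depth is decided by the tensor powers of `Q`. -/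
theorem similar_restrictLeft_iff (hn : 2 ≤ n) (i j : ℕ) :
    ((BiMod.relTensorPow (incl n q).toRingHom i).restrictLeft (incl n q).toRingHom).Similar
      ((BiMod.relTensorPow (incl n q).toRingHom j).restrictLeft (incl n q).toRingHom) ↔
    ((Q n q).tensorPow i).Similar ((Q n q).tensorPow j) := by
  have := finiteDimensional_inducedPow (q := q) hn i
  have := finiteDimensional_inducedPow (q := q) hn j
  rw [BiMod.similar_congr ((relTensorPow_isom hn i).restrictLeft _)
    ((relTensorPow_isom hn j).restrictLeft _), BiMod.similar_iff, dominated_restrictLeft_iff,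
    dominated_restrictLeft_iff, dominated_restrict_tensorPow_iff,
    dominated_restrict_tensorPow_iff, RightMod.similar_iff]

theorem isLeast_similar_tensorPow (hn : 2 ≤ n) :
    IsLeast {d : ℕ | ∃ m : ℕ, d = 2 * (m + 1) ∧
      ((Q n q).tensorPow m).Similar ((Q n q).tensorPow (m + 1))} 6 := by
  refine ⟨⟨2, rfl, RightMod.similar_iff.mpr
    ⟨(tensorPow_dominated hn 2).trans (dominated_tensorPow hn 1),
      (tensorPow_dominated hn 3).trans (dominated_tensorPow hn 0)⟩⟩, ?_⟩
  rintro d ⟨m, rfl, hm⟩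
  obtain ⟨-, h⟩ := RightMod.similar_iff.mp hm
  by_contra! hlt
  obtain rfl | rfl : m = 0 ∨ m = 1 := by omega
  · exact not_dominated_trivial hn (dominated_tensorPow_one.trans h)
  · exact not_dominated_Q hn (((dominated_tensorPow hn 0).trans h).trans tensorPow_one_dominated)

end TaftDouble

end QuantumDepth

theorem corollary5p3 {k : Type u} [Field k] (n : ℕ) [NeZero n] (hn : 2 ≤ n) (q : k)
    [hq : Fact (IsPrimitiveRoot q n)] :
    ¬ (QuantumDepth.TaftDouble.Q n q).Similar
        ((QuantumDepth.TaftDouble.Q n q).tensor (QuantumDepth.TaftDouble.Q n q)) ∧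
    ((QuantumDepth.TaftDouble.Q n q).tensor (QuantumDepth.TaftDouble.Q n q)).Similar
        (((QuantumDepth.TaftDouble.Q n q).tensor (QuantumDepth.TaftDouble.Q n q)).tensor
          (QuantumDepth.TaftDouble.Q n q)) ∧
    (QuantumDepth.TaftDouble.Q n q).HasDepth 2 ∧
    IsLeast {d : ℕ | QuantumDepth.BiMod.HasRightEvenDepth
      (QuantumDepth.TaftDouble.incl n q).toRingHom d} 6 ∧
    IsLeast {d : ℕ | QuantumDepth.BiMod.HasLeftEvenDepth
      (QuantumDepth.TaftDouble.incl n q).toRingHom d} 6 := by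
  open QuantumDepth TaftDouble in
  have := finiteDimensional_Q (q := q) hn
  refine ⟨fun h => not_dominated_Q hn (RightMod.similar_iff.mp h).2,
    RightMod.similar_iff.mpr ⟨RightMod.dominated_tensor (Q_dominated_tensor hn) .refl,
      dominated_Q_tensor_Q hn _⟩, hasDepth_two hn, ?_, ?_⟩
  · simpa only [BiMod.HasRightEvenDepth, similar_restrictRight_iff hn]
      using isLeast_similar_tensorPow (q := q) hn
  · simpa only [BiMod.HasLeftEvenDepth, similar_restrictLeft_iff hn]
      using isLeast_similar_tensorPow (q := q) hn
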